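/- **Trees.** A simplicial tree is a nonempty, connected, locally finite 1-dimensional simplicial complex without cycles; $E_v$ denotes the set of edges at a vertex $v$, and the valence of $v$ is $|E_v|$. Let $F:T\to T$ be a branched covering of a simplicial tree, that is, a simplicial map (each edge is mapped linearly onto an edge) that is continuous, open and proper. A local degree function for $F$ assigns an integer $\deg\ge 1$ to each vertex and edge so that for every vertex $v$ $$2\deg(v)-2\ \ge\ \sum_{e\in E_v}(\deg(e)-1),\qquad \deg(v)=\sum_{e'\in E_v,\ F(e')=F(e)}\deg(e')\quad\text{for every } e\in E_v ,$$ and $F$ has degree $D$ if $\sum_{F(u)=v}\deg(u)=D$ for every vertex $v$. The map $F$ is *polynomial-like* if $T$ has a unique isolated end $\infty$, $F$ has a local degree function, $T$ has no vertex of valence one, and the grand orbit of every vertex contains a vertex of valence at least $3$. A *height metric* is a path metric on $T$, linear on edges, with $\operatorname{dist}(F(e))=D\operatorname{dist}(e)$ for every edge $e$, where $D$ is the degree of $F$; the triple $(T,\operatorname{dist},F)$ is then a *metrized polynomial-like tree* of degree $D$. Let $\mathcal T_D$ be the set of these triples up to isometries conjugating the dynamics. **Strong convergence.** The base $v_0$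 is the vertex of valence at least $3$ closest to $\infty$. The combinatorial height $h(v)\in\mathbb Z$ of a vertex is, up to sign, the number of edges from $v_0$ to $v$, with $h\ge 0$ on $[v_0,\infty)$ and $h\le 0$ elsewhere. Let $v_i$ be the vertex of height $i\ge 0$, let $N(F)=h(F(v_0))$, and let $T(k)$ be the finite subtree spanned by the vertices with $|h(v)|\le kN(F)$. A sequence $(T_n,\operatorname{dist}_n,F_n)$ of metrized polynomial-like trees of degree $D$ converges strongly if (1) $\operatorname{dist}_n(v_0,v_i)$ converges for $i=1,\dots,D$; (2) $\lim\operatorname{dist}_n(v_0,v_D)>0$; (3) for each $k>0$ and all large $n$ there is a simplicial isomorphism $T_n(k)\cong T_{n+1}(k)$ preserving the base and respecting the dynamics. There is then a simplicial tree $T'$ with dynamics $F'$ such that, for each $k>0$, $T'(k)\cong T_n(k)$ for all large $n$, by isomorphisms preserving the base and respecting the dynamics; the metrics $\operatorname{dist}_n$ converge to a pseudo-metric on $T'$; and the limit of the sequence is the triple $(T,\operatorname{dist},F)$ obtained from $T'$ by collapsing the edges of length zero to points, the vertices of $T$ being the points in the grand orbits of its branch points. **Topology.** The *geometric topology* on $\mathcal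 T_D$ is the finest topology in which every strongly convergent sequence converges to its limit. The group $\mathbb R_+$ of positive reals acts on $\mathcal T_D$ by rescaling the metric, and $\mathbb P\mathcal T_D=\mathcal T_D/\mathbb R_+$ carries the quotient topology. **Theorem.** For every integer $D\ge 2$, the geometric topology on $\mathcal T_D$ is metrizable, and the projective space $\mathbb P\mathcal T_D$ is compact, Hausdorff and contractible. -/

import Mathlib

open Filter Topology

noncomputable section

namespace PolyTree

/-- A simplicial tree (nonempty, connected, locally finite, no cycles), presented by its graph of
vertices and edges, together with a branched covering `F` of the tree to itself, presented by its
action on vertices.  Being simplicial, `F` maps each edge `[v, w]` linearly onto the edge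
`[F v, F w]`, so it is continuous; it is open exactly when the edges at each vertex `v` map onto
the edges at `F v`, and it is proper exactly when its fibres over vertices are finite. -/
structure TreeMap where
  V : Type
  G : SimpleGraph V
  F : V → V
  isTree : G.IsTree
  locallyFinite : ∀ v, (G.neighborSet v).Finite
  /-- `F` is simplicial -/
  map_adj : ∀ v w, G.Adj v w → G.Adj (F v) (F w)
  /-- `F` is open -/
  map_open : ∀ v u, G.Adj (F v) u → ∃ w, G.Adj v w ∧ F w = u
  /-- `F` is proper -/
  map_proper : ∀ v, (F ⁻¹' {v}).Finite

namespace TreeMap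

variable (T : TreeMap)

instance : Nonempty T.V := T.isTree.connected.nonempty

/-- The valence of a vertex. -/
def val (v : T.V) : ℕ := (T.G.neighborSet v).ncard

/-- The space of ends of the tree is the inverse limit of the sets of components of the complements
of finite sets `K`.  An end `e` is isolated in the inverse limit topology iff it is the only end
lying in its component of the complement of some finite `K`. -/
def IsIsolatedEnd (e : T.G.end) : Prop :=
  ∃ K : Finset T.V, ∀ e' : T.G.end, e'.1 (Opposite.op K) = e.1 (Opposite.op K) → e' = e

/-- There is a unique isolated end, called `∞`. -/
def HasInfinity : Prop := ∃! e : T.G.end, T.IsIsolatedEnd e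

/-- The vertex `w` lies on the path `[v, ∞)`: either `w = v` or removing `w` separates `v` from the
isolated end `∞`.  (The component of `∞` in the complement of `w` does not contain `w`.) -/
def OnRay (v w : T.V) : Prop :=
  ∃ e : T.G.end, T.IsIsolatedEnd e ∧
    v ∉ SimpleGraph.ComponentCompl.supp (K := (({w} : Finset T.V) : Set T.V))
      (e.1 (Opposite.op {w}))

/-- `v` is the vertex of valence at least `3` closest to `∞`: it lies on the path to `∞` from every
vertex of valence at least `3`. -/
def IsBase (v : T.V) : Prop := 3 ≤ T.val v ∧ ∀ w, 3 ≤ T.val w → T.OnRay w v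

/-- The base `v₀` of the tree. -/
def base : T.V := Classical.epsilon T.IsBase

open Classical in
/-- The combinatorial height `h : V → ℤ`: its absolute value is the number of edges needed to
connect `v` to the base, and it is `≥ 0` on `[v₀, ∞)` and `≤ 0` elsewhere. -/
def height (v : T.V) : ℤ :=
  if T.OnRay T.base v then (T.G.dist T.base v : ℤ) else -(T.G.dist T.base v : ℤ)

/-- The integer `N(F)` by which `F` raises the combinatorial height; it is the height of
`F v₀`. -/
def N : ℤ := T.height (T.F T.base)

/-- The unique vertex `v_i` at combinatorial height `i ≥ 0`. -/
def spine (i : ℕ) : T.V := Classical.epsilon fun v => T.height v = i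

/-- The vertices of the finite subtree `T(k)` spanned by the vertices of combinatorial height
between `-k N(F)` and `k N(F)`. -/
def level (k : ℕ) : Set T.V := {v | -(k * T.N) ≤ T.height v ∧ T.height v ≤ k * T.N}

/-- A simplicial isomorphism `T(k) ≅ T'(k)` of finite subtrees, pointed by their bases, respecting
the dynamics: `F x = y` in `T(k)` iff the corresponding relation holds in `T'(k)`. -/
structure LevelIso (T T' : TreeMap) (k : ℕ) where
  iso : T.G.induce (T.level k) ≃g T'.G.induce (T'.level k)
  map_base : ∀ x, x.1 = T.base ↔ (iso x).1 = T'.base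
  map_dyn : ∀ x y, T.F x.1 = y.1 ↔ T'.F (iso x).1 = (iso y).1

/-- `degV`, `degE` form a local degree function for `F` (the values of `degE` matter on edges
only). -/
structure IsLocalDegree (degV : T.V → ℕ) (degE : Sym2 T.V → ℕ) : Prop where
  vertex_pos : ∀ v, 1 ≤ degV v
  edge_pos : ∀ e ∈ T.G.edgeSet, 1 ≤ degE e
  /-- `2 deg v - 2 ≥ ∑ (deg e - 1)` over the edges `e` at `v` -/
  ineq : ∀ v, ∑ᶠ w ∈ T.G.neighborSet v, ((degE s(v, w) : ℤ) - 1) ≤ 2 * (degV v : ℤ) - 2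
  /-- `deg v = ∑ deg e'` over the edges `e'` at `v` with `F e' = F e`, for every edge `e` at `v` -/
  eq : ∀ v w, T.G.Adj v w →
    degV v = ∑ᶠ w' ∈ {w' | T.G.Adj v w' ∧ s(T.F v, T.F w') = s(T.F v, T.F w)}, degE s(v, w')

/-- The branched covering `F` has a compatible local degree function, with global degree
`D = ∑ deg v₁` over the preimages `v₁` of any vertex. -/
def HasDegree (D : ℕ) : Prop :=
  ∃ (degV : T.V → ℕ) (degE : Sym2 T.V → ℕ), T.IsLocalDegree degV degE ∧
    ∀ v, ∑ᶠ u ∈ T.F ⁻¹' {v}, degV u = D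

/-- `x` and `y` lie in the same grand orbit. -/
def SameGrandOrbit (x y : T.V) : Prop :=
  ∃ n m : ℕ, 0 < n ∧ 0 < m ∧ T.F^[n] x = T.F^[m] y

/-- `F` is polynomial-like, of degree `D`. -/
structure IsPolynomialLike (D : ℕ) : Prop where
  hasInfinity : T.HasInfinity
  hasDegree : T.HasDegree D
  no_endpoints : ∀ v, T.val v ≠ 1
  grand_orbit : ∀ v, ∃ w, T.SameGrandOrbit v w ∧ 3 ≤ T.val w

/-- `d` is (the restriction to vertices of) a height metric on the tree, `D` being the degree of
`F`: a path metric, linear on edges and hence determined by its restriction to vertices, which is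
expanded by the factor `D` on each edge. -/
structure IsHeightMetric (D : ℕ) (d : T.V → T.V → ℝ) : Prop where
  self : ∀ x, d x x = 0
  eq_of_zero : ∀ x y, d x y = 0 → x = y
  symm : ∀ x y, d x y = d y x
  triangle : ∀ x y z, d x z ≤ d x y + d y z
  /-- additivity when `y` lies on the arc from `x` to `z` -/
  path : ∀ x y z (p : T.G.Walk x z), p.IsPath → y ∈ p.support → d x y + d y z = d x z
  expand : ∀ x y, T.G.Adj x y → d (T.F x) (T.F y) = D * d x y

end TreeMap

/-- A metrized polynomial-like tree `(T, dist, F)` of degree `D`. (A locally finite connected graph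
is countable, so vertex sets in `Type` suffice.) -/
structure MTree (D : ℕ) extends TreeMap where
  polyLike : toTreeMap.IsPolynomialLike D
  d : V → V → ℝ
  heightMetric : toTreeMap.IsHeightMetric D d

/-- Equivalence of metrized polynomial-like trees: an isometry conjugating the dynamics.  The
vertices are the points in the grand orbits of the branch points, so an isometry of trees
conjugating the dynamics restricts to one of the vertex sets, and conversely an isometry of the
vertex sets preserves adjacency (no third vertex in between) and extends linearly over edges. -/
def MTree.Equivalent {D : ℕ} (X Y : MTree D) : Prop :=
  ∃ i : X.V ≃ Y.V, (∀ x y, Y.d (i x) (i y) = X.d x y) ∧ ∀ x, i (X.F x) = Y.F (i x)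

instance MTree.setoid (D : ℕ) : Setoid (MTree D) where
  r := MTree.Equivalent
  iseqv :=
    { refl := fun _ => ⟨Equiv.refl _, fun _ _ => rfl, fun _ => rfl⟩
      symm := by
        rintro X Y ⟨i, hd, hF⟩
        refine ⟨i.symm, fun x y => ?_, fun x => ?_⟩
        · rw [← hd, i.apply_symm_apply, i.apply_symm_apply]
        · apply i.injective
          rw [hF, i.apply_symm_apply, i.apply_symm_apply]
      trans := by
        rintro X Y Z ⟨i, hd, hF⟩ ⟨j, hd', hF'⟩
        exact ⟨i.trans j, fun x y => by simp [hd, hd'], fun x => by simp [hF, hF']⟩ }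

/-- The moduli space `𝒯_D` of metrized polynomial-like trees of degree `D`. -/
def TD (D : ℕ) : Type 1 := Quotient (MTree.setoid D)

/-- The class of a tree in `𝒯_D`. -/
def TD.mk {D : ℕ} (X : MTree D) : TD D := Quotient.mk (MTree.setoid D) X

/-- A sequence of metrized polynomial-like trees converges strongly. -/
structure ConvergesStrongly {D : ℕ} (X : ℕ → MTree D) : Prop where
  dist_tendsto : ∀ i ∈ Finset.Icc 1 D, ∃ l : ℝ,
    Tendsto (fun n => (X n).d (X n).base ((X n).spine i)) atTop (𝓝 l)
  dist_pos : ∃ l : ℝ, 0 < l ∧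
    Tendsto (fun n => (X n).d (X n).base ((X n).spine D)) atTop (𝓝 l)
  iso : ∀ k : ℕ, 0 < k → ∀ᶠ n in atTop,
    Nonempty (TreeMap.LevelIso (X n).toTreeMap (X (n + 1)).toTreeMap k)

/-- `T'` with the pseudo-metric `d'` is the simplicial limit of the sequence `X`: for every `k`
there are simplicial isomorphisms `T'(k) ≅ X_n(k)` respecting the dynamics for all large `n`,
under which the metrics of `X_n` converge to `d'`. -/
def IsSimplicialLimit {D : ℕ} (X : ℕ → MTree D) (T' : TreeMap) (d' : T'.V → T'.V → ℝ) : Prop :=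
  T'.HasInfinity ∧ ∀ k : ℕ, 0 < k → ∀ ε : ℝ, 0 < ε → ∀ᶠ n in atTop,
    ∃ φ : TreeMap.LevelIso T' (X n).toTreeMap k,
      ∀ x y, |(X n).d (φ.iso x).1 (φ.iso y).1 - d' x.1 y.1| ≤ ε

/-- The metrized tree with dynamics `Y` is obtained from `(T', d', F')` by collapsing the edges of
length zero to points.  After the collapse, the vertices of `Y` (grand orbits of branch points)
are the images of some of the vertices of `T'`, chosen by `j`; the induced map from `Y` to the
collapsed tree is isometric, respects the dynamics, and is onto: each vertex of `T'` collapses to a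
point of a segment between vertices of `Y`. -/
def IsCollapse {D : ℕ} (T' : TreeMap) (d' : T'.V → T'.V → ℝ) (Y : MTree D) : Prop :=
  ∃ j : Y.V → T'.V,
    (∀ u w, d' (j u) (j w) = Y.d u w) ∧
    (∀ u, d' (j (Y.F u)) (T'.F (j u)) = 0) ∧
    ∀ x, ∃ u w, d' (j u) x + d' x (j w) = d' (j u) (j w)

/-- The sequence `X` converges strongly, with limiting triple `Y`. -/
def StrongLimit {D : ℕ} (X : ℕ → MTree D) (Y : MTree D) : Prop :=
  ConvergesStrongly X ∧
    ∃ (T' : TreeMap) (d' : T'.V → T'.V → ℝ), IsSimplicialLimit X T' d' ∧ IsCollapse T' d' Y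

/-- The geometric topology on `𝒯_D`, the (finest) topology in which each strongly convergent
sequence of trees converges to its limiting triple: `U` is open iff every strongly convergent
sequence whose limit lies in `U` is eventually in `U`. -/
instance geometricTopology (D : ℕ) : TopologicalSpace (TD D) where
  IsOpen U := ∀ (X : ℕ → MTree D) (Y : MTree D), StrongLimit X Y → TD.mk Y ∈ U →
    ∀ᶠ n in atTop, TD.mk (X n) ∈ U
  isOpen_univ := by simp
  isOpen_inter := by
    intro s t hs ht X Y h hY
    filter_upwards [hs X Y h hY.1, ht X Y h hY.2] with n h1 h2 using ⟨h1, h2⟩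
  isOpen_sUnion := by
    rintro S hS X Y h ⟨s, hs, hY⟩
    filter_upwards [hS s hs X Y h hY] with n hn using ⟨s, hs, hn⟩

/-- The multiplicative group `ℝ₊` of positive real numbers. -/
abbrev PosReal : Type := {c : ℝ // 0 < c}

/-- Rescaling the metric of a tree by `c > 0`. -/
def MTree.scale {D : ℕ} (c : PosReal) (X : MTree D) : MTree D where
  toTreeMap := X.toTreeMap
  polyLike := X.polyLike
  d := fun x y => c.1 * X.d x y
  heightMetric :=
    { self := fun x => by simp [X.heightMetric.self x]
      eq_of_zero := fun x y h => X.heightMetric.eq_of_zero x y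
        ((mul_eq_zero.1 h).resolve_left c.2.ne')
      symm := fun x y => by rw [X.heightMetric.symm x y]
      triangle := fun x y z => by
        rw [← mul_add]
        exact mul_le_mul_of_nonneg_left (X.heightMetric.triangle x y z) c.2.le
      path := fun x y z p hp hy => by rw [← mul_add, X.heightMetric.path x y z p hp hy]
      expand := fun x y h => by rw [X.heightMetric.expand x y h]; ring }

/-- The action of `ℝ₊` on `𝒯_D` by rescaling of the metric. -/
instance rescaling (D : ℕ) : MulAction PosReal (TD D) where
  smul c := Quotient.map (MTree.scale c) fun _ _ ⟨i, hd, hF⟩ =>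
    ⟨i, fun x y => congrArg (c.1 * ·) (hd x y), hF⟩
  one_smul := by
    rintro ⟨X⟩
    exact Quotient.sound ⟨Equiv.refl _, fun x y => (one_mul (X.d x y)).symm, fun _ => rfl⟩
  mul_smul := by
    rintro a b ⟨X⟩
    exact Quotient.sound
      ⟨Equiv.refl _, fun x y => (mul_assoc a.1 b.1 (X.d x y)).symm, fun _ => rfl⟩

/-- The projective space `ℙ𝒯_D = 𝒯_D / ℝ₊`, with the quotient topology. -/
abbrev PTD (D : ℕ) : Type 1 := MulAction.orbitRel.Quotient PosReal (TD D)

end PolyTree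

end

/-!
A polynomial-like tree `(T, dist, F)` of degree `D` is encoded by a single pseudo-ultrametric on
the words in `D` letters.  Below the base, `T` looks like the space of its ends other than `∞`, and
at each step the dynamics has `D` inverse branches, counted with multiplicity.  Numbering them
coherently labels the ends by infinite words `x : Code D`, so that `F` becomes the shift, and each
vertex is `lam i x`, the vertex on level `i` above the end `x`.  Let `ρ x y` be the height at which
the ends `x` and `y` branch apart, in units in which the base has height `1`.  Then
`ρ (cons a u) (cons a v) = ρ u v / D`, `ρ (shift x) (shift y) ≤ D * ρ x y`, the maximum of `ρ` is
`1`, and the inequality required of a local degree function becomes an inequality between numbers of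
balls.  These properties define `IsTreeMetric`.

The dictionary has two directions.  `IsTreeMetric.exists_labelled` builds, from a tree metric and a
height `c` of the base, a tree which is labelled by them; the vertices are the balls whose radii are
of the form `D ^ k * ρ x y`, and the Riemann–Hurwitz inequality bounds the number of orbits of such
radii by `D - 1` (`IsTreeMetric.card_heights_le`), which is what makes the heights discrete.
`MTree.exists_isLabelled` finds labels for an arbitrary tree: the isolated end orients the edges
(`MTree.exists_isLeveled`), and the inequality at the vertices forces the edge above a vertex to
have the same degree as the vertex, so that inverse branches can be distributed downwards
(`TreeMap.IsLeveled.exists_labels`).  Trees labelled by the same data are equivalent, and two tree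
metrics label the same tree exactly when they are related by an `IsIsom`.

All the conditions on a tree metric are closed, so tree metrics form a compact metrizable space
`TreeMetric D`: the subtle point is the Riemann–Hurwitz inequality at radii at which balls are
about to merge in the limit, which follows from the inequality at nearby radii
(`IsTreeMetric.of_tendsto`).  Strong convergence corresponds to pointwise convergence of tree
metrics, up to passing to subsequences and to isomorphism: convergent labels give strongly
convergent subsequences with the expected limit (`exists_strongLimit_subseq`), and, conversely, the
limit of a strongly convergent sequence is the tree labelled by any limit of labels
(`exists_isIsom_of_limit`).  Consequently `treeClass : TreeMetric D × ℝ₊ → 𝒯_D` is a continuous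
closed surjection with compact fibres, so `𝒯_D` is metrizable, and `projClass` is a continuous
closed surjection of `TreeMetric D` onto `ℙ𝒯_D`, which is therefore compact and Hausdorff.

For the contraction, let `trunc t ρ` be the maximum of `ρ` and `t` times the standard ultrametric on
words: the tree is kept above height `t`, and below it all inverse branches are separated at once.
This joins `ρ` at `t = 0` to the standard ultrametric at `t = 1`.  It descends to isomorphism
classes (`IsIsom.exists_trunc`): local degrees are determined by the growth of the numbers of balls,
so an isomorphism matches inverse branches up to height `t`, and below that height it can be
replaced by a map that permutes letters.
-/

namespace PolyTree

/-! ### Codes and tree metrics -/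

/-- Infinite words in `D` letters.  A word labels an end of a tree lying below the base: its `n`-th
letter names the inverse branch of the dynamics at the `n`-th step. -/
abbrev Code (D : ℕ) : Type := ℕ → Fin D

namespace Code

variable {D : ℕ}

/-- Prepend a letter to a word. -/
def cons (a : Fin D) (u : Code D) : Code D
  | 0 => a
  | n + 1 => u n

/-- Drop the first letter of a word; this models the dynamics on ends. -/
def shift (x : Code D) : Code D := fun n => x (n + 1)

@[simp] lemma shift_cons (a : Fin D) (u : Code D) : shift (cons a u) = u := rfl

@[simp] lemma cons_zero (a : Fin D) (u : Code D) : cons a u 0 = a := rfl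

lemma cons_shift (x : Code D) : cons (x 0) (shift x) = x := by
  funext n
  cases n <;> rfl

/-- The word that agrees with `x` on the first `k` letters and with `o` from there on. -/
def splice (o : Code D) (k : ℕ) (x : Code D) : Code D := fun n => if n < k then x n else o n

lemma splice_agree (o : Code D) (k : ℕ) (x : Code D) : ∀ n < k, x n = splice o k x n := by
  intro n hn
  simp [splice, hn]

lemma finite_range_splice (o : Code D) (k : ℕ) : (Set.range (splice o k)).Finite := by
  refine (Set.finite_range fun (g : Fin k → Fin D) (n : ℕ) =>
    if h : n < k then g ⟨n, h⟩ else o n).subset ?_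
  rintro _ ⟨x, rfl⟩
  refine ⟨fun i => x i, ?_⟩
  funext n
  by_cases h : n < k <;> simp [splice, h]

end Code

open Code

variable {D : ℕ}

/-- The closed ball of radius `s` around the word `x`. -/
def ball (ρ : Code D → Code D → ℝ) (s : ℝ) (x : Code D) : Set (Code D) := {y | ρ x y ≤ s}

/-- The number of balls of radius `s` that meet `A`. -/
noncomputable def cnt (ρ : Code D → Code D → ℝ) (s : ℝ) (A : Set (Code D)) : ℕ := (ball ρ s '' A).ncard

open Classical in
/-- The local degree at the point of height `s` below which the end `z` lies: the number of
inverse branches carrying the image of the point back to the point. -/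
noncomputable def deg (ρ : Code D → Code D → ℝ) (s : ℝ) (z : Code D) : ℕ :=
  (Finset.univ.filter fun a => ρ (cons a (shift z)) z ≤ s).card

/-- The pseudo-ultrametrics on words that come from polynomial-like trees with base at height
`1`: `ρ x y` is the height at which the ends `x` and `y` branch apart.  The last field is the
Riemann–Hurwitz inequality: below a point of height `s` and degree `m`, the sum of `deg - 1` over
the points of height `s'` is at most `m - 1`. -/
structure IsTreeMetric (ρ : Code D → Code D → ℝ) : Prop where
  refl : ∀ x, ρ x x = 0
  symm : ∀ x y, ρ x y = ρ y x
  ultra : ∀ x y z, ρ x z ≤ max (ρ x y) (ρ y z)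
  cons : ∀ a u u', ρ (cons a u) (cons a u') = ρ u u' / D
  shift : ∀ x y, ρ (shift x) (shift y) ≤ D * ρ x y
  le_one : ∀ x y, ρ x y ≤ 1
  exists_one : ∃ x y, ρ x y = 1
  riemannHurwitz : ∀ z s s', 0 < s' → s' ≤ s →
    deg ρ s z * cnt ρ (D * s') (ball ρ (D * s) (Code.shift z)) + 1 ≤
      cnt ρ s' (ball ρ s z) + deg ρ s z

namespace IsTreeMetric

variable {ρ : Code D → Code D → ℝ}

lemma nonneg (hρ : IsTreeMetric ρ) (x y : Code D) : 0 ≤ ρ x y := by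
  have h := hρ.ultra x y x
  rwa [hρ.refl, hρ.symm y x, max_self] at h

lemma one_lt (hρ : IsTreeMetric ρ) : 1 < D := by
  obtain ⟨x, y, hxy⟩ := hρ.exists_one
  by_contra! h
  have : x = y := by
    funext n
    apply Fin.ext
    have h1 := (x n).2
    have h2 := (y n).2
    omega
  rw [this, hρ.refl] at hxy
  norm_num at hxy

lemma one_lt' (hρ : IsTreeMetric ρ) : (1 : ℝ) < D := by exact_mod_cast hρ.one_lt

lemma pos' (hρ : IsTreeMetric ρ) : (0 : ℝ) < D := one_pos.trans hρ.one_lt'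

lemma ultra_le (hρ : IsTreeMetric ρ) {x y z : Code D} {s : ℝ} (h : ρ x y ≤ s) (h' : ρ y z ≤ s) :
    ρ x z ≤ s := (hρ.ultra x y z).trans (max_le h h')

lemma symm_le (hρ : IsTreeMetric ρ) {x y : Code D} {s : ℝ} (h : ρ x y ≤ s) : ρ y x ≤ s :=
  hρ.symm x y ▸ h

lemma eq_of_lt (hρ : IsTreeMetric ρ) {x x' y : Code D} (h : ρ x x' < ρ x y) :
    ρ x' y = ρ x y := by
  apply le_antisymm
  · exact hρ.ultra_le (hρ.symm_le h.le) le_rfl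
  · rcases le_max_iff.1 (hρ.ultra x x' y) with h' | h'
    · exact absurd h (not_lt.2 h')
    · exact h'

lemma eq_of_close (hρ : IsTreeMetric ρ) {x x' y y' : Code D} (h : ρ x x' < ρ x y)
    (h' : ρ y y' < ρ x y) : ρ x' y' = ρ x y := by
  have h1 := hρ.eq_of_lt h
  have h2 : ρ y y' < ρ y x' := by rwa [hρ.symm y x', h1]
  rw [hρ.symm x', hρ.eq_of_lt h2, hρ.symm, h1]

/-- The distance depends on close replacements of its arguments only up to their distance. -/
lemma abs_sub_le (hρ : IsTreeMetric ρ) {x x' y y' : Code D} {ε : ℝ} (h : ρ x x' ≤ ε)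
    (h' : ρ y y' ≤ ε) : |ρ x' y' - ρ x y| ≤ ε := by
  have h0 := hρ.nonneg x x'
  by_cases hx : ε < ρ x y
  · rw [hρ.eq_of_close (h.trans_lt hx) (h'.trans_lt hx)]
    simpa using h0.trans h
  · have h1 : ρ x' y' ≤ ε := hρ.ultra_le (hρ.ultra_le (hρ.symm_le h) (not_lt.1 hx)) h'
    have h2 := hρ.nonneg x' y'
    have h3 := hρ.nonneg x y
    rw [abs_le]
    constructor <;> linarith

lemma le_of_agree (hρ : IsTreeMetric ρ) (k : ℕ) {x y : Code D} (h : ∀ n < k, x n = y n) :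
    ρ x y ≤ ((D : ℝ)⁻¹) ^ k := by
  induction k generalizing x y with
  | zero => simpa using hρ.le_one x y
  | succ k ih =>
    have h0 : x 0 = y 0 := h 0 (Nat.succ_pos k)
    rw [← cons_shift x, ← cons_shift y, h0, hρ.cons, pow_succ, div_eq_mul_inv]
    exact mul_le_mul_of_nonneg_right (ih fun n hn => h (n + 1) (by omega))
      (inv_nonneg.2 hρ.pos'.le)

lemma exists_pow_lt (hρ : IsTreeMetric ρ) {s : ℝ} (hs : 0 < s) : ∃ k : ℕ, ((D : ℝ)⁻¹) ^ k < s :=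
  exists_pow_lt_of_lt_one hs (inv_lt_one_of_one_lt₀ hρ.one_lt')

lemma ball_eq_iff (hρ : IsTreeMetric ρ) {s : ℝ} (hs : 0 ≤ s) {x y : Code D} :
    ball ρ s x = ball ρ s y ↔ ρ x y ≤ s := by
  constructor
  · intro h
    have : y ∈ ball ρ s y := by simp [ball, hρ.refl, hs]
    rw [← h] at this
    exact this
  · intro h
    ext z
    exact ⟨fun hz => hρ.ultra_le (hρ.symm_le h) hz, fun hz => hρ.ultra_le h hz⟩

lemma finite_image_ball (hρ : IsTreeMetric ρ) {s : ℝ} (hs : 0 < s) (A : Set (Code D)) :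
    (ball ρ s '' A).Finite := by
  obtain ⟨k, hk⟩ := hρ.exists_pow_lt hs
  obtain ⟨o, -⟩ := hρ.exists_one
  refine ((finite_range_splice o k).image (ball ρ s)).subset ?_
  rintro _ ⟨x, -, rfl⟩
  exact ⟨_, ⟨x, rfl⟩, (hρ.ball_eq_iff hs.le).2
    (hρ.symm_le ((hρ.le_of_agree k (splice_agree o k x)).trans hk.le))⟩

lemma finite_values (hρ : IsTreeMetric ρ) {ε : ℝ} (hε : 0 < ε) :
    {v | ε ≤ v ∧ ∃ x y, ρ x y = v}.Finite := by
  obtain ⟨k, hk⟩ := hρ.exists_pow_lt hε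
  obtain ⟨o, -⟩ := hρ.exists_one
  have hf := finite_range_splice o k
  refine ((hf.prod hf).image fun p => ρ p.1 p.2).subset ?_
  rintro _ ⟨hv, x, y, rfl⟩
  refine ⟨(splice o k x, splice o k y), ⟨⟨x, rfl⟩, ⟨y, rfl⟩⟩, ?_⟩
  exact hρ.eq_of_close ((hρ.le_of_agree k (splice_agree o k x)).trans_lt (hk.trans_le hv))
    ((hρ.le_of_agree k (splice_agree o k y)).trans_lt (hk.trans_le hv))

/-! ### Counting balls -/

/-- Representatives of the balls of radius `s`. -/
structure Reps (ρ : Code D → Code D → ℝ) (s : ℝ) (Z : Finset (Code D)) (f : Code D → Code D) :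
    Prop where
  mem : ∀ x, f x ∈ Z
  le : ∀ x, ρ x (f x) ≤ s
  congr : ∀ x y, ρ x y ≤ s → f x = f y
  fix : ∀ z ∈ Z, f z = z

lemma exists_reps (hρ : IsTreeMetric ρ) {s : ℝ} (hs : 0 < s) : ∃ Z f, Reps ρ s Z f := by
  classical
  obtain ⟨o, -⟩ := hρ.exists_one
  let g : Set (Code D) → Code D := fun B => if h : B.Nonempty then h.some else o
  have hg : ∀ x, ρ x (g (ball ρ s x)) ≤ s := fun x => by
    have hne : (ball ρ s x).Nonempty := ⟨x, by simp [ball, hρ.refl, hs.le]⟩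
    simp only [g, dif_pos hne]
    exact hne.some_mem
  have hc : ∀ x y, ρ x y ≤ s → g (ball ρ s x) = g (ball ρ s y) := fun x y h => by
    rw [(hρ.ball_eq_iff hs.le).2 h]
  refine ⟨(hρ.finite_image_ball hs Set.univ).toFinset.image g, fun x => g (ball ρ s x),
    fun x => Finset.mem_image_of_mem _ (by simp), hg, hc, ?_⟩
  intro z hz
  obtain ⟨B, hB, rfl⟩ := Finset.mem_image.1 hz
  obtain ⟨x, -, rfl⟩ := (Set.Finite.mem_toFinset _).1 hB
  exact (hc _ _ (hg x)).symm

lemma Reps.eq_iff (hρ : IsTreeMetric ρ) {s : ℝ} {Z f} (h : Reps ρ s Z f) {x y : Code D} :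
    f x = f y ↔ ρ x y ≤ s :=
  ⟨fun e => hρ.ultra_le (h.le x) (e ▸ hρ.symm_le (h.le y)), h.congr x y⟩

open Classical in
lemma cnt_eq_card (hρ : IsTreeMetric ρ) {s : ℝ} (hs : 0 < s) {Z f} (h : Reps ρ s Z f)
    {A : Set (Code D)} (hA : ∀ x ∈ A, ∀ y, ρ x y ≤ s → y ∈ A) :
    cnt ρ s A = (Z.filter (· ∈ A)).card := by
  have h1 : ball ρ s '' A = ball ρ s '' (Z.filter (· ∈ A) : Finset (Code D)) := by
    ext B
    constructor
    · rintro ⟨x, hx, rfl⟩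
      refine ⟨f x, ?_, (hρ.ball_eq_iff hs.le).2 (hρ.symm_le (h.le x))⟩
      simp [h.mem x, hA x hx _ (h.le x)]
    · rintro ⟨x, hx, rfl⟩
      simp only [Finset.coe_filter, Set.mem_ofPred_eq] at hx
      exact ⟨x, hx.2, rfl⟩
  rw [cnt, h1, Set.InjOn.ncard_image, Set.ncard_coe_finset]
  intro x hx y hy hxy
  simp only [Finset.coe_filter, Set.mem_ofPred_eq] at hx hy
  rw [← h.fix x hx.1, ← h.fix y hy.1]
  exact h.congr x y ((hρ.ball_eq_iff hs.le).1 hxy)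

lemma cnt_univ (hρ : IsTreeMetric ρ) {s : ℝ} (hs : 0 < s) {Z f} (h : Reps ρ s Z f) :
    cnt ρ s Set.univ = Z.card := by
  classical
  rw [hρ.cnt_eq_card hs h (by simp)]
  simp

lemma sum_cnt_ball (hρ : IsTreeMetric ρ) {s s' : ℝ} (hs' : 0 < s') (hss : s' ≤ s) {Z f}
    (h : Reps ρ s Z f) : ∑ z ∈ Z, cnt ρ s' (ball ρ s z) = cnt ρ s' Set.univ := by
  classical
  obtain ⟨W, g, hW⟩ := hρ.exists_reps hs'
  rw [hρ.cnt_univ hs' hW, Finset.card_eq_sum_card_fiberwise (f := f) (t := Z)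
    (fun x _ => h.mem x)]
  refine Finset.sum_congr rfl fun z hz => ?_
  rw [hρ.cnt_eq_card hs' hW]
  · congr 1
    refine Finset.filter_congr fun x _ => ?_
    rw [← h.fix z hz, h.eq_iff hρ, h.fix z hz, hρ.symm]
    rfl
  · exact fun x hx y hxy => hρ.ultra_le hx (hxy.trans hss)

open Classical in
/-- Summing over the points of height `s` with multiplicity is `D` times summing over the points
of height `D s`: the dynamics has global degree `D`. -/
lemma sum_deg_mul (hρ : IsTreeMetric ρ) {s : ℝ} {Z f U h} (hZ : Reps ρ s Z f)
    (hU : Reps ρ (D * s) U h) (g : Code D → ℕ) (hg : ∀ u u', ρ u u' ≤ D * s → g u = g u') :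
    ∑ z ∈ Z, deg ρ s z * g (Code.shift z) = D * ∑ u ∈ U, g u := by
  have hD := hρ.pos'
  have h1 : ∑ p ∈ U ×ˢ (Finset.univ : Finset (Fin D)), g p.1 = D * ∑ u ∈ U, g u := by
    rw [Finset.sum_product, Finset.mul_sum]
    simp
  rw [← h1, ← Finset.sum_fiberwise_of_maps_to (t := Z)
    (g := fun p : Code D × Fin D => f (Code.cons p.2 p.1)) (fun p _ => hZ.mem _)]
  refine Finset.sum_congr rfl fun z hz => ?_
  have hfib : ∀ p : Code D × Fin D, f (Code.cons p.2 p.1) = z ↔ ρ (Code.cons p.2 p.1) z ≤ s := by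
    intro p
    conv_lhs => rw [← hZ.fix z hz]
    exact hZ.eq_iff hρ
  have hsh : ∀ p : Code D × Fin D, ρ (Code.cons p.2 p.1) z ≤ s → ρ p.1 (Code.shift z) ≤ D * s :=
    fun p hp => (hρ.shift _ _).trans (mul_le_mul_of_nonneg_left hp hD.le)
  have h2 : ∀ p ∈ (U ×ˢ (Finset.univ : Finset (Fin D))).filter
      (fun p => f (Code.cons p.2 p.1) = z), g p.1 = g (Code.shift z) := by
    intro p hp
    rw [Finset.mem_filter, hfib] at hp
    exact hg _ _ (hsh p hp.2)
  rw [Finset.sum_congr rfl h2, Finset.sum_const, smul_eq_mul]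
  congr 1
  have h3 : (U ×ˢ (Finset.univ : Finset (Fin D))).filter (fun p => f (Code.cons p.2 p.1) = z) =
      (Finset.univ.filter fun a => ρ (Code.cons a (Code.shift z)) z ≤ s).image
        fun a => (h (Code.shift z), a) := by
    ext ⟨u, a⟩
    simp only [Finset.mem_filter, Finset.mem_product, Finset.mem_univ, and_true, hfib,
      Finset.mem_image, true_and, Prod.mk.injEq, exists_eq_right_right]
    have key : ∀ u', ρ u' (Code.shift z) ≤ D * s →
        (ρ (Code.cons a u') z ≤ s ↔ ρ (Code.cons a (Code.shift z)) z ≤ s) := by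
      intro u' hu'
      have : ρ (Code.cons a u') (Code.cons a (Code.shift z)) ≤ s := by
        rw [hρ.cons, div_le_iff₀ hD, mul_comm]
        exact hu'
      exact ⟨fun h' => hρ.ultra_le (hρ.symm_le this) h', fun h' => hρ.ultra_le this h'⟩
    constructor
    · rintro ⟨hu, hp⟩
      have h4 := hsh (u, a) hp
      refine ⟨(key u h4).1 hp, ?_⟩
      rw [← hU.fix u hu]
      exact (hU.congr _ _ h4).symm
    · rintro ⟨hp, rfl⟩
      exact ⟨hU.mem _, (key _ (hρ.symm_le (hU.le _))).2 hp⟩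
  rw [h3, Finset.card_image_of_injective _ (fun a b hab => (Prod.ext_iff.1 hab).2)]
  rfl

lemma one_le_deg (hρ : IsTreeMetric ρ) {s : ℝ} (hs : 0 ≤ s) (z : Code D) : 1 ≤ deg ρ s z := by
  classical
  refine Finset.card_pos.2 ⟨z 0, ?_⟩
  simp [cons_shift, hρ.refl, hs]

/-- The total excess `∑ (deg - 1)` over the points of height `s`. -/
noncomputable def excess (ρ : Code D → Code D → ℝ) (s : ℝ) : ℤ :=
  D * cnt ρ (D * s) Set.univ - cnt ρ s Set.univ

lemma excess_nonneg (hρ : IsTreeMetric ρ) {s : ℝ} (hs : 0 < s) : 0 ≤ excess ρ s := by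
  classical
  obtain ⟨Z, f, hZ⟩ := hρ.exists_reps hs
  obtain ⟨U, h, hU⟩ := hρ.exists_reps (mul_pos hρ.pos' hs)
  have h1 := hρ.sum_deg_mul hZ hU (fun _ => 1) (fun _ _ _ => rfl)
  have h2 : Z.card ≤ ∑ z ∈ Z, deg ρ s z * 1 := by
    rw [Finset.card_eq_sum_ones]
    exact Finset.sum_le_sum fun z _ => by simpa using hρ.one_le_deg hs.le z
  rw [h1, ← Finset.card_eq_sum_ones, ← hρ.cnt_univ hs hZ,
    ← hρ.cnt_univ (mul_pos hρ.pos' hs) hU] at h2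
  rw [excess]
  have : (cnt ρ s Set.univ : ℤ) ≤ (D * cnt ρ (D * s) Set.univ : ℕ) := by exact_mod_cast h2
  push_cast at this
  linarith

/-- The excess decreases with the height, by the Riemann–Hurwitz inequality at each point. -/
lemma excess_mono (hρ : IsTreeMetric ρ) {s s' : ℝ} (hs' : 0 < s') (hss : s' ≤ s) :
    excess ρ s' ≤ excess ρ s := by
  classical
  have hs := hs'.trans_le hss
  have hD := hρ.pos'
  obtain ⟨Z, f, hZ⟩ := hρ.exists_reps hs
  obtain ⟨U, h, hU⟩ := hρ.exists_reps (mul_pos hD hs)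
  have h1 := hρ.sum_deg_mul hZ hU (fun u => cnt ρ (D * s') (ball ρ (D * s) u)) (fun u u' hu => by
    simp only [(hρ.ball_eq_iff (mul_pos hD hs).le).2 hu])
  have h2 := hρ.sum_deg_mul hZ hU (fun _ => 1) (fun _ _ _ => rfl)
  have h3 := Finset.sum_le_sum fun z (_ : z ∈ Z) => hρ.riemannHurwitz z s s' hs' hss
  rw [Finset.sum_add_distrib, Finset.sum_add_distrib, h1, hρ.sum_cnt_ball hs' hss hZ,
    hρ.sum_cnt_ball (mul_pos hD hs') (mul_le_mul_of_nonneg_left hss hD.le) hU] at h3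
  simp only [mul_one] at h2
  rw [h2, ← Finset.card_eq_sum_ones, ← Finset.card_eq_sum_ones, ← hρ.cnt_univ hs hZ,
    ← hρ.cnt_univ (mul_pos hD hs) hU] at h3
  simp only [excess]
  have : ((D * cnt ρ (D * s') Set.univ + cnt ρ s Set.univ : ℕ) : ℤ) ≤
    (cnt ρ s' Set.univ + D * cnt ρ (D * s) Set.univ : ℕ) := by exact_mod_cast h3
  push_cast at this
  linarith

lemma cnt_univ_of_one_le (hρ : IsTreeMetric ρ) {s : ℝ} (hs : 1 ≤ s) : cnt ρ s Set.univ = 1 := by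
  obtain ⟨o, -⟩ := hρ.exists_one
  rw [cnt, Set.ncard_eq_one]
  refine ⟨Set.univ, ?_⟩
  have : ∀ x, ball ρ s x = Set.univ := fun x =>
    Set.eq_univ_of_forall fun y => (hρ.le_one x y).trans hs
  ext B
  constructor
  · rintro ⟨x, -, rfl⟩
    exact this x
  · rintro rfl
    exact ⟨o, trivial, this o⟩

lemma excess_one (hρ : IsTreeMetric ρ) : excess ρ 1 = D - 1 := by
  rw [excess, hρ.cnt_univ_of_one_le le_rfl, hρ.cnt_univ_of_one_le (by simpa using hρ.one_lt'.le)]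
  simp

lemma cnt_univ_lt (hρ : IsTreeMetric ρ) {s s' : ℝ} (hs' : 0 < s') (hss : s' < s) {x y : Code D}
    (hxy : ρ x y ≤ s) (hxy' : s' < ρ x y) : cnt ρ s Set.univ < cnt ρ s' Set.univ := by
  classical
  obtain ⟨Z, f, hZ⟩ := hρ.exists_reps (hs'.trans hss)
  obtain ⟨W, g, hW⟩ := hρ.exists_reps hs'
  rw [hρ.cnt_univ _ hZ, hρ.cnt_univ hs' hW]
  swap
  · exact hs'.trans hss
  have hfg : ∀ x, f (g x) = f x := fun x => (hZ.congr _ _ ((hW.le x).trans hss.le)).symm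
  have himg : Z = W.image f := by
    ext z
    rw [Finset.mem_image]
    exact ⟨fun hz => ⟨g z, hW.mem z, by rw [hfg, hZ.fix z hz]⟩, by rintro ⟨w, -, rfl⟩; exact hZ.mem w⟩
  rw [himg]
  refine lt_of_le_of_ne Finset.card_image_le fun h => ?_
  rw [Finset.card_image_iff] at h
  have := h (hW.mem x) (hW.mem y) (by rw [hfg, hfg]; exact hZ.congr _ _ hxy)
  exact absurd ((hW.eq_iff hρ).1 this) (not_le.2 hxy')

/-! ### The heights of the vertices -/

/-- `s` is a height at which two ends branch apart. -/
def IsValue (ρ : Code D → Code D → ℝ) (s : ℝ) : Prop := 0 < s ∧ ∃ x y, ρ x y = s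

lemma isValue_one (hρ : IsTreeMetric ρ) : IsValue ρ 1 := ⟨one_pos, hρ.exists_one⟩

/-- If `τ` is a branching height and `D τ` is not, then there is a critical point at height `τ`, so
the excess is smaller just below `τ`. -/
lemma excess_drop (hρ : IsTreeMetric ρ) {τ : ℝ} (h : IsValue ρ τ) (h' : ¬ IsValue ρ (D * τ)) :
    ∃ σ, 0 < σ ∧ σ < τ ∧ ∀ s, σ ≤ s → s < τ → excess ρ s + 1 ≤ excess ρ τ := by
  obtain ⟨hτ, x, y, hxy⟩ := h
  have hD := hρ.pos'
  have hfin := hρ.finite_values (ε := D * τ / 2) (by positivity)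
  have hnot : D * τ ∈ {v | D * τ / 2 ≤ v ∧ ∃ x y, ρ x y = v}ᶜ :=
    fun hm => h' ⟨mul_pos hD hτ, hm.2⟩
  obtain ⟨ε, hε, hball⟩ := Metric.isOpen_iff.1 hfin.isClosed.isOpen_compl _ hnot
  refine ⟨max (τ / 2) (τ - ε / (2 * D)), lt_max_of_lt_left (by positivity),
    max_lt (by linarith) (by have : 0 < ε / (2 * D) := by positivity
                             linarith), fun s hs hsτ => ?_⟩
  have hs1 : τ / 2 ≤ s := (le_max_left _ _).trans hs
  have hs2 : τ - ε / (2 * D) ≤ s := (le_max_right _ _).trans hs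
  have hs0 : 0 < s := (by positivity : 0 < τ / 2).trans_le hs1
  -- `s` is so close to `τ` that no branching occurs between the heights `D * s` and `D * τ`
  have hgap : ∀ a b, ρ a b ≤ D * τ → ρ a b ≤ D * s := by
    intro a b hab
    by_contra! hlt
    have h1 : D * τ / 2 ≤ ρ a b := by nlinarith
    have h2 : D * s ≥ D * τ - ε / 2 := by
      have := mul_le_mul_of_nonneg_left hs2 hD.le
      have e : (D : ℝ) * (τ - ε / (2 * D)) = D * τ - ε / 2 := by field_simp
      linarith
    have h3 : ρ a b ∈ Metric.ball ((D : ℝ) * τ) ε := by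
      rw [Metric.mem_ball, Real.dist_eq, abs_lt]
      constructor <;> linarith
    exact hball h3 ⟨h1, a, b, rfl⟩
  have hb : ball ρ (D * s) = ball ρ (D * τ) := by
    funext a
    ext b
    exact ⟨fun hb => hb.trans (mul_le_mul_of_nonneg_left hsτ.le hD.le), hgap a b⟩
  have h1 : cnt ρ (D * s) Set.univ = cnt ρ (D * τ) Set.univ := by rw [cnt, cnt, hb]
  have h2 := hρ.cnt_univ_lt hs0 hsτ hxy.le (by rwa [hxy])
  rw [excess, excess, h1]
  have : (cnt ρ τ Set.univ : ℤ) + 1 ≤ cnt ρ s Set.univ := by exact_mod_cast h2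
  linarith

lemma card_le_excess (hρ : IsTreeMetric ρ) (S : Finset ℝ)
    (hS : ∀ τ ∈ S, IsValue ρ τ ∧ ¬ IsValue ρ (D * τ)) :
    ∀ s, 0 < s → (∀ τ ∈ S, τ ≤ s) → (S.card : ℤ) ≤ excess ρ s := by
  induction S using Finset.induction_on_max with
  | empty => exact fun s hs _ => by simpa using hρ.excess_nonneg hs
  | insert a S ha ih =>
    intro s hs hle
    obtain ⟨σ, hσ, hσa, hdrop⟩ := hρ.excess_drop (hS a (Finset.mem_insert_self _ _)).1
      (hS a (Finset.mem_insert_self _ _)).2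
    have : ∃ t, σ ≤ t ∧ t < a ∧ ∀ τ ∈ S, τ ≤ t := by
      rcases S.eq_empty_or_nonempty with rfl | hne
      · exact ⟨σ, le_rfl, hσa, by simp⟩
      · refine ⟨max σ (S.max' hne), le_max_left _ _, max_lt hσa (ha _ (S.max'_mem hne)), ?_⟩
        exact fun τ hτ => (S.le_max' τ hτ).trans (le_max_right _ _)
    obtain ⟨t, ht1, ht2, ht3⟩ := this
    have h1 := ih (fun τ hτ => hS τ (Finset.mem_insert_of_mem hτ)) t (hσ.trans_le ht1) ht3
    have h2 := hdrop t ht1 ht2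
    have h3 := hρ.excess_mono (hS a (Finset.mem_insert_self _ _)).1.1
      (hle a (Finset.mem_insert_self _ _))
    rw [Finset.card_insert_of_notMem fun h => lt_irrefl _ (ha a h)]
    push_cast
    linarith

/-- The heights of the vertices: the orbits of the branching heights under scaling by `D`. -/
def IsHeight (ρ : Code D → Code D → ℝ) (s : ℝ) : Prop := ∃ (k : ℤ) (v : ℝ), IsValue ρ v ∧ s = D ^ k * v

lemma IsHeight.pos (hρ : IsTreeMetric ρ) {s : ℝ} (h : IsHeight ρ s) : 0 < s := by
  obtain ⟨k, v, hv, rfl⟩ := h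
  exact mul_pos (zpow_pos hρ.pos' k) hv.1

lemma IsHeight.zpow_mul (hρ : IsTreeMetric ρ) {s : ℝ} (h : IsHeight ρ s) (j : ℤ) :
    IsHeight ρ (D ^ j * s) := by
  obtain ⟨k, v, hv, rfl⟩ := h
  exact ⟨j + k, v, hv, by rw [zpow_add₀ hρ.pos'.ne', mul_assoc]⟩

/-- Each orbit of heights has a largest branching height. -/
lemma IsHeight.exists_top (hρ : IsTreeMetric ρ) {s : ℝ} (h : IsHeight ρ s) :
    ∃ k : ℤ, IsValue ρ (D ^ k * s) ∧ ¬ IsValue ρ (D * (D ^ k * s)) := by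
  obtain ⟨k, v, hv, rfl⟩ := h
  have hD := hρ.pos'
  obtain ⟨m, hm⟩ := pow_unbounded_of_one_lt v⁻¹ hρ.one_lt'
  have hex : ∃ n : ℕ, ¬ IsValue ρ (D ^ n * v) := by
    refine ⟨m, ?_⟩
    rintro ⟨-, x, y, hxy⟩
    have h1 := hρ.le_one x y
    rw [hxy] at h1
    have h2 := mul_lt_mul_of_pos_right hm hv.1
    rw [inv_mul_cancel₀ hv.1.ne'] at h2
    linarith
  classical
  have hn := Nat.find_spec hex
  have hmin := fun n => Nat.find_min (m := n) hex
  obtain ⟨n, hn'⟩ : ∃ n, Nat.find hex = n + 1 := by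
    refine Nat.exists_eq_succ_of_ne_zero fun h0 => ?_
    rw [h0] at hn
    exact hn (by simpa using hv)
  refine ⟨n - k, ?_, ?_⟩
  · have := hmin n (by omega)
    rw [not_not] at this
    rwa [← mul_assoc, ← zpow_add₀ hD.ne', sub_add_cancel, zpow_natCast]
  · rw [← mul_assoc ((D : ℝ) ^ _), ← zpow_add₀ hD.ne', sub_add_cancel, zpow_natCast, ← mul_assoc,
      ← pow_succ', ← hn']
    exact hn

lemma zpow_eq_of_mem_Ico (hρ : IsTreeMetric ρ) {s s' : ℝ} {k : ℤ} (hs : s ∈ Set.Ico (1 : ℝ) D)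
    (hs' : s' ∈ Set.Ico (1 : ℝ) D) (h : s = D ^ k * s') : k = 0 := by
  have hD := hρ.one_lt'
  have h0 : 0 < s' := one_pos.trans_le hs'.1
  by_contra hk
  rcases lt_or_gt_of_ne hk with hk | hk
  · have h1 : (D : ℝ) ^ k ≤ D ^ (-1 : ℤ) := zpow_le_zpow_right₀ hD.le (by omega)
    have h2 : s ≤ D ^ (-1 : ℤ) * s' := h ▸ mul_le_mul_of_nonneg_right h1 h0.le
    rw [zpow_neg_one, inv_mul_eq_div, le_div_iff₀ hρ.pos'] at h2
    nlinarith [hs.1, hs'.2]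
  · have h1 : (D : ℝ) ^ (1 : ℤ) ≤ D ^ k := zpow_le_zpow_right₀ hD.le (by omega)
    have h2 : D ^ (1 : ℤ) * s' ≤ s := h ▸ mul_le_mul_of_nonneg_right h1 h0.le
    rw [zpow_one] at h2
    nlinarith [hs.2, hs'.1]

lemma card_heights_le (hρ : IsTreeMetric ρ) (S : Finset ℝ)
    (hS : ∀ s ∈ S, IsHeight ρ s ∧ s ∈ Set.Ico (1 : ℝ) D) : S.card + 1 ≤ D := by
  classical
  have hD := hρ.pos'
  choose! k hk1 hk2 using fun s hs => (hS s hs).1.exists_top hρ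
  have hinj : Set.InjOn (fun s => (D : ℝ) ^ k s * s) S := by
    intro s hs s' hs' h
    have h1 : s = (D : ℝ) ^ (k s' - k s) * s' := by
      rw [zpow_sub₀ hD.ne', div_mul_eq_mul_div, eq_div_iff (zpow_pos hD _).ne', mul_comm]
      exact h
    have := hρ.zpow_eq_of_mem_Ico (hS s hs).2 (hS s' hs').2 h1
    rw [h1, this, zpow_zero, one_mul]
  have h2 := hρ.card_le_excess (S.image fun s => (D : ℝ) ^ k s * s) (by
    intro τ hτ
    obtain ⟨s, hs, rfl⟩ := Finset.mem_image.1 hτ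
    exact ⟨hk1 s hs, hk2 s hs⟩) 1 one_pos (by
    intro τ hτ
    obtain ⟨s, hs, rfl⟩ := Finset.mem_image.1 hτ
    obtain ⟨-, x, y, hxy⟩ := hk1 s hs
    rw [← hxy]
    exact hρ.le_one x y)
  rw [Finset.card_image_of_injOn hinj, hρ.excess_one] at h2
  omega

end IsTreeMetric

/-- `ι` lists the heights of the vertices in increasing order, starting with `ι 0 = 1`, the height
of the base; the dynamics moves each height up by `N` steps. -/
structure IsEnum (ρ : Code D → Code D → ℝ) (N : ℕ) (ι : ℤ → ℝ) : Prop where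
  one_le : 1 ≤ N
  strictMono : StrictMono ι
  zero : ι 0 = 1
  add : ∀ i, ι (i + N) = D * ι i
  exists_eq : ∀ s, IsTreeMetric.IsHeight ρ s → ∃ i, ι i = s
  isHeight : ∀ i, IsTreeMetric.IsHeight ρ (ι i)

namespace IsTreeMetric

variable {ρ : Code D → Code D → ℝ}

lemma exists_enum (hρ : IsTreeMetric ρ) : ∃ N ι, IsEnum ρ N ι := by
  classical
  have hD := hρ.pos'
  have hD1 := hρ.one_lt'
  have hfin : {s | IsHeight ρ s ∧ s ∈ Set.Ico (1 : ℝ) D}.Finite := by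
    by_contra hinf
    obtain ⟨S, hS, hcard⟩ := Set.Infinite.exists_subset_card_eq hinf D
    have := hρ.card_heights_le S fun s hs => hS hs
    omega
  set A := hfin.toFinset with hA
  have hmemA : ∀ s, s ∈ A ↔ IsHeight ρ s ∧ s ∈ Set.Ico (1 : ℝ) D := fun s => by simp [hA]
  have h1A : (1 : ℝ) ∈ A := (hmemA 1).2 ⟨⟨0, 1, hρ.isValue_one, by simp⟩, le_rfl, hD1⟩
  set N := A.card with hN
  have hNpos : 0 < N := Finset.card_pos.2 ⟨1, h1A⟩
  have hNz : (N : ℤ) ≠ 0 := by omega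
  have hmod : ∀ i : ℤ, (i % N).toNat < N := fun i => by
    have h1 := Int.emod_nonneg i hNz
    have h2 := Int.emod_lt_of_pos i (by omega : (0 : ℤ) < N)
    omega
  let f : Fin N ↪o ℝ := A.orderEmbOfFin rfl
  have hf : ∀ r, f r ∈ A := fun r => A.orderEmbOfFin_mem rfl r
  have hf0 : ∀ h : 0 < N, f ⟨0, h⟩ = 1 := by
    intro h
    obtain ⟨r, hr⟩ : ∃ r, f r = 1 := by
      have : (1 : ℝ) ∈ Set.range f := by rw [Finset.range_orderEmbOfFin]; exact h1A
      exact this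
    apply le_antisymm
    · rw [← hr]
      exact f.monotone (Nat.zero_le _)
    · exact ((hmemA _).1 (hf _)).2.1
  let ι : ℤ → ℝ := fun i => D ^ (i / N) * f ⟨(i % N).toNat, hmod i⟩
  have hι : ∀ (q : ℤ) (r : Fin N), ι (q * N + r) = D ^ q * f r := by
    intro q r
    have h1 : (q * N + r) / N = q := by
      rw [add_comm, Int.add_mul_ediv_right _ _ hNz, Int.ediv_eq_zero_of_lt (by omega) (by omega)]
      simp
    have h2 : (q * N + r : ℤ) % N = r := by
      rw [add_comm, Int.add_mul_emod_self_right]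
      exact Int.emod_eq_of_lt (by omega) (by omega)
    simp only [ι, h1]
    congr 2
    apply Fin.ext
    simp [h2]
  have hdecomp : ∀ i : ℤ, ∃ (q : ℤ) (r : Fin N), i = q * N + r := fun i =>
    ⟨i / N, ⟨(i % N).toNat, hmod i⟩, by
      have := Int.emod_add_mul_ediv i N
      have h1 := Int.emod_nonneg i hNz
      simp only [Int.toNat_of_nonneg h1]
      linarith⟩
  refine ⟨N, ι, hNpos, strictMono_int_of_lt_succ fun i => ?_, ?_, fun i => ?_, fun s hs => ?_,
    fun i => ?_⟩
  · obtain ⟨q, r, rfl⟩ := hdecomp i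
    by_cases hr : r.1 + 1 < N
    · have : q * N + (r : ℤ) + 1 = q * N + ((⟨r.1 + 1, hr⟩ : Fin N) : ℕ) := by push_cast; ring
      rw [this, hι, hι]
      exact mul_lt_mul_of_pos_left (f.strictMono (Nat.lt_succ_self _)) (zpow_pos hD _)
    · have : q * N + (r : ℤ) + 1 = (q + 1) * N + ((⟨0, hNpos⟩ : Fin N) : ℕ) := by
        have : (r : ℤ) + 1 = N := by omega
        push_cast
        linarith
      rw [this, hι, hι, hf0, zpow_add_one₀ hD.ne', mul_one]
      exact mul_lt_mul_of_pos_left ((hmemA _).1 (hf _)).2.2 (zpow_pos hD _)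
  · have := hι 0 ⟨0, hNpos⟩
    rw [hf0] at this
    simpa using this
  · obtain ⟨q, r, rfl⟩ := hdecomp i
    have : q * N + (r : ℤ) + N = (q + 1) * N + r := by ring
    rw [this, hι, hι, zpow_add_one₀ hD.ne']
    ring
  · have hs0 := hs.pos hρ
    obtain ⟨n, hn1, hn2⟩ := exists_mem_Ico_zpow hs0 hD1
    have hmem : (D : ℝ) ^ (-n) * s ∈ A := by
      refine (hmemA _).2 ⟨hs.zpow_mul hρ _, ?_, ?_⟩
      · rw [zpow_neg, inv_mul_eq_div, le_div_iff₀ (zpow_pos hD _), one_mul]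
        exact hn1
      · rw [zpow_neg, inv_mul_eq_div, div_lt_iff₀ (zpow_pos hD _), mul_comm, ← zpow_add_one₀ hD.ne']
        exact hn2
    obtain ⟨r, hr⟩ : ∃ r, f r = (D : ℝ) ^ (-n) * s := by
      have : (D : ℝ) ^ (-n) * s ∈ Set.range f := by rw [Finset.range_orderEmbOfFin]; exact hmem
      exact this
    refine ⟨n * N + r, ?_⟩
    rw [hι, hr, ← mul_assoc, ← zpow_add₀ hD.ne']
    simp
  · obtain ⟨q, r, rfl⟩ := hdecomp i
    rw [hι]
    exact ((hmemA _).1 (hf r)).1.zpow_mul hρ q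

end IsTreeMetric

namespace IsEnum

variable {ρ : Code D → Code D → ℝ} {N : ℕ} {ι : ℤ → ℝ}

lemma pos (hρ : IsTreeMetric ρ) (h : IsEnum ρ N ι) (i : ℤ) : 0 < ι i := (h.isHeight i).pos hρ

lemma add_mul (hρ : IsTreeMetric ρ) (h : IsEnum ρ N ι) (i k : ℤ) : ι (i + k * N) = D ^ k * ι i := by
  have hD := hρ.pos'.ne'
  induction k using Int.induction_on with
  | zero => simp
  | succ k ih =>
    rw [_root_.add_mul, one_mul, ← add_assoc, h.add, ih, zpow_add_one₀ hD]
    ring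
  | pred k ih =>
    have h1 := h.add (i + (-k - 1) * N)
    have h2 : i + (-k - 1) * N + N = i + -k * (N : ℤ) := by ring
    rw [h2, ih] at h1
    rw [zpow_sub_one₀ hD]
    field_simp
    linarith

lemma mul_eq (hρ : IsTreeMetric ρ) (h : IsEnum ρ N ι) (k : ℤ) : ι (k * N) = D ^ k := by
  have := h.add_mul hρ 0 k
  rwa [zero_add, h.zero, mul_one] at this

lemma exists_lt (hρ : IsTreeMetric ρ) (h : IsEnum ρ N ι) {s : ℝ} (hs : 0 < s) :
    ∃ i, ι i < s := by
  obtain ⟨k, hk⟩ := hρ.exists_pow_lt hs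
  refine ⟨-k * N, ?_⟩
  rwa [h.mul_eq hρ, zpow_neg, zpow_natCast, ← inv_pow]

lemma exists_gt (hρ : IsTreeMetric ρ) (h : IsEnum ρ N ι) (s : ℝ) : ∃ i, s < ι i := by
  obtain ⟨k, hk⟩ := pow_unbounded_of_one_lt s hρ.one_lt'
  refine ⟨k * N, ?_⟩
  rwa [h.mul_eq hρ, zpow_natCast]

lemma exists_eq_of_pos (h : IsEnum ρ N ι) {x y : Code D} (hxy : 0 < ρ x y) : ∃ i, ι i = ρ x y :=
  h.exists_eq _ ⟨0, ρ x y, ⟨hxy, x, y, rfl⟩, by simp⟩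

lemma lt (hρ : IsTreeMetric ρ) (h : IsEnum ρ N ι) : N < D := by
  classical
  have h1 := hρ.card_heights_le ((Finset.range N).image fun r : ℕ => ι r) (by
    intro s hs
    obtain ⟨r, hr, rfl⟩ := Finset.mem_image.1 hs
    rw [Finset.mem_range] at hr
    refine ⟨h.isHeight _, ?_, ?_⟩
    · rw [← h.zero]
      exact h.strictMono.monotone (by omega)
    · have := h.mul_eq hρ 1
      rw [one_mul, zpow_one] at this
      rw [← this]
      exact h.strictMono (by omega))
  rw [Finset.card_image_of_injective _ fun a b hab => by
    have := h.strictMono.injective hab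
    omega, Finset.card_range] at h1
  omega

lemma le_of_lt_succ (hρ : IsTreeMetric ρ) (h : IsEnum ρ N ι) {x y : Code D} {i : ℤ}
    (hxy : ρ x y < ι (i + 1)) : ρ x y ≤ ι i := by
  rcases (hρ.nonneg x y).eq_or_lt with h0 | h0
  · rw [← h0]
    exact (h.pos hρ i).le
  · obtain ⟨j, hj⟩ := h.exists_eq_of_pos h0
    rw [← hj] at hxy ⊢
    have := h.strictMono.lt_iff_lt.1 hxy
    exact h.strictMono.monotone (by omega)

/-- The enumeration of the heights depends only on the set of heights. -/
lemma unique {ρ' : Code D → Code D → ℝ} {N' : ℕ} {ι' : ℤ → ℝ} (h : IsEnum ρ N ι) (h' : IsEnum ρ' N' ι')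
    (hh : ∀ s, IsTreeMetric.IsHeight ρ s ↔ IsTreeMetric.IsHeight ρ' s) : ι = ι' ∧ N = N' := by
  have h1 : ∀ i, ∃ j, ι' j = ι i := fun i => h'.exists_eq _ ((hh _).1 (h.isHeight i))
  have h2 : ∀ j, ∃ i, ι i = ι' j := fun j => h.exists_eq _ ((hh _).2 (h'.isHeight j))
  choose g hg using h1
  have hgm : StrictMono g := fun a b hab => by
    rw [← h'.strictMono.lt_iff_lt, hg, hg]
    exact h.strictMono hab
  have hgs : Function.Surjective g := fun j => by
    obtain ⟨i, hi⟩ := h2 j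
    exact ⟨i, h'.strictMono.injective (by rw [hg, hi])⟩
  have hg0 : g 0 = 0 := h'.strictMono.injective (by rw [hg, h.zero, h'.zero])
  have hsucc : ∀ i, g (i + 1) = g i + 1 := by
    intro i
    obtain ⟨k, hk⟩ := hgs (g i + 1)
    have h3 : i < k := hgm.lt_iff_lt.1 (by omega)
    have h4 : k < i + 2 := by
      by_contra! hc
      have h5 : g i < g (i + 1) := hgm (by omega)
      have h6 : g (i + 1) < g k := hgm (by omega)
      omega
    have : k = i + 1 := by omega
    rw [← this, hk]
  have hgid : ∀ i, g i = i := by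
    intro i
    induction i using Int.induction_on with
    | zero => exact hg0
    | succ k ih => rw [hsucc, ih]
    | pred k ih =>
      have := hsucc (-k - 1)
      rw [sub_add_cancel, ih] at this
      omega
  have he : ι = ι' := funext fun i => by rw [← hg, hgid]
  refine ⟨he, ?_⟩
  have h3 := h.add 0
  have h4 := h'.add 0
  rw [h.zero, zero_add] at h3
  rw [h'.zero, zero_add] at h4
  have := h'.strictMono.injective (h4.trans (h3.symm.trans (congrFun he _)))
  omega

end IsEnum

/-! ### The standard metric and truncation -/

open Classical in
/-- The standard ultrametric on words, which belongs to the tree all of whose critical points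
lie at the base. -/
noncomputable def std (x y : Code D) : ℝ :=
  if x = y then 0 else ((D : ℝ)⁻¹) ^ (PiNat.firstDiff x y)

lemma std_refl (x : Code D) : std x x = 0 := by simp [std]

lemma std_symm (x y : Code D) : std x y = std y x := by
  by_cases h : x = y
  · rw [h]
  · rw [std, std, if_neg h, if_neg (Ne.symm h), PiNat.firstDiff_comm]

lemma std_nonneg (x y : Code D) : 0 ≤ std x y := by
  unfold std
  split_ifs <;> positivity

lemma one_lt_of_ne {x y : Code D} (h : x ≠ y) : 1 < D := by
  obtain ⟨n, hn⟩ := Function.ne_iff.1 h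
  have h1 := (x n).2
  have h2 := (y n).2
  have : (x n).1 ≠ (y n).1 := fun h => hn (Fin.ext h)
  omega

lemma std_le_one (x y : Code D) : std x y ≤ 1 := by
  unfold std
  split_ifs with h
  · norm_num
  · refine pow_le_one₀ (by positivity) (inv_le_one_of_one_le₀ ?_)
    exact_mod_cast (one_lt_of_ne h).le

lemma std_ultra (x y z : Code D) : std x z ≤ max (std x y) (std y z) := by
  by_cases hxy : x = y
  · subst hxy
    exact le_max_right _ _
  by_cases hyz : y = z
  · subst hyz
    exact le_max_left _ _
  by_cases hxz : x = z
  · subst hxz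
    rw [std_refl]
    exact (std_nonneg _ _).trans (le_max_left _ _)
  have h1 := PiNat.min_firstDiff_le x y z hxz
  have hD : (D : ℝ)⁻¹ ≤ 1 := inv_le_one_of_one_le₀ (by exact_mod_cast (one_lt_of_ne hxy).le)
  have hD' : (0 : ℝ) ≤ (D : ℝ)⁻¹ := by positivity
  simp only [std, if_neg hxy, if_neg hyz, if_neg hxz]
  rcases min_le_iff.1 h1 with h | h
  · exact (pow_le_pow_of_le_one hD' hD h).trans (le_max_left _ _)
  · exact (pow_le_pow_of_le_one hD' hD h).trans (le_max_right _ _)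

lemma std_of_ne {x y : Code D} (h : x 0 ≠ y 0) : std x y = 1 := by
  have hxy : x ≠ y := fun e => h (e ▸ rfl)
  have : PiNat.firstDiff x y = 0 := by
    by_contra h0
    exact h (PiNat.apply_eq_of_lt_firstDiff (Nat.pos_of_ne_zero h0))
  rw [std, if_neg hxy, this, pow_zero]

lemma std_of_eq {x y : Code D} (h : x 0 = y 0) : std x y = std (shift x) (shift y) / D := by
  by_cases hxy : x = y
  · subst hxy
    simp [std_refl]
  have hs : shift x ≠ shift y := by
    intro e
    apply hxy
    rw [← cons_shift x, ← cons_shift y, e, h]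
  have hd : PiNat.firstDiff x y = PiNat.firstDiff (shift x) (shift y) + 1 := by
    apply le_antisymm
    · by_contra! hc
      exact PiNat.apply_firstDiff_ne hs
        (PiNat.apply_eq_of_lt_firstDiff (x := x) (y := y) hc)
    · by_contra! hc
      have hne := PiNat.apply_firstDiff_ne hxy
      rcases Nat.eq_zero_or_pos (PiNat.firstDiff x y) with h0 | h0
      · rw [h0] at hne
        exact hne h
      · obtain ⟨m, hm⟩ := Nat.exists_eq_succ_of_ne_zero h0.ne'
        rw [hm] at hne hc
        exact hne (PiNat.apply_eq_of_lt_firstDiff (x := shift x) (y := shift y) (n := m) (by omega))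
  rw [std, std, if_neg hxy, if_neg hs, hd, pow_succ, div_eq_mul_inv]

lemma std_le_mul (x y : Code D) : std (shift x) (shift y) ≤ D * std x y := by
  by_cases hxy : x = y
  · subst hxy
    simp [std_refl]
  have hD : (1 : ℝ) < D := by exact_mod_cast one_lt_of_ne hxy
  by_cases h : x 0 = y 0
  · rw [std_of_eq h, mul_div_cancel₀ _ (by positivity)]
  · rw [std_of_ne h, mul_one]
    exact (std_le_one _ _).trans hD.le

lemma mem_ball {ρ : Code D → Code D → ℝ} {s : ℝ} {x y : Code D} : y ∈ ball ρ s x ↔ ρ x y ≤ s :=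
  Iff.rfl

/-- Below a height `t` at which all inverse branches are separated, all local degrees are `1` and
the Riemann–Hurwitz inequality is automatic. -/
lemma isTreeMetric_of_separated {σ : Code D → Code D → ℝ} {t : ℝ} (refl : ∀ x, σ x x = 0)
    (symm : ∀ x y, σ x y = σ y x) (ultra : ∀ x y z, σ x z ≤ max (σ x y) (σ y z))
    (cons : ∀ a u u', σ (cons a u) (cons a u') = σ u u' / D)
    (shift : ∀ x y, σ (shift x) (shift y) ≤ D * σ x y) (le_one : ∀ x y, σ x y ≤ 1)
    (exists_one : ∃ x y, σ x y = 1) (sep : ∀ x y, x 0 ≠ y 0 → t ≤ σ x y)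
    (rh : ∀ z s s', 0 < s' → t ≤ s' → s' ≤ s →
      deg σ s z * cnt σ (D * s') (ball σ (D * s) (Code.shift z)) + 1 ≤
        cnt σ s' (ball σ s z) + deg σ s z) : IsTreeMetric σ := by
  classical
  refine ⟨refl, symm, ultra, cons, shift, le_one, exists_one, fun z s s' hs' hss => ?_⟩
  rcases le_or_gt t s' with h | h
  · exact rh z s s' hs' h hss
  have hD : 0 < (D : ℝ) := by
    obtain ⟨x, -⟩ := exists_one
    have := (x 0).2
    exact_mod_cast (by omega : 0 < D)
  have hdeg : 1 ≤ deg σ s z := by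
    refine Finset.card_pos.2 ⟨z 0, ?_⟩
    simp [cons_shift, refl, hs'.le.trans hss]
  suffices hmul : deg σ s z * cnt σ (D * s') (ball σ (D * s) (Code.shift z)) ≤
      cnt σ s' (ball σ s z) by omega
  let A : Set (Fin D) := {a | σ (Code.cons a (Code.shift z)) z ≤ s}
  let ψ : Set (Code D) → Set (Fin D) × Set (Code D) := fun B =>
    ({a | ∃ u, Code.cons a u ∈ B}, {u | ∃ a, Code.cons a u ∈ B})
  have hψ : ∀ a u, ψ (ball σ s' (Code.cons a u)) = ({a}, ball σ (D * s') u) := by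
    intro a u
    have key : ∀ b v, σ (Code.cons a u) (Code.cons b v) ≤ s' ↔ b = a ∧ σ u v ≤ D * s' := by
      intro b v
      constructor
      · intro hle
        have hab : b = a := by
          by_contra hne
          exact absurd (sep (Code.cons a u) (Code.cons b v) fun e => hne e.symm)
            (not_le.2 (hle.trans_lt h))
        subst hab
        rw [cons, div_le_iff₀ hD, mul_comm] at hle
        exact ⟨rfl, hle⟩
      · rintro ⟨rfl, hle⟩
        rwa [cons, div_le_iff₀ hD, mul_comm]
    refine Prod.ext ?_ ?_
    · ext b
      simp only [ψ, mem_ball, key, Set.mem_ofPred_eq, Set.mem_singleton_iff]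
      exact ⟨fun ⟨_, h1, _⟩ => h1, fun h1 => ⟨u, h1, by rw [refl]; positivity⟩⟩
    · ext v
      simp only [ψ, mem_ball, key, Set.mem_ofPred_eq]
      exact ⟨fun ⟨_, _, h1⟩ => h1, fun h1 => ⟨a, rfl, h1⟩⟩
  have hsub : ((fun a => ({a} : Set (Fin D))) '' A) ×ˢ
      (ball σ (D * s') '' ball σ (D * s) (Code.shift z)) ⊆ ψ '' (ball σ s' '' ball σ s z) := by
    rintro ⟨_, _⟩ ⟨⟨a, ha, rfl⟩, ⟨u, hu, rfl⟩⟩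
    refine ⟨_, ⟨Code.cons a u, ?_, rfl⟩, hψ a u⟩
    rw [mem_ball] at hu ⊢
    have h1 : σ (Code.cons a (Code.shift z)) (Code.cons a u) ≤ s := by
      rwa [cons, div_le_iff₀ hD, mul_comm]
    refine (ultra _ (Code.cons a (Code.shift z)) _).trans (max_le ?_ h1)
    rw [symm]
    exact ha
  have hfin : (ball σ s' '' ball σ s z).Finite := by
    obtain ⟨k, hk⟩ := exists_pow_lt_of_lt_one hs' (inv_lt_one_of_one_lt₀ (by
      obtain ⟨x, y, hxy⟩ := exists_one
      have : x ≠ y := by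
        rintro rfl
        rw [refl] at hxy
        norm_num at hxy
      exact_mod_cast one_lt_of_ne this : (1 : ℝ) < D))
    have hag : ∀ (k : ℕ) (x y : Code D), (∀ n < k, x n = y n) → σ x y ≤ ((D : ℝ)⁻¹) ^ k := by
      intro k
      induction k with
      | zero => exact fun x y _ => by simpa using le_one x y
      | succ k ih =>
        intro x y hxy
        rw [← cons_shift x, ← cons_shift y, hxy 0 (Nat.succ_pos k), cons, pow_succ,
          div_eq_mul_inv]
        exact mul_le_mul_of_nonneg_right (ih _ _ fun n hn => hxy (n + 1) (by omega))
          (inv_nonneg.2 hD.le)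
    refine ((finite_range_splice z k).image (ball σ s')).subset ?_
    rintro _ ⟨x, -, rfl⟩
    refine ⟨_, ⟨x, rfl⟩, ?_⟩
    have h1 : σ x (splice z k x) ≤ s' := (hag k _ _ (splice_agree z k x)).trans hk.le
    ext y
    rw [mem_ball, mem_ball]
    exact ⟨fun h2 => (ultra _ _ _).trans (max_le h1 h2),
      fun h2 => (ultra _ _ _).trans (max_le (symm x _ ▸ h1) h2)⟩
  calc deg σ s z * cnt σ (D * s') (ball σ (D * s) (Code.shift z))
      = (((fun a => ({a} : Set (Fin D))) '' A) ×ˢ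
          (ball σ (D * s') '' ball σ (D * s) (Code.shift z))).ncard := by
        rw [Set.ncard_prod, Set.ncard_image_of_injective _ Set.singleton_injective]
        congr 1
        rw [deg, ← Set.ncard_coe_finset]
        simp [A]
    _ ≤ (ψ '' (ball σ s' '' ball σ s z)).ncard := Set.ncard_le_ncard hsub (hfin.image ψ)
    _ ≤ cnt σ s' (ball σ s z) := Set.ncard_image_le hfin

lemma isTreeMetric_std (hD : 2 ≤ D) : IsTreeMetric (std (D := D)) := by
  classical
  have hcons : ∀ (a : Fin D) u u', std (cons a u) (cons a u') = std u u' / D :=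
    fun a u u' => std_of_eq rfl
  let o : Code D := fun _ => ⟨0, by omega⟩
  have hball : ∀ s : ℝ, 1 ≤ s → ∀ x : Code D, ball std s x = Set.univ := fun s hs x =>
    Set.eq_univ_of_forall fun y => (std_le_one x y).trans hs
  have hcnt : ∀ s : ℝ, 1 ≤ s → cnt std s (Set.univ : Set (Code D)) = 1 := by
    intro s hs
    rw [cnt, Set.ncard_eq_one]
    refine ⟨Set.univ, ?_⟩
    ext B
    constructor
    · rintro ⟨x, -, rfl⟩
      exact hball s hs x
    · rintro rfl
      exact ⟨o, trivial, hball s hs o⟩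
  refine isTreeMetric_of_separated (t := 1) std_refl std_symm std_ultra hcons std_le_mul std_le_one
    ⟨cons ⟨0, by omega⟩ o, cons ⟨1, by omega⟩ o, std_of_ne (by simp)⟩
    (fun x y h => (std_of_ne h).ge) fun z s s' _ hs' hss => ?_
  have hDr : (1 : ℝ) ≤ D := by exact_mod_cast (by omega : 1 ≤ D)
  rw [hball s (hs'.trans hss), hball (D * s) (by nlinarith), hcnt s' hs',
    hcnt (D * s') (by nlinarith)]
  omega

/-- The tree metric truncated at height `t`: above `t` the tree is kept, and below `t` all inverse
branches are separated, so that no critical point is left there. -/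
noncomputable def trunc (t : ℝ) (ρ : Code D → Code D → ℝ) (x y : Code D) : ℝ :=
  max (ρ x y) (t * std x y)

lemma ball_trunc {ρ : Code D → Code D → ℝ} {t s : ℝ} (ht : 0 ≤ t) (h : t ≤ s) :
    ball (trunc t ρ) s = ball ρ s := by
  funext x
  ext y
  rw [mem_ball, mem_ball, trunc, max_le_iff, and_iff_left_iff_imp]
  intro _
  nlinarith [std_nonneg x y, std_le_one x y]

lemma IsTreeMetric.le_std {ρ : Code D → Code D → ℝ} (hρ : IsTreeMetric ρ) (x y : Code D) :
    ρ x y ≤ std x y := by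
  unfold std
  split_ifs with h
  · rw [h, hρ.refl]
  · exact hρ.le_of_agree _ fun n hn => PiNat.apply_eq_of_lt_firstDiff hn

lemma trunc_zero {ρ : Code D → Code D → ℝ} (hρ : IsTreeMetric ρ) : trunc 0 ρ = ρ := by
  funext x y
  simp [trunc, hρ.nonneg]

lemma trunc_one {ρ : Code D → Code D → ℝ} (hρ : IsTreeMetric ρ) : trunc 1 ρ = std := by
  funext x y
  simp [trunc, hρ.le_std]

lemma trunc_cons {ρ : Code D → Code D → ℝ} (hρ : IsTreeMetric ρ) (t : ℝ) (a : Fin D)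
    (u u' : Code D) : trunc t ρ (cons a u) (cons a u') = trunc t ρ u u' / D := by
  have : std (cons a u) (cons a u') = std u u' / D := std_of_eq rfl
  rw [trunc, trunc, hρ.cons, this, ← mul_div_assoc, max_div_div_right hρ.pos'.le]

lemma IsTreeMetric.trunc {ρ : Code D → Code D → ℝ} (hρ : IsTreeMetric ρ) {t : ℝ} (ht : 0 ≤ t)
    (ht1 : t ≤ 1) : IsTreeMetric (trunc t ρ) := by
  classical
  have hD := hρ.one_lt'
  refine isTreeMetric_of_separated (t := t) (fun x => ?_) (fun x y => ?_) (fun x y z => ?_)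
    (trunc_cons hρ t) (fun x y => ?_) (fun x y => ?_) ?_ (fun x y h => ?_)
    fun z s s' hs' hts hss => ?_
  · simp [PolyTree.trunc, hρ.refl, std_refl]
  · rw [PolyTree.trunc, PolyTree.trunc, hρ.symm, std_symm]
  · simp only [PolyTree.trunc]
    refine max_le ?_ ?_
    · exact (hρ.ultra x y z).trans (max_le_max (le_max_left _ _) (le_max_left _ _))
    · calc t * std x z ≤ t * max (std x y) (std y z) :=
            mul_le_mul_of_nonneg_left (std_ultra x y z) ht
        _ = max (t * std x y) (t * std y z) := mul_max_of_nonneg _ _ ht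
        _ ≤ _ := max_le_max (le_max_right _ _) (le_max_right _ _)
  · simp only [PolyTree.trunc]
    rw [mul_max_of_nonneg _ _ hρ.pos'.le]
    refine max_le_max (hρ.shift x y) ?_
    calc t * std (Code.shift x) (Code.shift y) ≤ t * (D * std x y) :=
          mul_le_mul_of_nonneg_left (std_le_mul x y) ht
      _ = D * (t * std x y) := by ring
  · exact max_le (hρ.le_one x y) (by nlinarith [std_nonneg x y, std_le_one x y])
  · obtain ⟨x, y, hxy⟩ := hρ.exists_one
    refine ⟨x, y, ?_⟩
    rw [PolyTree.trunc, hxy, max_eq_left]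
    nlinarith [std_nonneg x y, std_le_one x y]
  · rw [PolyTree.trunc, std_of_ne h, mul_one]
    exact le_max_right _ _
  · have h1 : t ≤ s := hts.trans hss
    have h2 : t ≤ D * s := by nlinarith
    have h3 : t ≤ D * s' := by nlinarith
    have hdeg : deg (PolyTree.trunc t ρ) s z = deg ρ s z := by
      unfold deg
      congr 1
      refine Finset.filter_congr fun a _ => ?_
      rw [← mem_ball (ρ := ρ), ← ball_trunc ht h1]
      rfl
    rw [hdeg, ball_trunc ht h1, ball_trunc ht h2, cnt, cnt, ball_trunc ht h3, ball_trunc ht hts]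
    exact hρ.riemannHurwitz z s s' hs' hss

/-! ### The compact space of tree metrics -/

/-- At radii slightly larger than `s`, the balls of metrics converging to `ρ` are eventually the
balls of radius `s` of `ρ`. -/
lemma eventually_ball_eq {α : Type*} {l : Filter α} [l.NeBot] {f : α → Code D → Code D → ℝ}
    {ρ : Code D → Code D → ℝ} (hf : ∀ᶠ n in l, IsTreeMetric (f n))
    (h : ∀ x y, Tendsto (fun n => f n x y) l (𝓝 (ρ x y))) {s : ℝ} (hs : 0 < s) :
    ∀ᶠ δ in 𝓝[>] (1 : ℝ), ∀ᶠ n in l, ball (f n) (δ * s) = ball ρ s := by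
  obtain ⟨n0, hn0⟩ := hf.exists
  obtain ⟨o, -⟩ := hn0.exists_one
  obtain ⟨k, hk⟩ := hn0.exists_pow_lt hs
  have hE := finite_range_splice o k
  have hfar : ∀ᶠ δ in 𝓝[>] (1 : ℝ), ∀ p ∈ Set.range (splice o k) ×ˢ Set.range (splice o k),
      s < ρ p.1 p.2 → δ * s < ρ p.1 p.2 := by
    rw [eventually_all_finite (hE.prod hE)]
    intro p _
    by_cases hp : s < ρ p.1 p.2
    · have : Tendsto (fun δ : ℝ => δ * s) (𝓝[>] 1) (𝓝 (1 * s)) :=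
        ((continuous_id.mul continuous_const).tendsto 1).mono_left nhdsWithin_le_nhds
      rw [one_mul] at this
      filter_upwards [this.eventually (gt_mem_nhds hp)] with δ hδ _ using hδ
    · exact Eventually.of_forall fun δ h => absurd h hp
  filter_upwards [hfar, self_mem_nhdsWithin] with δ hδ hδ1
  have hsδ : s < δ * s := by
    have : (1 : ℝ) < δ := hδ1
    nlinarith
  have hall : ∀ᶠ n in l, ∀ p ∈ Set.range (splice o k) ×ˢ Set.range (splice o k),
      (f n p.1 p.2 ≤ δ * s ↔ ρ p.1 p.2 ≤ s) := by
    rw [eventually_all_finite (hE.prod hE)]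
    intro p hp
    by_cases hps : s < ρ p.1 p.2
    · filter_upwards [(h p.1 p.2).eventually (lt_mem_nhds (hδ p hp hps))] with n hn
      exact iff_of_false (not_le.2 hn) (not_le.2 hps)
    · filter_upwards [(h p.1 p.2).eventually (gt_mem_nhds ((not_lt.1 hps).trans_lt hsδ))] with n hn
      exact iff_of_true hn.le (not_lt.1 hps)
  have hag : ∀ x, ρ x (splice o k x) ≤ s := fun x =>
    le_of_tendsto (h _ _) (hf.mono fun n hn => (hn.le_of_agree k (splice_agree o k x)).trans hk.le)
  have hsymm : ∀ x y, ρ x y = ρ y x := fun x y =>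
    tendsto_nhds_unique ((h x y).congr' (hf.mono fun n hn => hn.symm x y)) (h y x)
  have hultra : ∀ x y z, ρ x z ≤ max (ρ x y) (ρ y z) := fun x y z =>
    le_of_tendsto_of_tendsto (h x z) ((h x y).max (h y z)) (hf.mono fun n hn => hn.ultra x y z)
  filter_upwards [hall, hf] with n hn hfn
  funext x
  ext y
  rw [mem_ball, mem_ball]
  have h1 : f n x (splice o k x) ≤ δ * s :=
    (hfn.le_of_agree k (splice_agree o k x)).trans (hk.le.trans hsδ.le)
  have h2 : f n y (splice o k y) ≤ δ * s :=
    (hfn.le_of_agree k (splice_agree o k y)).trans (hk.le.trans hsδ.le)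
  have h3 := hn (splice o k x, splice o k y) ⟨⟨x, rfl⟩, ⟨y, rfl⟩⟩
  constructor
  · intro h4
    have h5 := h3.1 (hfn.ultra_le (hfn.ultra_le (hfn.symm_le h1) h4) h2)
    exact (hultra _ _ _).trans (max_le ((hultra _ _ _).trans (max_le (hag x) h5))
      (hsymm y _ ▸ hag y))
  · intro h4
    have h5 := h3.2 ((hultra _ _ _).trans (max_le ((hultra _ _ _).trans
      (max_le (hsymm x _ ▸ hag x) h4)) (hag y)))
    exact hfn.ultra_le (hfn.ultra_le h1 h5) (hfn.symm_le h2)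

/-- A pointwise limit of tree metrics is a tree metric. -/
lemma IsTreeMetric.of_tendsto {α : Type*} {l : Filter α} [l.NeBot] {f : α → Code D → Code D → ℝ}
    {ρ : Code D → Code D → ℝ} (hf : ∀ᶠ n in l, IsTreeMetric (f n))
    (h : ∀ x y, Tendsto (fun n => f n x y) l (𝓝 (ρ x y))) : IsTreeMetric ρ := by
  classical
  obtain ⟨n0, hn0⟩ := hf.exists
  obtain ⟨o, -⟩ := hn0.exists_one
  refine ⟨fun x => ?_, fun x y => ?_, fun x y z => ?_, fun a u u' => ?_, fun x y => ?_,
    fun x y => ?_, ?_, fun z s s' hs' hss => ?_⟩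
  · exact tendsto_nhds_unique ((h x x).congr' (hf.mono fun n hn => hn.refl x)) tendsto_const_nhds
  · exact tendsto_nhds_unique ((h x y).congr' (hf.mono fun n hn => hn.symm x y)) (h y x)
  · exact le_of_tendsto_of_tendsto (h x z) ((h x y).max (h y z))
      (hf.mono fun n hn => hn.ultra x y z)
  · exact tendsto_nhds_unique ((h _ _).congr' (hf.mono fun n hn => hn.cons a u u'))
      ((h u u').div_const _)
  · exact le_of_tendsto_of_tendsto (h _ _) ((h x y).const_mul _)
      (hf.mono fun n hn => hn.shift x y)
  · exact le_of_tendsto (h x y) (hf.mono fun n hn => hn.le_one x y)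
  · -- the value `1` is attained at words that differ in their first letters only
    by_contra hcon
    have hlt : ∀ p : Fin D × Fin D, ∀ᶠ n in l, f n (Code.cons p.1 o) (Code.cons p.2 o) < 1 := by
      intro p
      refine (h _ _).eventually (gt_mem_nhds (lt_of_le_of_ne ?_ fun e => hcon ⟨_, _, e⟩))
      exact le_of_tendsto (h _ _) (hf.mono fun n hn => hn.le_one _ _)
    obtain ⟨n, hn, hfn⟩ := ((eventually_all.2 hlt).and hf).exists
    obtain ⟨x, y, hxy⟩ := hfn.exists_one
    have hlt1 : ∀ x : Code D, f n x (Code.cons (x 0) o) < 1 := fun x =>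
      (hfn.le_of_agree 1 (y := Code.cons (x 0) o) fun m hm => by
        obtain rfl : m = 0 := by omega
        rfl).trans_lt (by simpa using inv_lt_one_of_one_lt₀ hfn.one_lt')
    have := hfn.eq_of_close (x := x) (y := y) (x' := Code.cons (x 0) o) (y' := Code.cons (y 0) o)
      (hxy ▸ hlt1 x) (hxy ▸ hlt1 y)
    exact (hn (x 0, y 0)).ne (this.trans hxy)
  · -- for a suitable `δ > 1`, all the balls that occur are balls of some `f n` at radii enlarged
    -- by the factor `δ`
    have hs := hs'.trans_le hss
    have hD := hn0.pos'
    obtain ⟨δ, ⟨⟨⟨h1, h2⟩, h3⟩, h4⟩, hδ⟩ := ((((eventually_ball_eq hf h hs).and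
      (eventually_ball_eq hf h hs')).and (eventually_ball_eq hf h (mul_pos hD hs))).and
      (eventually_ball_eq hf h (mul_pos hD hs'))).and self_mem_nhdsWithin |>.exists
    have hδ0 : 0 < δ := one_pos.trans hδ
    obtain ⟨n, ⟨⟨⟨⟨e1, e2⟩, e3⟩, e4⟩, hfn⟩⟩ := ((((h1.and h2).and h3).and h4).and hf).exists
    have key := hfn.riemannHurwitz z (δ * s) (δ * s') (mul_pos hδ0 hs')
      (mul_le_mul_of_nonneg_left hss hδ0.le)
    have hdeg : deg (f n) (δ * s) z = deg ρ s z := by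
      unfold deg
      congr 1
      refine Finset.filter_congr fun a _ => ?_
      rw [← mem_ball (ρ := ρ), ← e1]
      rfl
    rw [mul_left_comm (D : ℝ) δ s, mul_left_comm (D : ℝ) δ s', hdeg, e3, e1, cnt, cnt, e4, e2] at key
    exact key

/-- The space of tree metrics, with the topology of pointwise convergence. -/
abbrev TreeMetric (D : ℕ) : Type := {ρ : Code D → Code D → ℝ // IsTreeMetric ρ}

lemma tendsto_treeMetric {α : Type*} {l : Filter α} {f : α → TreeMetric D} {ρ : TreeMetric D} :
    Tendsto f l (𝓝 ρ) ↔ ∀ x y, Tendsto (fun n => (f n).1 x y) l (𝓝 (ρ.1 x y)) := by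
  rw [tendsto_subtype_rng, tendsto_pi_nhds]
  simp only [tendsto_pi_nhds]

instance : CompactSpace (TreeMetric D) := by
  have hclosed : IsClosed {ρ : Code D → Code D → ℝ | IsTreeMetric ρ} := by
    rw [isClosed_iff_ultrafilter]
    intro ρ u hu hmem
    have hmem' : ∀ᶠ ρ in (u : Filter (Code D → Code D → ℝ)), IsTreeMetric ρ := hmem
    refine IsTreeMetric.of_tendsto hmem' fun x y => ?_
    have h1 : Tendsto (fun ρ : Code D → Code D → ℝ => ρ x y) (𝓝 ρ) (𝓝 (ρ x y)) :=
      ((continuous_apply y).comp (continuous_apply x)).tendsto ρ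
    exact h1.mono_left hu
  have hcomp : IsCompact (Set.univ.pi fun _ : Code D => Set.univ.pi fun _ : Code D =>
      Set.Icc (0 : ℝ) 1) := isCompact_univ_pi fun _ => isCompact_univ_pi fun _ => isCompact_Icc
  refine isCompact_iff_compactSpace.1 (hcomp.of_isClosed_subset hclosed fun ρ hρ => ?_)
  exact fun x _ y _ => ⟨IsTreeMetric.nonneg hρ x y, IsTreeMetric.le_one hρ x y⟩

/-- A tree metric is determined by its values on the countably many eventually constant words. -/
lemma metrizableSpace_treeMetric (hD : 2 ≤ D) : TopologicalSpace.MetrizableSpace (TreeMetric D) := by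
  let o : Code D := fun _ => ⟨0, by omega⟩
  let W : Set (Code D) := ⋃ k, Set.range (splice o k)
  have hW : W.Countable := Set.countable_iUnion fun k => (finite_range_splice o k).countable
  have : Countable W := hW.to_subtype
  let F : TreeMetric D → (W × W → ℝ) := fun ρ p => ρ.1 p.1 p.2
  have hF : Continuous F := continuous_pi fun p =>
    (continuous_apply p.2.1).comp ((continuous_apply p.1.1).comp continuous_subtype_val)
  have hinj : Function.Injective F := by
    intro ρ ρ' h
    apply Subtype.ext
    funext x y
    by_contra hne
    have hpos : 0 < |ρ.1 x y - ρ'.1 x y| := abs_pos.2 (sub_ne_zero.2 hne)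
    obtain ⟨k, hk⟩ := ρ.2.exists_pow_lt (half_pos (half_pos hpos))
    have h1 := ρ.2.abs_sub_le (ρ.2.le_of_agree k (splice_agree o k x))
      (ρ.2.le_of_agree k (splice_agree o k y))
    have h2 := ρ'.2.abs_sub_le (ρ'.2.le_of_agree k (splice_agree o k x))
      (ρ'.2.le_of_agree k (splice_agree o k y))
    have h3 : ρ.1 (splice o k x) (splice o k y) = ρ'.1 (splice o k x) (splice o k y) :=
      congrFun h (⟨_, Set.mem_iUnion.2 ⟨k, x, rfl⟩⟩, ⟨_, Set.mem_iUnion.2 ⟨k, y, rfl⟩⟩)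
    rw [h3] at h1
    have h4 := abs_sub_abs_le_abs_sub (ρ.1 x y - ρ'.1 x y) 0
    have h5 : |ρ.1 x y - ρ'.1 x y| ≤ |ρ'.1 (splice o k x) (splice o k y) - ρ'.1 x y| +
        |ρ'.1 (splice o k x) (splice o k y) - ρ.1 x y| := by
      rw [abs_sub_comm _ (ρ.1 x y), add_comm]
      exact _root_.abs_sub_le _ _ _
    linarith
  exact (hF.isClosedEmbedding hinj).isEmbedding.metrizableSpace

/-! ### Ends of graphs -/

section Ends

variable {V : Type} {G : SimpleGraph V}

/-- The set of vertices of the component of the complement of `K` that contains the end `e`. -/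
def endComp (e : G.end) (K : Finset V) : Set V :=
  SimpleGraph.ComponentCompl.supp (K := (K : Set V)) (e.1 (Opposite.op K))

lemma endComp_mono (e : G.end) {K L : Finset V} (h : K ⊆ L) : endComp e L ⊆ endComp e K := by
  have h1 : (e.1 (Opposite.op L)).hom (Finset.coe_subset.2 h) = e.1 (Opposite.op K) :=
    e.2 (CategoryTheory.opHomOfLE h)
  intro v hv
  have := SimpleGraph.ComponentCompl.subset_hom (e.1 (Opposite.op L)) (Finset.coe_subset.2 h) hv
  rw [h1] at this
  exact this

lemma endComp_infinite (e : G.end) (K : Finset V) : (endComp e K).Infinite :=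
  G.end_componentCompl_infinite e (Opposite.op K)

lemma notMem_of_mem_endComp {e : G.end} {K : Finset V} {v : V} (h : v ∈ endComp e K) : v ∉ K := by
  obtain ⟨h1, -⟩ := h
  simpa using h1

lemma mem_endComp_of_adj {e : G.end} {K : Finset V} {v w : V} (h : v ∈ endComp e K) (hw : w ∉ K)
    (a : G.Adj v w) : w ∈ endComp e K :=
  SimpleGraph.ComponentCompl.mem_of_adj (C := e.1 (Opposite.op K)) v w h (by simpa using hw) a

lemma comp_eq_of_mem {K : Finset V} {C C' : G.ComponentCompl (K : Set V)} {v : V}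
    (h : v ∈ C.supp) (h' : v ∈ C'.supp) : C = C' := by
  obtain ⟨_, rfl⟩ := h
  obtain ⟨_, rfl⟩ := h'
  rfl

lemma endComp_eq_of_mem {e e' : G.end} {K : Finset V} {v : V} (h : v ∈ endComp e K)
    (h' : v ∈ endComp e' K) : e.1 (Opposite.op K) = e'.1 (Opposite.op K) :=
  comp_eq_of_mem h h'

lemma end_ext {e e' : G.end} (h : ∀ K, ∃ v, v ∈ endComp e K ∧ v ∈ endComp e' K) : e = e' := by
  apply Subtype.ext
  funext K
  obtain ⟨v, h1, h2⟩ := h K.unop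
  exact endComp_eq_of_mem h1 h2

/-- A set that is closed under adjacency outside `K` contains every component outside `K` that it
meets. -/
lemma endComp_subset {e : G.end} {K : Finset V} {S : Set V} {v : V} (hv : v ∈ endComp e K)
    (hS : v ∈ S) (hadj : ∀ x ∈ S, ∀ y, G.Adj x y → y ∉ K → y ∈ S) : endComp e K ⊆ S := by
  rintro w ⟨hw, hw'⟩
  obtain ⟨hv1, hv'⟩ := hv
  have hr : (G.induce ((K : Set V)ᶜ)).Reachable ⟨v, hv1⟩ ⟨w, hw⟩ :=
    SimpleGraph.ConnectedComponent.eq.1 (hv'.trans hw'.symm)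
  obtain ⟨q⟩ := hr
  have key : ∀ (a b : ((K : Set V)ᶜ : Set V)) (q : (G.induce ((K : Set V)ᶜ)).Walk a b),
      a.1 ∈ S → b.1 ∈ S := by
    intro a b q
    induction q with
    | nil => exact id
    | @cons a b c hab _ ih => exact fun ha => ih (hadj a.1 ha b.1 hab fun hb => b.2 hb)
  exact key _ _ q hS

lemma mem_endComp_of_chain {e : G.end} {K : Finset V} {r : ℕ → V} {m : ℕ}
    (hadj : ∀ n, G.Adj (r n) (r (n + 1))) (hK : ∀ n, n < m → r n ∉ K) (h : r m ∈ endComp e K) :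
    ∀ n ≤ m, r n ∈ endComp e K := by
  intro n hn
  induction m, hn using Nat.le_induction with
  | base => exact h
  | succ m hm ih =>
    exact ih (fun k hk => hK k (by omega)) (mem_endComp_of_adj h (hK m (by omega)) (hadj m).symm)

lemma ray_eventually_notMem {r : ℕ → V} (hinj : Function.Injective r) (K : Finset V) :
    ∃ n0, ∀ n ≥ n0, r n ∉ K := by
  have h := hinj.tendsto_cofinite.eventually (K.finite_toSet.compl_mem_cofinite)
  rw [Nat.cofinite_eq_atTop, eventually_atTop] at h
  obtain ⟨n0, hn0⟩ := h
  exact ⟨n0, fun n hn => by simpa using hn0 n hn⟩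

/-- The end to which a ray converges. -/
lemma exists_rayEnd {r : ℕ → V} (hadj : ∀ n, G.Adj (r n) (r (n + 1)))
    (hinj : Function.Injective r) :
    ∃ e : G.end, ∀ K : Finset V, ∃ n0, ∀ n ≥ n0, r n ∈ endComp e K := by
  choose n0 hn0 using ray_eventually_notMem hinj
  let c : ∀ K : Finset V, G.ComponentCompl (K : Set V) := fun K =>
    G.componentComplMk (v := r (n0 K)) (by simpa using hn0 K (n0 K) le_rfl)
  have hc : ∀ K, ∀ n ≥ n0 K, r n ∈ (c K).supp := by
    intro K n hn
    induction n, hn using Nat.le_induction with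
    | base => exact ⟨_, rfl⟩
    | succ n hn ih =>
      exact SimpleGraph.ComponentCompl.mem_of_adj (C := c K) _ _ ih
        (by simpa using hn0 K (n + 1) (by omega)) (hadj n)
  refine ⟨⟨fun K => c K.unop, ?_⟩, fun K => ⟨n0 K, hc K⟩⟩
  intro K L f
  have hsub : (L.unop : Set V) ⊆ K.unop := CategoryTheory.le_of_op_hom f
  have h1 : r (max (n0 K.unop) (n0 L.unop)) ∈ ((c K.unop).hom hsub).supp :=
    SimpleGraph.ComponentCompl.subset_hom _ hsub (hc K.unop _ (le_max_left _ _))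
  exact comp_eq_of_mem h1 (hc L.unop _ (le_max_right _ _))

end Ends

namespace TreeMap

variable {T : TreeMap}

lemma isIsolatedEnd_iff {e : T.G.end} : T.IsIsolatedEnd e ↔
    ∃ K : Finset T.V, ∀ e' : T.G.end, e'.1 (Opposite.op K) = e.1 (Opposite.op K) → e' = e :=
  Iff.rfl

/-- A ray whose vertices, apart from the first one, have valence two converges to an isolated
end. -/
lemma isIsolatedEnd_of_ray {r : ℕ → T.V}
    (hnbr : ∀ n w, T.G.Adj (r (n + 1)) w → w = r n ∨ w = r (n + 2)) {e : T.G.end}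
    (he : ∀ K : Finset T.V, ∃ n0, ∀ n ≥ n0, r n ∈ endComp e K) : T.IsIsolatedEnd e := by
  classical
  refine ⟨{r 0}, fun e' he' => end_ext fun K => ?_⟩
  have hsub : endComp e' {r 0} ⊆ {v | ∃ n, r (n + 1) = v} := by
    have h1 : endComp e' {r 0} = endComp e {r 0} := by rw [endComp, endComp, he']
    rw [h1]
    obtain ⟨n0, hn0⟩ := he {r 0}
    refine endComp_subset (hn0 (n0 + 1) (by omega)) ⟨n0, rfl⟩ ?_
    rintro _ ⟨n, rfl⟩ y hy hy0
    rcases hnbr n y hy with rfl | rfl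
    · cases n with
      | zero => simp at hy0
      | succ n => exact ⟨n, rfl⟩
    · exact ⟨n + 1, rfl⟩
  obtain ⟨n0, hn0⟩ := he K
  have hinf := endComp_infinite e' (K ∪ {r 0})
  have hfin : ((fun n => r n) '' (Set.Iio n0)).Finite := (Set.finite_Iio n0).image _
  obtain ⟨v, hv, hv'⟩ := (hinf.sdiff hfin).nonempty
  obtain ⟨n, rfl⟩ := hsub (endComp_mono e' Finset.subset_union_right hv)
  refine ⟨_, endComp_mono e' Finset.subset_union_left hv, hn0 _ ?_⟩
  by_contra! hc
  exact hv' ⟨n + 1, hc, rfl⟩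

/-- A tree is levelled by a parent map `p` towards a distinguished end and a height function `h`
that increases by one along `p`: there is just one vertex on each level `≥ 0`, the one on level
`0` has at least two children, and there is branching below each vertex. -/
structure IsLeveled (T : TreeMap) (p : T.V → T.V) (h : T.V → ℤ) : Prop where
  adj_iff : ∀ v w, T.G.Adj v w ↔ p v = w ∨ p w = v
  height_parent : ∀ v, h (p v) = h v + 1
  unique_top : ∀ v w, 0 ≤ h v → h v = h w → v = w
  exists_base : ∃ v, h v = 0 ∧ ∃ w w', w ≠ w' ∧ p w = v ∧ p w' = v
  child : ∀ v, ∃ w, p w = v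
  branch : ∀ v, ∃ w w' n, w ≠ w' ∧ p^[n] w = v ∧ p^[n] w' = v

namespace IsLeveled

variable {p : T.V → T.V} {h : T.V → ℤ}

lemma height_iterate (hL : IsLeveled T p h) (n : ℕ) (v : T.V) : h (p^[n] v) = h v + n := by
  induction n with
  | zero => simp
  | succ n ih =>
    rw [Function.iterate_succ_apply', hL.height_parent, ih]
    push_cast
    ring

lemma adj_parent (hL : IsLeveled T p h) (v : T.V) : T.G.Adj v (p v) := (hL.adj_iff _ _).2 (Or.inl rfl)

lemma injective_iterate (hL : IsLeveled T p h) (v : T.V) : Function.Injective fun n => p^[n] v := by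
  intro a b hab
  have := congrArg h hab
  simp only [hL.height_iterate] at this
  omega

lemma adj_iterate (hL : IsLeveled T p h) (v : T.V) (n : ℕ) : T.G.Adj (p^[n] v) (p^[n + 1] v) := by
  rw [Function.iterate_succ_apply']
  exact hL.adj_parent _

/-- Strict descendants of `w` are closed under adjacency away from `w`. -/
lemma desc_closed (hL : IsLeveled T p h) (w x y : T.V) (hx : ∃ n, p^[n + 1] x = w)
    (hxy : T.G.Adj x y) (hy : y ≠ w) : ∃ n, p^[n + 1] y = w := by
  obtain ⟨n, hn⟩ := hx
  rcases (hL.adj_iff _ _).1 hxy with rfl | rfl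
  · cases n with
    | zero => exact absurd hn hy
    | succ n => exact ⟨n, hn⟩
  · exact ⟨n + 1, hn⟩

lemma exists_descending (hL : IsLeveled T p h) (v : T.V) :
    ∃ r : ℕ → T.V, r 0 = v ∧ (∀ n, p^[n] (r n) = v) ∧ (∀ n, T.G.Adj (r n) (r (n + 1))) ∧
      Function.Injective r := by
  choose c hc using hL.child
  have hpc : ∀ n, p (c^[n + 1] v) = c^[n] v := fun n => by
    rw [Function.iterate_succ_apply', hc]
  have hpn : ∀ n, p^[n] (c^[n] v) = v := by
    intro n
    induction n with
    | zero => rfl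
    | succ n ih => rw [Function.iterate_succ_apply, hpc, ih]
  refine ⟨fun n => c^[n] v, rfl, hpn, fun n => (hL.adj_iff _ _).2 (Or.inr (hpc n)), ?_⟩
  intro a b hab
  have h1 := hL.height_iterate a (c^[a] v)
  have h2 := hL.height_iterate b (c^[b] v)
  simp only at hab
  rw [hpn] at h1 h2
  rw [hab] at h1
  omega

lemma exists_top (hL : IsLeveled T p h) {v0 : T.V} (h0 : h v0 = 0) {v : T.V} (hv : 0 ≤ h v) :
    p^[(h v).toNat] v0 = v := by
  refine (hL.unique_top _ _ hv ?_).symm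
  rw [hL.height_iterate, h0]
  omega

lemma below_base (hL : IsLeveled T p h) {v0 : T.V} (h0 : h v0 = 0) {v : T.V} (hv : h v ≤ 0) :
    p^[(-h v).toNat] v = v0 := by
  refine (hL.unique_top _ _ h0.ge ?_).symm
  rw [hL.height_iterate, h0]
  omega

/-- The end of the upward ray is the unique isolated end. -/
lemma exists_infinity (hL : IsLeveled T p h) {v0 : T.V} (h0 : h v0 = 0) :
    ∃ e : T.G.end, (∀ K : Finset T.V, ∃ n0, ∀ n ≥ n0, p^[n] v0 ∈ endComp e K) ∧
      T.IsIsolatedEnd e ∧ ∀ e', T.IsIsolatedEnd e' → e' = e := by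
  classical
  obtain ⟨e, he⟩ := exists_rayEnd (hL.adj_iterate v0) (hL.injective_iterate v0)
  refine ⟨e, he, isIsolatedEnd_of_ray (fun n w hw => ?_) he, ?_⟩
  · rcases (hL.adj_iff _ _).1 hw with rfl | h1
    · right
      rw [Function.iterate_succ_apply' p (n + 1)]
    · left
      have h2 := hL.height_parent w
      rw [h1, hL.height_iterate, h0] at h2
      push_cast at h2
      refine hL.unique_top _ _ (by omega) ?_
      rw [hL.height_iterate, h0]
      omega
  intro e' he'
  obtain ⟨K, hK⟩ := isIsolatedEnd_iff.1 he'
  by_cases hcase : ∃ z ∈ endComp e' K, ∀ w n, p^[n] w = z → w ∉ K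
  · exfalso
    obtain ⟨z, hz, hzK⟩ := hcase
    obtain ⟨w, w', n, hne, hw, hw'⟩ := hL.branch z
    have hbelow : ∀ x n, p^[n] x = z → x ∈ endComp e' K := by
      intro x n hx
      refine mem_endComp_of_chain (r := fun k => p^[k] x) (m := n) (hL.adj_iterate x)
        (fun k hk => hzK _ (n - k) ?_) (by simpa [hx] using hz) 0 (Nat.zero_le _)
      rw [← Function.iterate_add_apply, Nat.sub_add_cancel hk.le, hx]
    have hend : ∀ x, p^[n] x = z → ∀ r : ℕ → T.V, (∀ k, p^[k] (r k) = x) →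
        (∀ k, T.G.Adj (r k) (r (k + 1))) → Function.Injective r →
        ∀ K' : Finset T.V, ∃ n0, ∀ k ≥ n0, r k ∈ endComp e' K' := by
      intro x hx r hr hadj hinj
      obtain ⟨e1, he1⟩ := exists_rayEnd hadj hinj
      have : e1 = e' := by
        apply hK
        obtain ⟨n0, hn0⟩ := he1 K
        refine endComp_eq_of_mem (hn0 n0 le_rfl) (hbelow _ (n + n0) ?_)
        rw [Function.iterate_add_apply, hr, hx]
      rwa [this] at he1
    obtain ⟨r, -, hr, hadj, hinj⟩ := hL.exists_descending w
    obtain ⟨r', -, hr', hadj', hinj'⟩ := hL.exists_descending w'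
    obtain ⟨n1, hn1⟩ := hend w hw r hr hadj hinj {w}
    obtain ⟨n2, hn2⟩ := hend w' hw' r' hr' hadj' hinj' {w}
    have hsub : endComp e' {w} ⊆ {x | ∃ n, p^[n + 1] x = w} :=
      endComp_subset (hn1 (n1 + 1) (by omega)) ⟨n1, hr _⟩ fun x hx y hxy hy =>
        hL.desc_closed w x y hx hxy (by simpa using hy)
    obtain ⟨k, hk⟩ := hsub (hn2 n2 le_rfl)
    have hh1 := hL.height_iterate (k + 1) (r' n2)
    have hh2 := hL.height_iterate n2 (r' n2)
    have hh3 := hL.height_iterate n w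
    have hh4 := hL.height_iterate n w'
    rw [hk] at hh1
    rw [hr'] at hh2
    rw [hw] at hh3
    rw [hw'] at hh4
    have : k + 1 = n2 := by omega
    rw [this, hr'] at hk
    exact hne hk.symm
  · push Not at hcase
    refine end_ext fun K' => ?_
    obtain ⟨n0, hn0⟩ := he K'
    have hinf := endComp_infinite e' (K ∪ K')
    have hfin : (⋃ k ∈ K, (fun n => p^[n] k) '' (Set.Iic ((-h k).toNat + n0))).Finite :=
      K.finite_toSet.biUnion fun k _ => (Set.finite_Iic _).image _
    obtain ⟨v, hv, hv'⟩ := (hinf.sdiff hfin).nonempty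
    obtain ⟨k, n, hkv, hkK⟩ := hcase v (endComp_mono e' Finset.subset_union_left hv)
    have hn : (-h k).toNat + n0 < n := by
      by_contra! hc
      refine hv' ?_
      simp only [Set.mem_iUnion]
      exact ⟨k, hkK, n, hc, hkv⟩
    have hhv : h v = h k + n := by rw [← hkv, hL.height_iterate]
    have hv0 : 0 ≤ h v := by omega
    refine ⟨v, endComp_mono e' Finset.subset_union_right hv, ?_⟩
    rw [← hL.exists_top h0 hv0]
    exact hn0 _ (by omega)

lemma hasInfinity (hL : IsLeveled T p h) : T.HasInfinity := by
  obtain ⟨v0, h0, -⟩ := hL.exists_base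
  obtain ⟨e, -, he, huniq⟩ := hL.exists_infinity h0
  exact ⟨e, he, huniq⟩

lemma onRay_iff (hL : IsLeveled T p h) {v w : T.V} : T.OnRay v w ↔ ∃ n, p^[n] v = w := by
  classical
  obtain ⟨v0, h0, -⟩ := hL.exists_base
  obtain ⟨e, he, hiso, huniq⟩ := hL.exists_infinity h0
  have h1 : T.OnRay v w ↔ v ∉ endComp e {w} :=
    ⟨fun ⟨e', he', hv⟩ => by rw [← huniq e' he']; exact hv, fun hv => ⟨e, hiso, hv⟩⟩
  rw [h1]
  obtain ⟨n0, hn0⟩ := he {w}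
  constructor
  · intro hv
    by_contra! hc
    have h2 : p^[(h v).natAbs + n0] v ∈ endComp e {w} := by
      have h3 : 0 ≤ h (p^[(h v).natAbs + n0] v) := by
        rw [hL.height_iterate]
        omega
      have h4 := hL.exists_top h0 h3
      rw [← h4]
      apply hn0
      rw [hL.height_iterate]
      omega
    exact hv (mem_endComp_of_chain (r := fun n => p^[n] v) (hL.adj_iterate v)
      (fun n _ => by simpa using hc n) h2 0 (Nat.zero_le _))
  · rintro ⟨n, hn⟩ hv
    cases n with
    | zero => exact notMem_of_mem_endComp hv (by simpa using hn)
    | succ n =>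
      have hsub := endComp_subset hv (S := {x | ∃ n, p^[n + 1] x = w}) ⟨n, hn⟩
        fun x hx y hxy hy => hL.desc_closed w x y hx hxy (by simpa using hy)
      obtain ⟨k, hk⟩ := hsub (hn0 (n0 + (h w).natAbs) (by omega))
      have h2 := hL.height_iterate (k + 1) (p^[n0 + (h w).natAbs] v0)
      rw [hk, hL.height_iterate, h0] at h2
      omega

lemma two_lt_val (hL : IsLeveled T p h) {v w w' : T.V} (hne : w ≠ w') (hw : p w = v)
    (hw' : p w' = v) : 3 ≤ T.val v := by
  have h1 := hL.height_parent w
  have h2 := hL.height_parent w'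
  have h3 := hL.height_parent v
  rw [hw] at h1
  rw [hw'] at h2
  have hwp : p v ≠ w := fun e => by rw [e] at h3; omega
  have hwp' : p v ≠ w' := fun e => by rw [e] at h3; omega
  have hsub : ({p v, w, w'} : Set T.V) ⊆ T.G.neighborSet v := by
    rintro x (rfl | rfl | rfl)
    · exact hL.adj_parent v
    · exact (hL.adj_iff _ _).2 (Or.inr hw)
    · exact (hL.adj_iff _ _).2 (Or.inr hw')
  have hcard : ({p v, w, w'} : Set T.V).ncard = 3 :=
    Set.ncard_eq_three.2 ⟨_, _, _, hwp, hwp', hne, rfl⟩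
  rw [← hcard]
  exact Set.ncard_le_ncard hsub (T.locallyFinite v)

lemma exists_children (hL : IsLeveled T p h) {v : T.V} (hv : 3 ≤ T.val v) :
    ∃ w w', w ≠ w' ∧ p w = v ∧ p w' = v := by
  by_contra! hc
  obtain ⟨c, hcv⟩ := hL.child v
  have hsub : T.G.neighborSet v ⊆ {p v, c} := by
    intro x hx
    rcases (hL.adj_iff _ _).1 hx with h1 | h1
    · exact Or.inl h1.symm
    · right
      by_contra hne
      exact hc x c hne h1 hcv
  have h1 := (Set.ncard_le_ncard hsub (by simp)).trans (Set.ncard_insert_le _ _)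
  rw [Set.ncard_singleton] at h1
  have : T.val v = (T.G.neighborSet v).ncard := rfl
  omega

lemma height_nonpos_of_val (hL : IsLeveled T p h) {v : T.V} (hv : 3 ≤ T.val v) : h v ≤ 0 := by
  by_contra! hc
  obtain ⟨w, w', hne, hw, hw'⟩ := hL.exists_children hv
  have h1 := hL.height_parent w
  have h2 := hL.height_parent w'
  rw [hw] at h1
  rw [hw'] at h2
  exact hne (hL.unique_top _ _ (by omega) (by omega))

lemma height_base (hL : IsLeveled T p h) : h T.base = 0 := by
  obtain ⟨v0, h0, w, w', hne, hw, hw'⟩ := hL.exists_base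
  have hb : T.IsBase v0 := by
    refine ⟨hL.two_lt_val hne hw hw', fun v hv => hL.onRay_iff.2 ?_⟩
    exact ⟨_, hL.below_base h0 (hL.height_nonpos_of_val hv)⟩
  have hb' : T.IsBase T.base := Classical.epsilon_spec ⟨v0, hb⟩
  obtain ⟨n, hn⟩ := hL.onRay_iff.1 (hb.2 _ hb'.1)
  obtain ⟨m, hm⟩ := hL.onRay_iff.1 (hb'.2 _ hb.1)
  have h1 := hL.height_iterate n T.base
  have h2 := hL.height_iterate m v0
  rw [hn] at h1
  rw [hm] at h2
  omega

lemma abs_height_sub_le (hL : IsLeveled T p h) (v w : T.V) : |h v - h w| ≤ T.G.dist v w := by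
  obtain ⟨q, hq⟩ := T.isTree.connected.exists_walk_length_eq_dist v w
  rw [← hq]
  clear hq
  induction q with
  | nil => simp
  | @cons u v w huv q ih =>
    have h1 : |h u - h v| ≤ 1 := by
      rcases (hL.adj_iff _ _).1 huv with rfl | rfl
      · rw [hL.height_parent]
        simp
      · rw [hL.height_parent]
        simp
    rw [SimpleGraph.Walk.length_cons]
    push_cast
    have := abs_sub_le (h u) (h v) (h w)
    linarith

lemma dist_iterate_le (hL : IsLeveled T p h) (n : ℕ) (v : T.V) : T.G.dist v (p^[n] v) ≤ n := by
  induction n with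
  | zero => simp
  | succ n ih =>
    have h1 := T.isTree.connected.dist_triangle (u := v) (v := p^[n] v) (w := p^[n + 1] v)
    have h2 : T.G.dist (p^[n] v) (p^[n + 1] v) = 1 :=
      SimpleGraph.dist_eq_one_iff_adj.2 (hL.adj_iterate v n)
    omega

/-- The combinatorial height of a levelled tree is the given one. -/
lemma height_eq (hL : IsLeveled T p h) (v : T.V) : T.height v = h v := by
  have h0 := hL.height_base
  have h1 := hL.abs_height_sub_le T.base v
  rw [h0] at h1
  unfold TreeMap.height
  rcases le_or_gt 0 (h v) with hv | hv
  · have h2 := hL.exists_top h0 hv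
    rw [if_pos (hL.onRay_iff.2 ⟨_, h2⟩)]
    have h3 := hL.dist_iterate_le (h v).toNat T.base
    rw [h2] at h3
    rw [abs_le] at h1
    omega
  · rw [if_neg]
    · have h3 := hL.dist_iterate_le (-h v).toNat v
      rw [hL.below_base h0 hv.le, SimpleGraph.dist_comm] at h3
      rw [abs_le] at h1
      omega
    · intro hr
      obtain ⟨n, hn⟩ := hL.onRay_iff.1 hr
      have h4 := hL.height_iterate n T.base
      rw [hn] at h4
      omega

lemma N_eq (hL : IsLeveled T p h) {N : ℤ} (hF : ∀ v, h (T.F v) = h v + N) : T.N = N := by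
  rw [TreeMap.N, hL.height_eq, hF, hL.height_base, zero_add]

end IsLeveled

end TreeMap

/-! ### Degrees on a levelled tree with inverse branches -/

namespace TreeMap.IsLeveled

variable {T : TreeMap} {p : T.V → T.V} {h : T.V → ℤ}

lemma parent_parent_ne (hL : IsLeveled T p h) (v : T.V) : p (p v) ≠ v := by
  intro e
  have := hL.height_iterate 2 v
  simp only [Function.iterate_succ, Function.comp_apply, Function.iterate_zero, id] at this
  rw [e] at this
  omega

/-- A walk that leaves the set of descendants of `v` uses the edge from `v` to its parent. -/
lemma exists_exit (hL : IsLeveled T p h) {v a b : T.V} (q : T.G.Walk a b)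
    (ha : ∃ n, p^[n] a = v) (hb : ¬ ∃ n, p^[n] b = v) :
    s(v, p v) ∈ q.edges ∧ p v ∈ q.support := by
  obtain ⟨⟨⟨y, y'⟩, hyy⟩, hd, ⟨n, hn⟩, hy'⟩ := q.exists_boundary_dart {x | ∃ n, p^[n] x = v} ha hb
  have hyv : y = v ∧ y' = p v := by
    rcases (hL.adj_iff _ _).1 hyy with h1 | h1
    · cases n with
      | zero => exact ⟨hn, by simp only at h1 hn; rw [← h1]; exact congrArg p hn⟩
      | succ n =>
        refine absurd ⟨n, ?_⟩ hy'
        simp only at h1 ⊢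
        rw [← h1]
        exact hn
    · refine absurd ⟨n + 1, ?_⟩ hy'
      simp only [Function.iterate_succ, Function.comp_apply] at h1 ⊢
      rw [h1]
      exact hn
  obtain ⟨rfl, rfl⟩ := hyv
  refine ⟨?_, ?_⟩
  · rw [SimpleGraph.Walk.edges, List.mem_map]
    exact ⟨_, hd, rfl⟩
  · exact SimpleGraph.Walk.dart_snd_mem_support_of_mem_darts _ hd

/-- Additivity along paths follows from additivity for the first edge of a path. -/
lemma path_additive (hL : IsLeveled T p h) {d : T.V → T.V → ℝ} (hself : ∀ x, d x x = 0)
    (hup : ∀ x z, (¬ ∃ n, p^[n] z = x) → d x z = d x (p x) + d (p x) z)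
    (hdown : ∀ x z, (∃ n, p^[n] z = x) → d (p x) z = d (p x) x + d x z) :
    ∀ x y z (q : T.G.Walk x z), q.IsPath → y ∈ q.support → d x y + d y z = d x z := by
  have hfirst : ∀ x x' z (hx : T.G.Adj x x') (q : T.G.Walk x' z), x ∉ q.support →
      d x z = d x x' + d x' z := by
    intro x x' z hx q hq
    rcases (hL.adj_iff _ _).1 hx with rfl | rfl
    · refine hup x z fun hz => hq ?_
      by_cases hmem : ∃ n, p^[n] (p x) = x
      · obtain ⟨n, hn⟩ := hmem
        have h1 := hL.height_iterate n (p x)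
        rw [hn, hL.height_parent] at h1
        omega
      · have := (hL.exists_exit q.reverse hz hmem).1
        rw [SimpleGraph.Walk.edges_reverse, List.mem_reverse] at this
        exact SimpleGraph.Walk.fst_mem_support_of_mem_edges _ this
    · refine hdown x' z ?_
      by_contra hz
      exact hq (hL.exists_exit q ⟨0, rfl⟩ hz).2
  intro x y z q
  induction q with
  | nil =>
    intro _ hy
    simp only [SimpleGraph.Walk.support_nil, List.mem_singleton] at hy
    rw [hy, hself, add_zero]
  | @cons x x' z hx q ih =>
    intro hp hy
    rw [SimpleGraph.Walk.cons_isPath_iff] at hp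
    rw [SimpleGraph.Walk.support_cons, List.mem_cons] at hy
    rcases hy with rfl | hy
    · rw [hself, zero_add]
    · classical
      have h1 := ih hp.1 hy
      have h2 := hfirst x x' z hx q hp.2
      have h3 := hfirst x x' y hx (q.takeUntil y hy) fun hmem =>
        hp.2 (q.support_takeUntil_subset_support hy hmem)
      rw [h2, h3, ← h1]
      ring

lemma neighborSet_eq (hL : IsLeveled T p h) (v : T.V) :
    T.G.neighborSet v = insert (p v) {w | p w = v} := by
  ext w
  rw [SimpleGraph.mem_neighborSet, hL.adj_iff]
  simp [eq_comm]

lemma finite_children (hL : IsLeveled T p h) (v : T.V) : {w | p w = v}.Finite :=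
  (T.locallyFinite v).subset fun _ hw => (hL.adj_iff _ _).2 (Or.inr hw)

/-- The edge to the parent is the only edge at a vertex with its image. -/
lemma edge_fiber_parent (hL : IsLeveled T p h) (hFp : ∀ v, T.F (p v) = p (T.F v)) (v : T.V) :
    {w' | T.G.Adj v w' ∧ s(T.F v, T.F w') = s(T.F v, T.F (p v))} = {p v} := by
  ext w'
  simp only [Set.mem_ofPred_eq, Set.mem_singleton_iff, Sym2.congr_right]
  constructor
  · rintro ⟨h1, h2⟩
    rcases (hL.adj_iff _ _).1 h1 with h3 | h3
    · exact h3.symm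
    · exfalso
      rw [hFp, ← h3, hFp] at h2
      exact hL.parent_parent_ne _ h2.symm
  · rintro rfl
    exact ⟨hL.adj_parent v, rfl⟩

lemma edge_fiber_child (hL : IsLeveled T p h) (hFp : ∀ v, T.F (p v) = p (T.F v)) {v w : T.V}
    (hw : p w = v) : {w' | T.G.Adj v w' ∧ s(T.F v, T.F w') = s(T.F v, T.F w)} =
      {w' | p w' = v ∧ T.F w' = T.F w} := by
  ext w'
  simp only [Set.mem_ofPred_eq, Sym2.congr_right]
  refine and_congr_left fun h2 => ?_
  constructor
  · intro h1
    rcases (hL.adj_iff _ _).1 h1 with h3 | h3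
    · exfalso
      rw [← h3, hFp, ← hw, hFp] at h2
      exact hL.parent_parent_ne _ h2
    · exact h3
  · exact fun h1 => (hL.adj_iff _ _).2 (Or.inr h1)

open Classical in
/-- The number of inverse branches carrying `F v` to `v`. -/
noncomputable def branchDeg {D : ℕ} (B : Fin D → T.V → T.V) (v : T.V) : ℕ :=
  (Finset.univ.filter fun a => B a (T.F v) = v).card

/-- A complete family of inverse branches `B` of the dynamics defines a local degree function, as
soon as the Riemann–Hurwitz inequality holds, in the form of a bound on the number of children. -/
lemma hasDegree_of_branches {D : ℕ} (hL : IsLeveled T p h) (hFp : ∀ v, T.F (p v) = p (T.F v))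
    (B : Fin D → T.V → T.V) (hFB : ∀ a v, T.F (B a v) = v) (hpB : ∀ a v, p (B a v) = B a (p v))
    (hB : ∀ v, ∃ a, B a (T.F v) = v)
    (hRH : ∀ v, branchDeg B v * {u | p u = T.F v}.ncard + 1 ≤ {w | p w = v}.ncard + branchDeg B v) :
    T.HasDegree D := by
  classical
  have hfib : ∀ v, ∑ᶠ u ∈ T.F ⁻¹' {v}, branchDeg B u = D := by
    intro v
    rw [finsum_mem_eq_finite_toFinset_sum _ (T.map_proper v)]
    have := Finset.card_eq_sum_card_fiberwise (s := (Finset.univ : Finset (Fin D)))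
      (t := (T.map_proper v).toFinset) (f := fun a => B a v) (by
        intro a _
        simp [hFB])
    rw [Finset.card_univ, Fintype.card_fin] at this
    refine (Finset.sum_congr rfl fun u hu => ?_).trans this.symm
    have hu' : T.F u = v := by simpa using hu
    rw [branchDeg, hu']
  have hchild : ∀ v u, p u = T.F v →
      branchDeg B v = ∑ᶠ w ∈ {w | p w = v ∧ T.F w = u}, branchDeg B w := by
    intro v u hu
    have hfin : {w | p w = v ∧ T.F w = u}.Finite := (hL.finite_children v).subset fun _ hw => hw.1
    rw [finsum_mem_eq_finite_toFinset_sum _ hfin]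
    have h1 : branchDeg B v = ((Finset.univ : Finset (Fin D)).filter fun a => p (B a u) = v).card := by
      rw [branchDeg]
      congr 1
      refine Finset.filter_congr fun a _ => ?_
      rw [hpB, hu]
    rw [h1, Finset.card_eq_sum_card_fiberwise (t := hfin.toFinset) (f := fun a => B a u)]
    · refine Finset.sum_congr rfl fun w hw => ?_
      have hw' : p w = v ∧ T.F w = u := by simpa using hw
      rw [branchDeg, hw'.2, Finset.filter_filter]
      congr 1
      refine Finset.filter_congr fun a _ => ?_
      constructor
      · exact fun h => h.2
      · intro h
        exact ⟨by rw [h]; exact hw'.1, h⟩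
    · intro a ha
      simp only [Finset.coe_filter, Set.mem_ofPred_eq] at ha
      simp [ha.2, hFB]
  let f : T.V → T.V → ℕ := fun v w =>
    if p v = w then branchDeg B v else if p w = v then branchDeg B w else 1
  have hfsymm : ∀ v w, f v w = f w v := by
    intro v w
    simp only [f]
    by_cases h1 : p v = w
    · subst h1
      rw [if_pos rfl, if_neg (hL.parent_parent_ne v), if_pos rfl]
    · rw [if_neg h1]
      by_cases h2 : p w = v
      · rw [if_pos h2, if_pos h2]
      · rw [if_neg h2, if_neg h2, if_neg h1]
  have hpos : ∀ v, 1 ≤ branchDeg B v := fun v => by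
    obtain ⟨a, ha⟩ := hB v
    exact Finset.card_pos.2 ⟨a, by simp [ha]⟩
  have hfpar : ∀ v, f v (p v) = branchDeg B v := fun v => if_pos rfl
  have hfchild : ∀ v w, p w = v → f v w = branchDeg B w := by
    rintro _ w rfl
    rw [hfsymm, hfpar]
  refine ⟨branchDeg B, fun e => Sym2.lift ⟨f, hfsymm⟩ e, ⟨hpos, ?_, ?_, ?_⟩, hfib⟩
  · intro e
    induction e using Sym2.ind with
    | _ v w =>
      intro _
      change 1 ≤ f v w
      simp only [f]
      split_ifs
      · exact hpos _
      · exact hpos _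
      · exact le_rfl
  · intro v
    change ∑ᶠ w ∈ T.G.neighborSet v, ((f v w : ℤ) - 1) ≤ _
    have hfin := hL.finite_children v
    have hnot : p v ∉ {w | p w = v} := hL.parent_parent_ne v
    rw [hL.neighborSet_eq v, finsum_mem_insert _ hnot hfin, hfpar]
    have h1 : ∑ᶠ w ∈ {w | p w = v}, ((f v w : ℤ) - 1) =
        ∑ w ∈ hfin.toFinset, ((branchDeg B w : ℤ) - 1) := by
      rw [finsum_mem_eq_finite_toFinset_sum _ hfin]
      refine Finset.sum_congr rfl fun w hw => ?_
      rw [hfchild v w (by simpa using hw)]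
    have h2 : ∑ w ∈ hfin.toFinset, branchDeg B w = branchDeg B v * {u | p u = T.F v}.ncard := by
      have hfin' := hL.finite_children (T.F v)
      rw [← Finset.sum_fiberwise_of_maps_to (t := hfin'.toFinset) (g := T.F),
        Set.ncard_eq_toFinset_card _ hfin', mul_comm, ← smul_eq_mul, ← Finset.sum_const]
      · refine Finset.sum_congr rfl fun u hu => ?_
        have hu' : p u = T.F v := by simpa using hu
        have hf : {w | p w = v ∧ T.F w = u}.Finite := hfin.subset fun _ hw => hw.1
        rw [hchild v u hu', finsum_mem_eq_finite_toFinset_sum _ hf]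
        refine Finset.sum_congr ?_ fun _ _ => rfl
        ext w
        simp
      · intro w hw
        have hw' : p w = v := by simpa using hw
        rw [hfin'.mem_toFinset, Set.mem_ofPred_eq, ← hFp, hw']
    rw [h1, Finset.sum_sub_distrib, Finset.sum_const, nsmul_eq_mul, mul_one,
      ← Set.ncard_eq_toFinset_card _ hfin, ← Nat.cast_sum, h2]
    have := hRH v
    zify at this
    push_cast
    linarith
  · intro v w hvw
    rcases (hL.adj_iff _ _).1 hvw with rfl | hw
    · rw [hL.edge_fiber_parent hFp, finsum_mem_singleton]
      exact (hfpar v).symm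
    · rw [hL.edge_fiber_child hFp hw, hchild v (T.F w) (by rw [← hFp, hw])]
      refine finsum_mem_congr rfl fun w' hw' => ?_
      exact (hfchild v w' hw'.1).symm

end TreeMap.IsLeveled

/-! ### The tree of a filtered family of equivalence relations -/

variable {D : ℕ}

/-- The combinatorial data of a tree with dynamics: for each level `i` the equivalence relation
`R i` of passing through the same vertex on level `i`. -/
structure LevelData (D : ℕ) where
  N : ℕ
  R : ℤ → Setoid (Code D)
  one_le : 1 ≤ N
  mono : ∀ i j x y, i ≤ j → R i x y → R j x y
  top : ∀ i x y, 0 ≤ i → R i x y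
  cons : ∀ i a u u', R (i + N) u u' ↔ R i (cons a u) (cons a u')
  shift : ∀ i x y, R i x y → R (i + N) (shift x) (shift y)
  branch : ∃ x y, ¬ R (-1) x y

/-- `lam i x` is the vertex on level `i` above the end `x`, in a tree whose vertices on level `i`
are the classes of the relation `R i`. -/
structure CombLab (T : TreeMap) (N : ℕ) (R : ℤ → Code D → Code D → Prop)
    (lam : ℤ → Code D → T.V) : Prop where
  surj : ∀ v, ∃ i x, lam i x = v
  top : ∀ i x y, 0 ≤ i → R i x y
  eq_iff : ∀ i j x y, lam i x = lam j y ↔ i = j ∧ R i x y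
  adj_iff : ∀ i j x y, T.G.Adj (lam i x) (lam j y) ↔
    (j = i + 1 ∧ R j x y) ∨ (i = j + 1 ∧ R i x y)
  dyn : ∀ i x, T.F (lam i x) = lam (i + N) (shift x)
  height : ∀ i x, T.height (lam i x) = i
  N_eq : T.N = N

namespace LevelData

variable (L : LevelData D)

/-- The vertices of the tree. -/
def Vert : Type := Σ i : ℤ, Quotient (L.R i)

/-- The vertex on level `i` above the end `x`. -/
def vert (i : ℤ) (x : Code D) : L.Vert := ⟨i, Quotient.mk (L.R i) x⟩

/-- The parent of a vertex. -/
def parent (v : L.Vert) : L.Vert :=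
  ⟨v.1 + 1, Quotient.map' id (fun x y hxy => L.mono _ _ x y (by omega) hxy) v.2⟩

/-- The dynamics on vertices. -/
def map (v : L.Vert) : L.Vert :=
  ⟨v.1 + L.N, Quotient.map' Code.shift (fun x y hxy => L.shift _ x y hxy) v.2⟩

@[simp] lemma parent_vert (i : ℤ) (x : Code D) : L.parent (L.vert i x) = L.vert (i + 1) x := rfl

@[simp] lemma map_vert (i : ℤ) (x : Code D) : L.map (L.vert i x) = L.vert (i + L.N) (Code.shift x) := rfl

lemma exists_vert (v : L.Vert) : ∃ i x, L.vert i x = v := by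
  obtain ⟨i, q⟩ := v
  obtain ⟨x, rfl⟩ := Quotient.exists_rep q
  exact ⟨i, x, rfl⟩

lemma vert_eq_iff {i j : ℤ} {x y : Code D} : L.vert i x = L.vert j y ↔ i = j ∧ L.R i x y := by
  constructor
  · intro h
    obtain rfl : i = j := congrArg Sigma.fst h
    refine ⟨rfl, ?_⟩
    have := eq_of_heq (Sigma.mk.inj_iff.1 h).2
    exact Quotient.exact this
  · rintro ⟨rfl, h⟩
    exact congrArg (Sigma.mk i) (Quotient.sound h)

lemma vert_congr {i j : ℤ} {x y : Code D} (h : i = j) (h' : x = y) : L.vert i x = L.vert j y := by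
  rw [h, h']

lemma of_agree (k : ℕ) {i : ℤ} {x y : Code D} (h : ∀ n < k, x n = y n) (hi : 0 ≤ i + k * L.N) :
    L.R i x y := by
  induction k generalizing i x y with
  | zero => exact L.top i x y (by simpa using hi)
  | succ k ih =>
    rw [← cons_shift x, ← cons_shift y, h 0 (Nat.succ_pos k), ← L.cons]
    refine ih (fun n hn => h (n + 1) (by omega)) ?_
    push_cast at hi
    linarith

lemma exists_nonneg (i : ℤ) : ∃ k : ℕ, 0 ≤ i + k * L.N := by
  refine ⟨i.natAbs, ?_⟩
  have h1 : (1 : ℤ) ≤ L.N := by exact_mod_cast L.one_le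
  have h2 : (i.natAbs : ℤ) * 1 ≤ i.natAbs * L.N := by gcongr
  omega

lemma finite_level (i : ℤ) : (Set.range (L.vert i)).Finite := by
  obtain ⟨k, hk⟩ := L.exists_nonneg i
  obtain ⟨o, -⟩ := L.branch
  refine ((finite_range_splice o k).image (L.vert i)).subset ?_
  rintro _ ⟨x, rfl⟩
  refine ⟨_, ⟨x, rfl⟩, L.vert_eq_iff.2 ⟨rfl, ?_⟩⟩
  exact (L.R i).symm (L.of_agree k (splice_agree o k x) hk)

lemma exists_branch (k : ℕ) (x : Code D) : ∃ w w', (∀ n < k, w n = x n) ∧ (∀ n < k, w' n = x n) ∧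
    ¬ L.R (-1 - k * L.N) w w' := by
  induction k generalizing x with
  | zero =>
    obtain ⟨w, w', h⟩ := L.branch
    exact ⟨w, w', by simp, by simp, by
      have e : (-1 - ((0 : ℕ) : ℤ) * L.N) = -1 := by simp
      rwa [e]⟩
  | succ k ih =>
    obtain ⟨w, w', h1, h2, h3⟩ := ih (Code.shift x)
    refine ⟨Code.cons (x 0) w, Code.cons (x 0) w', ?_, ?_, ?_⟩
    · rintro (_ | n) hn
      · rfl
      · exact h1 n (by omega)
    · rintro (_ | n) hn
      · rfl
      · exact h2 n (by omega)
    · rw [← L.cons]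
      have : (-1 - ((k + 1 : ℕ) : ℤ) * L.N + L.N) = -1 - k * L.N := by push_cast; ring
      rwa [this]

/-- The graph of the tree: each vertex is joined to its parent. -/
def graph : SimpleGraph L.Vert where
  Adj v w := L.parent v = w ∨ L.parent w = v
  symm := ⟨fun _ _ h => h.symm⟩
  loopless := ⟨fun v h => by
    have h1 : L.parent v = v := h.elim id id
    have h2 : v.1 + 1 = v.1 := congrArg Sigma.fst h1
    omega⟩

lemma parent_iterate (n : ℕ) (i : ℤ) (x : Code D) : L.parent^[n] (L.vert i x) = L.vert (i + n) x := by
  induction n with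
  | zero => exact L.vert_congr (by simp) rfl
  | succ n ih =>
    rw [Function.iterate_succ_apply', ih, parent_vert]
    exact L.vert_congr (by push_cast; ring) rfl

lemma map_parent (v : L.Vert) : L.map (L.parent v) = L.parent (L.map v) := by
  obtain ⟨i, x, rfl⟩ := L.exists_vert v
  rw [parent_vert, map_vert, map_vert, parent_vert]
  exact L.vert_congr (by ring) rfl

lemma reachable_iterate (n : ℕ) (v : L.Vert) : L.graph.Reachable v (L.parent^[n] v) := by
  induction n with
  | zero => exact SimpleGraph.Reachable.refl _
  | succ n ih =>
    rw [Function.iterate_succ_apply']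
    exact ih.trans (SimpleGraph.Adj.reachable (Or.inl rfl))

lemma isTree_graph : L.graph.IsTree := by
  obtain ⟨o, -⟩ := L.branch
  have hne : Nonempty L.Vert := ⟨L.vert 0 o⟩
  refine ⟨⟨?_⟩, ?_⟩
  · intro v w
    obtain ⟨i, x, rfl⟩ := L.exists_vert v
    obtain ⟨j, y, rfl⟩ := L.exists_vert w
    have h1 := L.reachable_iterate (i.natAbs + j.natAbs + (j - i).toNat) (L.vert i x)
    have h2 := L.reachable_iterate (i.natAbs + j.natAbs + (i - j).toNat) (L.vert j y)
    have h3 : L.parent^[i.natAbs + j.natAbs + (j - i).toNat] (L.vert i x) =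
        L.parent^[i.natAbs + j.natAbs + (i - j).toNat] (L.vert j y) := by
      rw [parent_iterate, parent_iterate, vert_eq_iff]
      exact ⟨by omega, L.top _ _ _ (by omega)⟩
    rw [h3] at h1
    exact h1.trans h2.symm
  · rw [SimpleGraph.isAcyclic_iff_forall_adj_isBridge]
    have key : ∀ v (q : L.graph.Walk v (L.parent v)), s(v, L.parent v) ∈ q.edges := by
      intro v q
      obtain ⟨⟨⟨y, y'⟩, hyy⟩, hd, ⟨n, hn⟩, hy'⟩ :=
        q.exists_boundary_dart {x | ∃ n, L.parent^[n] x = v} ⟨0, rfl⟩ (by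
          rintro ⟨n, hn⟩
          obtain ⟨i, x, rfl⟩ := L.exists_vert v
          rw [parent_vert, parent_iterate, vert_eq_iff] at hn
          omega)
      have hyv : y = v ∧ y' = L.parent v := by
        rcases hyy with h1 | h1
        · cases n with
          | zero => exact ⟨hn, by simp only at h1 hn; rw [← h1]; exact congrArg L.parent hn⟩
          | succ n =>
            refine absurd ⟨n, ?_⟩ hy'
            simp only at h1 ⊢
            rw [← h1]
            exact hn
        · refine absurd ⟨n + 1, ?_⟩ hy'
          simp only [Function.iterate_succ, Function.comp_apply] at h1 ⊢
          rw [h1]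
          exact hn
      obtain ⟨rfl, rfl⟩ := hyv
      rw [SimpleGraph.Walk.edges, List.mem_map]
      exact ⟨_, hd, rfl⟩
    rintro v w (rfl | rfl)
    · exact SimpleGraph.isBridge_iff_forall_walk_mem_edges.2 (key v)
    · rw [Sym2.eq_swap]
      exact SimpleGraph.isBridge_iff_forall_walk_mem_edges.2 (key w)

/-- The tree with dynamics. -/
def tree : TreeMap where
  V := L.Vert
  G := L.graph
  F := L.map
  isTree := L.isTree_graph
  locallyFinite v := by
    obtain ⟨i, x, rfl⟩ := L.exists_vert v
    refine ((Set.finite_singleton (L.vert (i + 1) x)).union (L.finite_level (i - 1))).subset ?_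
    rintro w (h | h)
    · exact Or.inl h.symm
    · right
      obtain ⟨j, y, rfl⟩ := L.exists_vert w
      rw [parent_vert, vert_eq_iff] at h
      exact ⟨y, L.vert_congr (by omega) rfl⟩
  map_adj v w h := by
    rcases h with rfl | rfl
    · exact Or.inl (L.map_parent v).symm
    · exact Or.inr (L.map_parent w).symm
  map_open v u h := by
    rcases h with rfl | h
    · exact ⟨_, Or.inl rfl, L.map_parent v⟩
    · obtain ⟨i, x, rfl⟩ := L.exists_vert v
      obtain ⟨j, y, rfl⟩ := L.exists_vert u
      rw [parent_vert, map_vert, vert_eq_iff] at h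
      obtain ⟨h1, h2⟩ := h
      refine ⟨L.vert (i - 1) (Code.cons (x 0) y), Or.inr ?_, ?_⟩
      · rw [parent_vert, vert_eq_iff]
        refine ⟨by ring, ?_⟩
        have e : i - 1 + 1 = i := by ring
        rw [e]
        conv_rhs => rw [← cons_shift x]
        rw [← L.cons, ← h1]
        exact h2
      · rw [map_vert]
        exact L.vert_congr (by omega) rfl
  map_proper v := by
    obtain ⟨j, y, rfl⟩ := L.exists_vert v
    refine (L.finite_level (j - L.N)).subset ?_
    intro w hw
    obtain ⟨i, x, rfl⟩ := L.exists_vert w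
    have hw' : L.map (L.vert i x) = L.vert j y := hw
    rw [map_vert, vert_eq_iff] at hw'
    exact ⟨x, L.vert_congr (by omega) rfl⟩

lemma isLeveled : L.tree.IsLeveled L.parent Sigma.fst where
  adj_iff _ _ := Iff.rfl
  height_parent _ := rfl
  unique_top v w hv hvw := by
    obtain ⟨i, x, rfl⟩ := L.exists_vert v
    obtain ⟨j, y, rfl⟩ := L.exists_vert w
    exact L.vert_eq_iff.2 ⟨hvw, L.top _ _ _ hv⟩
  exists_base := by
    obtain ⟨x, y, hxy⟩ := L.branch
    refine ⟨L.vert 0 x, rfl, L.vert (-1) x, L.vert (-1) y, ?_, rfl, ?_⟩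
    · intro e
      exact hxy (L.vert_eq_iff.1 e).2
    · exact L.vert_eq_iff.2 ⟨neg_add_cancel 1, L.top _ _ _ (neg_add_cancel (1 : ℤ)).ge⟩
  child v := by
    obtain ⟨i, x, rfl⟩ := L.exists_vert v
    exact ⟨L.vert (i - 1) x, L.vert_congr (sub_add_cancel i 1) rfl⟩
  branch v := by
    obtain ⟨i, x, rfl⟩ := L.exists_vert v
    obtain ⟨k, hk⟩ := L.exists_nonneg i
    obtain ⟨w, w', h1, h2, h3⟩ := L.exists_branch k x
    refine ⟨L.vert (-1 - k * L.N) w, L.vert (-1 - k * L.N) w', (i + 1 + k * L.N).toNat, ?_, ?_, ?_⟩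
    · intro e
      exact h3 (L.vert_eq_iff.1 e).2
    · exact (L.parent_iterate _ _ _).trans
        (L.vert_eq_iff.2 ⟨by omega, L.of_agree k h1 (by omega)⟩)
    · exact (L.parent_iterate _ _ _).trans
        (L.vert_eq_iff.2 ⟨by omega, L.of_agree k h2 (by omega)⟩)

lemma combLab : CombLab L.tree L.N (fun i x y => L.R i x y) L.vert where
  surj := L.exists_vert
  top := L.top
  eq_iff _ _ _ _ := L.vert_eq_iff
  adj_iff i j x y := by
    change (L.parent (L.vert i x) = L.vert j y ∨ L.parent (L.vert j y) = L.vert i x) ↔ _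
    rw [parent_vert, parent_vert, vert_eq_iff, vert_eq_iff]
    refine or_congr ?_ ?_
    · constructor
      · rintro ⟨rfl, h⟩
        exact ⟨rfl, h⟩
      · rintro ⟨rfl, h⟩
        exact ⟨rfl, h⟩
    · constructor
      · rintro ⟨rfl, h⟩
        exact ⟨rfl, (L.R _).symm h⟩
      · rintro ⟨rfl, h⟩
        exact ⟨rfl, (L.R _).symm h⟩
  dyn _ _ := rfl
  height i x := L.isLeveled.height_eq (L.vert i x)
  N_eq := L.isLeveled.N_eq fun _ => rfl

/-- The inverse branch of the dynamics with letter `a`. -/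
def invBranch (a : Fin D) (v : L.Vert) : L.Vert :=
  ⟨v.1 - L.N, Quotient.map' (Code.cons a) (fun x y hxy => by
    have h1 := L.cons (v.1 - L.N) a x y
    rw [sub_add_cancel] at h1
    exact h1.1 hxy) v.2⟩

lemma hasDegree (hRH : ∀ i z, TreeMap.IsLeveled.branchDeg (T := L.tree) L.invBranch (L.vert i z) *
      {u | L.parent u = L.map (L.vert i z)}.ncard + 1 ≤ {w | L.parent w = L.vert i z}.ncard +
        TreeMap.IsLeveled.branchDeg (T := L.tree) L.invBranch (L.vert i z)) : L.tree.HasDegree D := by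
  refine L.isLeveled.hasDegree_of_branches L.map_parent L.invBranch ?_ ?_ ?_ ?_
  · intro a v
    obtain ⟨i, x, rfl⟩ := L.exists_vert v
    exact L.vert_congr (sub_add_cancel i (L.N : ℤ)) rfl
  · intro a v
    obtain ⟨i, x, rfl⟩ := L.exists_vert v
    exact L.vert_congr (show i - L.N + 1 = i + 1 - L.N by ring) rfl
  · intro v
    obtain ⟨i, x, rfl⟩ := L.exists_vert v
    exact ⟨x 0, L.vert_congr (add_sub_cancel_right i (L.N : ℤ)) (cons_shift x)⟩
  · intro v
    obtain ⟨i, x, rfl⟩ := L.exists_vert v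
    exact hRH i x

end LevelData

/-! ### The metrized tree of a tree metric -/

/-- `X` is labelled by the tree metric `ρ`, with scale `c`: the vertices on level `i` are the balls
of radius `ι i`, and the branch point of two ends `x`, `y` has height `c * ρ x y`. -/
structure Labelling (X : MTree D) (ρ : Code D → Code D → ℝ) (c : ℝ) (N : ℕ) (ι : ℤ → ℝ)
    (lam : ℤ → Code D → X.V) : Prop extends
    CombLab X.toTreeMap N (fun i x y => ρ x y ≤ ι i) lam where
  dist : ∀ i j x y, X.d (lam i x) (lam j y) =
    c * (2 * max (max (ι i) (ι j)) (ρ x y) - ι i - ι j)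

/-- `X` is the tree of the tree metric `ρ`, with scale `c`. -/
def IsLabelled (X : MTree D) (ρ : Code D → Code D → ℝ) (c : ℝ) : Prop :=
  ∃ N ι lam, IsEnum ρ N ι ∧ Labelling X ρ c N ι lam

lemma ncard_image_eq_of_iff {α β γ : Type*} [Nonempty α] (f : α → β) (g : α → γ)
    (h : ∀ a b, f a = f b ↔ g a = g b) (A : Set α) : (f '' A).ncard = (g '' A).ncard := by
  have h1 : ∀ a, g (Function.invFun f (f a)) = g a := fun a =>
    (h _ _).1 (Function.invFun_eq ⟨a, rfl⟩)
  have h2 : g '' A = (fun b => g (Function.invFun f b)) '' (f '' A) := by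
    rw [Set.image_image]
    exact Set.image_congr fun a _ => (h1 a).symm
  have h3 : Set.InjOn (fun b => g (Function.invFun f b)) (f '' A) := by
    rintro _ ⟨a, -, rfl⟩ _ ⟨b, -, rfl⟩ hab
    simp only [h1] at hab
    exact (h _ _).2 hab
  rw [h2, h3.ncard_image]

lemma TreeMap.IsLeveled.val_ne_one {T : TreeMap} {p : T.V → T.V} {h : T.V → ℤ}
    (hL : T.IsLeveled p h) (v : T.V) : T.val v ≠ 1 := by
  obtain ⟨w, hw⟩ := hL.child v
  intro h1
  obtain ⟨u, hu⟩ := Set.ncard_eq_one.1 h1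
  rw [hL.neighborSet_eq] at hu
  have h2 : p v ∈ ({u} : Set T.V) := hu ▸ Set.mem_insert _ _
  have h3 : w ∈ ({u} : Set T.V) := hu ▸ Set.mem_insert_of_mem _ hw
  rw [Set.mem_singleton_iff] at h2 h3
  apply hL.parent_parent_ne v
  rw [h2, ← h3, hw]

lemma IsTreeMetric.max_congr {ρ : Code D → Code D → ℝ} (hρ : IsTreeMetric ρ) {s t : ℝ}
    {x x' y y' : Code D} (hx : ρ x x' ≤ s) (hy : ρ y y' ≤ t) :
    max (max s t) (ρ x y) = max (max s t) (ρ x' y') := by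
  have key : ∀ x x' y y', ρ x x' ≤ s → ρ y y' ≤ t →
      max (max s t) (ρ x y) ≤ max (max s t) (ρ x' y') := by
    intro x x' y y' h1 h2
    refine max_le (le_max_left _ _) ?_
    refine (hρ.ultra x x' y).trans (max_le ?_ ((hρ.ultra x' y' y).trans (max_le ?_ ?_)))
    · exact h1.trans ((le_max_left _ _).trans (le_max_left _ _))
    · exact le_max_right _ _
    · exact (hρ.symm_le h2).trans ((le_max_right _ _).trans (le_max_left _ _))
  exact (key _ _ _ _ hx hy).antisymm (key _ _ _ _ (hρ.symm_le hx) (hρ.symm_le hy))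

namespace LevelData

variable (L : LevelData D)

/-- The pseudo-distance between two vertices, up to scale, when level `i` is at height `η i` and
the ends `x`, `y` branch at height `ρ x y`. -/
noncomputable def vertDist (ρ : Code D → Code D → ℝ) (η : ℤ → ℝ) (v w : L.Vert) : ℝ :=
  2 * max (max (η v.1) (η w.1)) (ρ v.2.out w.2.out) - η v.1 - η w.1

lemma vertDist_vert {ρ : Code D → Code D → ℝ} {η : ℤ → ℝ} (hρ : IsTreeMetric ρ)
    (hR : ∀ i x y, L.R i x y → ρ x y ≤ η i) (i j : ℤ) (x y : Code D) :
    L.vertDist ρ η (L.vert i x) (L.vert j y) = 2 * max (max (η i) (η j)) (ρ x y) - η i - η j := by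
  have hx : ρ (Quotient.mk (L.R i) x).out x ≤ η i :=
    hR _ _ _ (Quotient.exact (Quotient.out_eq (Quotient.mk (L.R i) x)))
  have hy : ρ (Quotient.mk (L.R j) y).out y ≤ η j :=
    hR _ _ _ (Quotient.exact (Quotient.out_eq (Quotient.mk (L.R j) y)))
  change 2 * max (max (η i) (η j)) (ρ (Quotient.mk (L.R i) x).out
    (Quotient.mk (L.R j) y).out) - η i - η j = _
  rw [hρ.max_congr hx hy]

end LevelData

namespace IsEnum

variable {ρ : Code D → Code D → ℝ} {N : ℕ} {ι : ℤ → ℝ}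

/-- The combinatorial data of the tree of a tree metric. -/
def levelData (hρ : IsTreeMetric ρ) (h : IsEnum ρ N ι) : LevelData D where
  N := N
  R i :=
    { r := fun x y => ρ x y ≤ ι i
      iseqv :=
        ⟨fun x => by rw [hρ.refl]; exact (h.pos hρ i).le, fun hxy => hρ.symm_le hxy,
          fun hxy hyz => hρ.ultra_le hxy hyz⟩ }
  one_le := h.one_le
  mono i j x y hij hxy := le_trans hxy (h.strictMono.monotone hij)
  top i x y hi := (hρ.le_one x y).trans (h.zero ▸ h.strictMono.monotone hi)
  cons i a u u' := by
    change ρ u u' ≤ ι (i + N) ↔ ρ (Code.cons a u) (Code.cons a u') ≤ ι i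
    rw [hρ.cons, h.add, div_le_iff₀' hρ.pos']
  shift i x y hxy := by
    change ρ (Code.shift x) (Code.shift y) ≤ ι (i + N)
    rw [h.add]
    exact (hρ.shift x y).trans (mul_le_mul_of_nonneg_left hxy hρ.pos'.le)
  branch := by
    obtain ⟨x, y, hxy⟩ := hρ.exists_one
    refine ⟨x, y, fun hle => ?_⟩
    have h1 : ρ x y ≤ ι (-1) := hle
    have h2 : ι (-1) < ι 0 := h.strictMono (by norm_num)
    rw [hxy] at h1
    rw [h.zero] at h2
    linarith

lemma vert_eq (hρ : IsTreeMetric ρ) (h : IsEnum ρ N ι) {i j : ℤ} {x y : Code D} :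
    (h.levelData hρ).vert i x = (h.levelData hρ).vert j y ↔ i = j ∧ ρ x y ≤ ι i :=
  (h.levelData hρ).vert_eq_iff

lemma ncard_children (hρ : IsTreeMetric ρ) (h : IsEnum ρ N ι) (i : ℤ) (z : Code D) :
    {w | (h.levelData hρ).parent w = (h.levelData hρ).vert i z}.ncard =
      cnt ρ (ι (i - 1)) (ball ρ (ι i) z) := by
  have h1 : {w | (h.levelData hρ).parent w = (h.levelData hρ).vert i z} =
      (h.levelData hρ).vert (i - 1) '' ball ρ (ι i) z := by
    ext w
    obtain ⟨j, y, rfl⟩ := (h.levelData hρ).exists_vert w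
    rw [Set.mem_ofPred_eq, LevelData.parent_vert, h.vert_eq hρ]
    constructor
    · rintro ⟨rfl, hy⟩
      exact ⟨y, hρ.symm_le hy, LevelData.vert_congr _ (by ring) rfl⟩
    · rintro ⟨y', hy', e⟩
      obtain ⟨rfl, e2⟩ := (h.vert_eq hρ).1 e
      refine ⟨by ring, ?_⟩
      rw [sub_add_cancel]
      exact hρ.symm_le (hρ.ultra_le hy' (e2.trans (h.strictMono.monotone (by omega))))
  have : Nonempty (Code D) := ⟨z⟩
  rw [h1, cnt]
  refine ncard_image_eq_of_iff _ _ (fun a b => ?_) _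
  rw [h.vert_eq hρ, hρ.ball_eq_iff (h.pos hρ _).le]
  simp

lemma branchDeg_eq (hρ : IsTreeMetric ρ) (h : IsEnum ρ N ι) (i : ℤ) (z : Code D) :
    TreeMap.IsLeveled.branchDeg (T := (h.levelData hρ).tree) (h.levelData hρ).invBranch
      ((h.levelData hρ).vert i z) = deg ρ (ι i) z := by
  unfold TreeMap.IsLeveled.branchDeg deg
  congr 1
  ext a
  simp only [Finset.mem_filter, Finset.mem_univ, true_and]
  change (h.levelData hρ).vert (i + N - N) (Code.cons a (Code.shift z)) = _ ↔ _
  rw [h.vert_eq hρ, add_sub_cancel_right]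
  simp

lemma hasDegree (hρ : IsTreeMetric ρ) (h : IsEnum ρ N ι) : (h.levelData hρ).tree.HasDegree D := by
  refine (h.levelData hρ).hasDegree fun i z => ?_
  rw [h.branchDeg_eq hρ, LevelData.map_vert, h.ncard_children hρ, h.ncard_children hρ]
  have e1 : ι (i + (h.levelData hρ).N - 1) = D * ι (i - 1) := by
    rw [← h.add]
    congr 1
    change i + (N : ℤ) - 1 = _
    ring
  have e2 : ι (i + (h.levelData hρ).N) = D * ι i := h.add i
  rw [e1, e2]
  exact hρ.riemannHurwitz z _ _ (h.pos hρ _) (h.strictMono.monotone (by omega))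

lemma map_iterate (hρ : IsTreeMetric ρ) (h : IsEnum ρ N ι) (n : ℕ) (i : ℤ) (x : Code D) :
    (h.levelData hρ).map^[n] ((h.levelData hρ).vert i x) =
      (h.levelData hρ).vert (i + n * N) (Code.shift^[n] x) := by
  induction n with
  | zero => exact LevelData.vert_congr _ (by simp) rfl
  | succ n ih =>
    rw [Function.iterate_succ_apply', ih, LevelData.map_vert, Function.iterate_succ_apply']
    refine LevelData.vert_congr _ ?_ rfl
    change i + n * N + (N : ℤ) = _
    push_cast
    ring

lemma isPolynomialLike (hρ : IsTreeMetric ρ) (h : IsEnum ρ N ι) :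
    (h.levelData hρ).tree.IsPolynomialLike D where
  hasInfinity := (h.levelData hρ).isLeveled.hasInfinity
  hasDegree := h.hasDegree hρ
  no_endpoints := (h.levelData hρ).isLeveled.val_ne_one
  grand_orbit v := by
    obtain ⟨i, x, rfl⟩ := (h.levelData hρ).exists_vert v
    obtain ⟨k, _, ⟨h0, a, b, rfl⟩, hk⟩ := h.isHeight i
    obtain ⟨l, hl⟩ := h.exists_eq_of_pos h0
    rw [← hl, ← h.add_mul hρ] at hk
    have hi : i = l + k * N := h.strictMono.injective hk
    refine ⟨(h.levelData hρ).vert l a, ?_, ?_⟩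
    · -- both orbits reach the same vertex of the spine
      refine ⟨i.natAbs + k.natAbs + 1, (i.natAbs + k.natAbs + 1 + k).toNat, by omega, by omega, ?_⟩
      refine (h.map_iterate hρ _ _ _).trans (Eq.trans ?_ (h.map_iterate hρ _ _ _).symm)
      have hN : (1 : ℤ) ≤ N := by exact_mod_cast h.one_le
      have h3 : ((i.natAbs + k.natAbs + 1 : ℕ) : ℤ) * 1 ≤ (i.natAbs + k.natAbs + 1 : ℕ) * N := by
        gcongr
      refine (h.vert_eq hρ).2 ⟨?_, ?_⟩
      · rw [Int.toNat_of_nonneg (by omega), hi]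
        push_cast
        ring
      · exact (h.levelData hρ).top _ _ _ (by omega)
    · refine (h.levelData hρ).isLeveled.two_lt_val (w := (h.levelData hρ).vert (l - 1) a)
        (w' := (h.levelData hρ).vert (l - 1) b) ?_ ?_ ?_
      · intro e
        have h1 := ((h.vert_eq hρ).1 e).2
        rw [← hl] at h1
        exact absurd h1 (not_le.2 (h.strictMono (by omega)))
      · exact LevelData.vert_congr _ (sub_add_cancel l 1) rfl
      · exact (h.vert_eq hρ).2 ⟨sub_add_cancel l 1, by
          change ρ b a ≤ ι (l - 1 + 1)
          rw [sub_add_cancel]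
          exact hρ.symm_le hl.ge⟩

/-- The distance between two vertices of the tree of a tree metric, up to scale. -/
noncomputable def vertDist (hρ : IsTreeMetric ρ) (h : IsEnum ρ N ι)
    (v w : (h.levelData hρ).Vert) : ℝ :=
  (h.levelData hρ).vertDist ρ ι v w

lemma vertDist_vert (hρ : IsTreeMetric ρ) (h : IsEnum ρ N ι) (i j : ℤ) (x y : Code D) :
    h.vertDist hρ ((h.levelData hρ).vert i x) ((h.levelData hρ).vert j y) =
      2 * max (max (ι i) (ι j)) (ρ x y) - ι i - ι j :=
  (h.levelData hρ).vertDist_vert hρ (fun _ _ _ hxy => hxy) i j x y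

lemma vertDist_parent (hρ : IsTreeMetric ρ) (h : IsEnum ρ N ι) (i : ℤ) (x : Code D) :
    h.vertDist hρ ((h.levelData hρ).vert i x) ((h.levelData hρ).vert (i + 1) x) =
      ι (i + 1) - ι i := by
  rw [vertDist_vert, hρ.refl, max_eq_right (h.strictMono.monotone (by omega)),
    max_eq_left (h.pos hρ _).le]
  ring

lemma vertDist_symm (hρ : IsTreeMetric ρ) (h : IsEnum ρ N ι) (v w : (h.levelData hρ).Vert) :
    h.vertDist hρ v w = h.vertDist hρ w v := by
  unfold vertDist LevelData.vertDist
  rw [hρ.symm, max_comm (ι v.1)]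
  ring

lemma vertDist_up (hρ : IsTreeMetric ρ) (h : IsEnum ρ N ι) (x z : (h.levelData hρ).Vert)
    (hxz : ¬ ∃ n, (h.levelData hρ).parent^[n] z = x) :
    h.vertDist hρ x z = h.vertDist hρ x ((h.levelData hρ).parent x) +
      h.vertDist hρ ((h.levelData hρ).parent x) z := by
  obtain ⟨i, x, rfl⟩ := (h.levelData hρ).exists_vert x
  obtain ⟨j, z, rfl⟩ := (h.levelData hρ).exists_vert z
  rw [LevelData.parent_vert, vertDist_parent, vertDist_vert, vertDist_vert]
  have key : max (max (ι i) (ι j)) (ρ x z) = max (max (ι (i + 1)) (ι j)) (ρ x z) := by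
    refine le_antisymm ?_ ?_
    · gcongr
      exact h.strictMono.monotone (by omega)
    · refine max_le (max_le ?_ ?_) (le_max_right _ _)
      · rcases le_or_gt (i + 1) j with hij | hij
        · exact (h.strictMono.monotone hij).trans ((le_max_right _ _).trans (le_max_left _ _))
        · refine le_trans (not_lt.1 fun hlt => hxz ⟨(i - j).toNat, ?_⟩) (le_max_right _ _)
          have := h.le_of_lt_succ hρ hlt
          rw [LevelData.parent_iterate, h.vert_eq hρ]
          have e : j + ((i - j).toNat : ℤ) = i := by omega
          rw [e]
          exact ⟨rfl, hρ.symm_le this⟩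
      · exact (le_max_right _ _).trans (le_max_left _ _)
  rw [key]
  ring

lemma vertDist_down (hρ : IsTreeMetric ρ) (h : IsEnum ρ N ι) (x z : (h.levelData hρ).Vert)
    (hxz : ∃ n, (h.levelData hρ).parent^[n] z = x) :
    h.vertDist hρ ((h.levelData hρ).parent x) z = h.vertDist hρ ((h.levelData hρ).parent x) x +
      h.vertDist hρ x z := by
  obtain ⟨n, rfl⟩ := hxz
  obtain ⟨j, z, rfl⟩ := (h.levelData hρ).exists_vert z
  rw [LevelData.parent_iterate, LevelData.parent_vert, h.vertDist_symm hρ _ (LevelData.vert _ _ _),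
    h.vertDist_symm hρ _ (LevelData.vert _ (j + n) _), vertDist_parent, vertDist_vert, vertDist_vert,
    hρ.refl, max_eq_right (h.strictMono.monotone (by omega)),
    max_eq_left (h.strictMono.monotone (by omega : j ≤ j + n)), max_eq_left (h.pos hρ _).le,
    max_eq_left (h.pos hρ _).le]
  ring

lemma isHeightMetric (hρ : IsTreeMetric ρ) (h : IsEnum ρ N ι) {c : ℝ} (hc : 0 < c) :
    (h.levelData hρ).tree.IsHeightMetric D fun v w => c * h.vertDist hρ v w where
  self v := by
    obtain ⟨i, x, rfl⟩ := (h.levelData hρ).exists_vert v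
    rw [vertDist_vert, hρ.refl, max_self, max_eq_left (h.pos hρ _).le]
    ring
  eq_of_zero v w := by
    obtain ⟨i, x, rfl⟩ := (h.levelData hρ).exists_vert v
    obtain ⟨j, y, rfl⟩ := (h.levelData hρ).exists_vert w
    intro h0
    have h1 := (mul_eq_zero.1 h0).resolve_left hc.ne'
    rw [vertDist_vert] at h1
    have h2 : ι i ≤ max (max (ι i) (ι j)) (ρ x y) := (le_max_left _ _).trans (le_max_left _ _)
    have h3 : ι j ≤ max (max (ι i) (ι j)) (ρ x y) := (le_max_right _ _).trans (le_max_left _ _)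
    have h4 : ρ x y ≤ max (max (ι i) (ι j)) (ρ x y) := le_max_right _ _
    exact (h.vert_eq hρ).2 ⟨h.strictMono.injective (by linarith), by linarith⟩
  symm v w := congrArg (c * ·) (h.vertDist_symm hρ v w)
  triangle u v w := by
    rw [← mul_add]
    refine mul_le_mul_of_nonneg_left ?_ hc.le
    obtain ⟨i, x, rfl⟩ := (h.levelData hρ).exists_vert u
    obtain ⟨j, y, rfl⟩ := (h.levelData hρ).exists_vert v
    obtain ⟨k, z, rfl⟩ := (h.levelData hρ).exists_vert w
    rw [vertDist_vert, vertDist_vert, vertDist_vert]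
    have h1 : ι i ≤ max (max (ι i) (ι j)) (ρ x y) := (le_max_left _ _).trans (le_max_left _ _)
    have h2 : ι j ≤ max (max (ι i) (ι j)) (ρ x y) := (le_max_right _ _).trans (le_max_left _ _)
    have h3 : ρ x y ≤ max (max (ι i) (ι j)) (ρ x y) := le_max_right _ _
    have h4 : ι j ≤ max (max (ι j) (ι k)) (ρ y z) := (le_max_left _ _).trans (le_max_left _ _)
    have h5 : ι k ≤ max (max (ι j) (ι k)) (ρ y z) := (le_max_right _ _).trans (le_max_left _ _)
    have h6 : ρ y z ≤ max (max (ι j) (ι k)) (ρ y z) := le_max_right _ _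
    have h7 : max (max (ι i) (ι k)) (ρ x z) ≤
        max (max (ι i) (ι j)) (ρ x y) + max (max (ι j) (ι k)) (ρ y z) - ι j := by
      refine max_le (max_le (by linarith) (by linarith)) ((hρ.ultra x y z).trans ?_)
      exact max_le (by linarith) (by linarith)
    linarith
  path := by
    refine (h.levelData hρ).isLeveled.path_additive (fun v => ?_) (fun x z hxz => ?_)
      (fun x z hxz => ?_)
    · obtain ⟨i, x, rfl⟩ := (h.levelData hρ).exists_vert v
      rw [vertDist_vert, hρ.refl, max_self, max_eq_left (h.pos hρ _).le]
      ring
    · rw [h.vertDist_up hρ x z hxz, mul_add]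
    · rw [h.vertDist_down hρ x z hxz, mul_add]
  expand v w hvw := by
    have key : ∀ v, c * h.vertDist hρ ((h.levelData hρ).map v)
        ((h.levelData hρ).map ((h.levelData hρ).parent v)) =
          D * (c * h.vertDist hρ v ((h.levelData hρ).parent v)) := by
      intro v
      obtain ⟨i, x, rfl⟩ := (h.levelData hρ).exists_vert v
      rw [LevelData.map_parent, LevelData.map_vert, LevelData.parent_vert, LevelData.parent_vert,
        vertDist_parent, vertDist_parent]
      change c * (ι (i + N + 1) - ι (i + N)) = _
      rw [add_right_comm, h.add, h.add]
      ring
    rcases hvw with rfl | rfl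
    · exact key v
    · have := key w
      rw [h.vertDist_symm hρ, h.vertDist_symm hρ w] at this
      exact this

/-- The metrized tree of a tree metric. -/
noncomputable def mtree (hρ : IsTreeMetric ρ) (h : IsEnum ρ N ι) {c : ℝ} (hc : 0 < c) : MTree D where
  toTreeMap := (h.levelData hρ).tree
  polyLike := h.isPolynomialLike hρ
  d := fun v w => c * h.vertDist hρ v w
  heightMetric := h.isHeightMetric hρ hc

lemma labelling (hρ : IsTreeMetric ρ) (h : IsEnum ρ N ι) {c : ℝ} (hc : 0 < c) :
    Labelling (h.mtree hρ hc) ρ c N ι (h.levelData hρ).vert where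
  toCombLab := (h.levelData hρ).combLab
  dist i j x y := congrArg (c * ·) (h.vertDist_vert hρ i j x y)

end IsEnum

lemma IsTreeMetric.exists_labelled {ρ : Code D → Code D → ℝ} (hρ : IsTreeMetric ρ) {c : ℝ}
    (hc : 0 < c) : ∃ X : MTree D, IsLabelled X ρ c := by
  obtain ⟨N, ι, h⟩ := hρ.exists_enum
  exact ⟨h.mtree hρ hc, N, ι, _, h, h.labelling hρ hc⟩

lemma IsLabelled.equivalent {X Y : MTree D} {ρ : Code D → Code D → ℝ} {c : ℝ}
    (hX : IsLabelled X ρ c) (hY : IsLabelled Y ρ c) : MTree.Equivalent X Y := by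
  obtain ⟨N, ι, lam, h, hl⟩ := hX
  obtain ⟨N', ι', lam', h', hl'⟩ := hY
  obtain ⟨rfl, rfl⟩ := h.unique h' fun _ => Iff.rfl
  choose i x hix using hl.surj
  have hf : ∀ j y, lam' (i (lam j y)) (x (lam j y)) = lam' j y := fun j y =>
    (hl'.eq_iff _ _ _ _).2 ((hl.eq_iff _ _ _ _).1 (hix (lam j y)))
  have hbij : Function.Bijective fun v => lam' (i v) (x v) := by
    constructor
    · intro v w hvw
      rw [← hix v, ← hix w]
      exact (hl.eq_iff _ _ _ _).2 ((hl'.eq_iff _ _ _ _).1 hvw)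
    · intro w
      obtain ⟨j, y, rfl⟩ := hl'.surj w
      exact ⟨lam j y, hf j y⟩
  refine ⟨Equiv.ofBijective _ hbij, fun v w => ?_, fun v => ?_⟩
  · obtain ⟨j, y, rfl⟩ := hl.surj v
    obtain ⟨k, z, rfl⟩ := hl.surj w
    rw [Equiv.ofBijective_apply, Equiv.ofBijective_apply, hf, hf, hl'.dist, hl.dist]
  · obtain ⟨j, y, rfl⟩ := hl.surj v
    rw [Equiv.ofBijective_apply, Equiv.ofBijective_apply, hf, hl.dyn, hf, hl'.dyn]

lemma IsLabelled.scale {X : MTree D} {ρ : Code D → Code D → ℝ} {c : ℝ} (hX : IsLabelled X ρ c)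
    (a : PosReal) : IsLabelled (X.scale a) ρ (a.1 * c) := by
  obtain ⟨N, ι, lam, h, hl⟩ := hX
  refine ⟨N, ι, lam, h, hl.toCombLab, fun i j x y => ?_⟩
  change a.1 * X.d _ _ = _
  rw [hl.dist, mul_assoc]

/-! ### Comparison of labelled trees on finite levels -/

namespace CombLab

variable {T T' : TreeMap} {N : ℕ} {R R' : ℤ → Code D → Code D → Prop} {lam : ℤ → Code D → T.V}
  {lam' : ℤ → Code D → T'.V}

lemma lam_of_height (h : CombLab T N R lam) {i : ℤ} (hi : 0 ≤ i) {v : T.V} (hv : T.height v = i)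
    (x : Code D) : v = lam i x := by
  obtain ⟨j, y, rfl⟩ := h.surj v
  rw [h.height] at hv
  subst hv
  exact (h.eq_iff _ _ _ _).2 ⟨rfl, h.top _ _ _ hi⟩

lemma base_eq (h : CombLab T N R lam) (x : Code D) : T.base = lam 0 x := by
  refine h.lam_of_height le_rfl ?_ x
  simp [TreeMap.height]

lemma spine_eq (h : CombLab T N R lam) (i : ℕ) (x : Code D) : T.spine i = lam i x :=
  h.lam_of_height (Int.natCast_nonneg i)
    (Classical.epsilon_spec (p := fun v => T.height v = i) ⟨lam i x, h.height _ _⟩) x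

lemma mem_level (h : CombLab T N R lam) {k : ℕ} {i : ℤ} {x : Code D} :
    lam i x ∈ T.level k ↔ -(k * N : ℤ) ≤ i ∧ i ≤ k * N := by
  rw [TreeMap.level, Set.mem_ofPred_eq, h.height, h.N_eq]

/-- Two trees with the same combinatorial labels on the levels between `-k N` and `k N` have
isomorphic finite subtrees. -/
lemma exists_levelIso (h : CombLab T N R lam) (h' : CombLab T' N R' lam') (k : ℕ)
    (hR : ∀ i : ℤ, -(k * N : ℤ) ≤ i → i ≤ k * N → ∀ x y, R i x y ↔ R' i x y) :
    ∃ φ : TreeMap.LevelIso T T' k, ∀ v i x, v.1 = lam i x → (φ.iso v).1 = lam' i x := by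
  choose i x hix using h.surj
  have hmem : ∀ v : T.level k, -(k * N : ℤ) ≤ i v.1 ∧ i v.1 ≤ k * N := fun v => by
    have := v.2
    rwa [← hix v.1, h.mem_level] at this
  let f : T.level k → T'.level k := fun v => ⟨lam' (i v.1) (x v.1), h'.mem_level.2 (hmem v)⟩
  have hf : ∀ v j y, v.1 = lam j y → (f v).1 = lam' j y := by
    intro v j y hv
    have h1 := hmem v
    have h2 := (h.eq_iff _ _ _ _).1 ((hix v.1).trans hv)
    exact (h'.eq_iff _ _ _ _).2 ⟨h2.1, (hR _ h1.1 h1.2 _ _).1 h2.2⟩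
  have hbij : Function.Bijective f := by
    constructor
    · intro v w hvw
      have h1 := hmem v
      have h2 := (h'.eq_iff _ _ _ _).1 (congrArg Subtype.val hvw)
      apply Subtype.ext
      rw [← hix v.1, ← hix w.1]
      exact (h.eq_iff _ _ _ _).2 ⟨h2.1, (hR _ h1.1 h1.2 _ _).2 h2.2⟩
    · rintro ⟨w, hw⟩
      obtain ⟨j, y, rfl⟩ := h'.surj w
      exact ⟨⟨lam j y, h.mem_level.2 (h'.mem_level.1 hw)⟩, Subtype.ext (hf _ j y rfl)⟩
  refine ⟨⟨⟨Equiv.ofBijective f hbij, ?_⟩, ?_, ?_⟩, hf⟩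
  · intro v w
    have h1 := hmem v
    have h2 := hmem w
    change T'.G.Adj (f v).1 (f w).1 ↔ T.G.Adj v.1 w.1
    rw [hf v _ _ (hix v.1).symm, hf w _ _ (hix w.1).symm, h'.adj_iff, ← hR _ h1.1 h1.2,
      ← hR _ h2.1 h2.2, ← h.adj_iff, hix, hix]
  · intro v
    change v.1 = T.base ↔ (f v).1 = T'.base
    have h1 := hmem v
    rw [hf v _ _ (hix v.1).symm, h.base_eq (x v.1), h'.base_eq (x v.1), h'.eq_iff, ← hR _ h1.1 h1.2,
      ← h.eq_iff, hix]
  · intro v w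
    have h2 := hmem w
    change T.F v.1 = w.1 ↔ T'.F (f v).1 = (f w).1
    rw [hf v _ _ (hix v.1).symm, hf w _ _ (hix w.1).symm, h'.dyn, h'.eq_iff]
    have h3 : T.F v.1 = w.1 ↔
        i v.1 + N = i w.1 ∧ R (i v.1 + N) (Code.shift (x v.1)) (x w.1) := by
      rw [← h.eq_iff, ← h.dyn, hix, hix]
    rw [h3]
    refine and_congr_right fun e => ?_
    rw [e]
    exact hR _ h2.1 h2.2 _ _

end CombLab

/-! ### Strong limits of sequences of labelled trees -/

/-- Sequences of labelled trees whose combinatorial labels stabilize on each level, and whose tree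
metrics, scales and heights converge. -/
structure ConvergentLabels (ρn : ℕ → Code D → Code D → ℝ) (Nn : ℕ → ℕ) (ιn : ℕ → ℤ → ℝ)
    (ρ : Code D → Code D → ℝ) (N : ℕ) (η : ℤ → ℝ) : Prop where
  metric : ∀ n, IsTreeMetric (ρn n)
  isEnum : ∀ n, IsEnum (ρn n) (Nn n) (ιn n)
  limit : IsTreeMetric ρ
  tendsto_metric : ∀ x y, Tendsto (fun n => ρn n x y) atTop (𝓝 (ρ x y))
  eventually_N : ∀ᶠ n in atTop, Nn n = N
  tendsto_height : ∀ i, Tendsto (fun n => ιn n i) atTop (𝓝 (η i))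
  stable : ∀ i x y, (∀ᶠ n in atTop, ρn n x y ≤ ιn n i) ∨ ∀ᶠ n in atTop, ¬ ρn n x y ≤ ιn n i

namespace IsEnum

variable {ρ : Code D → Code D → ℝ} {N : ℕ} {ι : ℤ → ℝ}

lemma le_iff_of_agree (hρ : IsTreeMetric ρ) (h : IsEnum ρ N ι) {i : ℤ} {k : ℕ} (hk : -(k : ℤ) ≤ i)
    {x x' y y' : Code D} (hx : ∀ n < k, x n = x' n) (hy : ∀ n < k, y n = y' n) :
    ρ x y ≤ ι i ↔ ρ x' y' ≤ ι i := by
  have hN : (k : ℤ) * 1 ≤ k * N := by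
    gcongr
    exact_mod_cast h.one_le
  have h1 : ρ x x' ≤ ι i := (h.levelData hρ).of_agree k hx (show 0 ≤ i + k * (N : ℤ) by omega)
  have h2 : ρ y y' ≤ ι i := (h.levelData hρ).of_agree k hy (show 0 ≤ i + k * (N : ℤ) by omega)
  exact ⟨fun h3 => hρ.ultra_le (hρ.symm_le h1) (hρ.ultra_le h3 h2),
    fun h3 => hρ.ultra_le h1 (hρ.ultra_le h3 (hρ.symm_le h2))⟩

lemma mem_Icc (hρ : IsTreeMetric ρ) (h : IsEnum ρ N ι) (i : ℤ) :
    ι i ∈ Set.Icc ((D : ℝ) ^ (-|i|)) ((D : ℝ) ^ |i|) := by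
  have hN : |i| * 1 ≤ |i| * N := by
    gcongr
    exact_mod_cast h.one_le
  rw [← h.mul_eq hρ, ← h.mul_eq hρ]
  have := neg_abs_le i
  have := le_abs_self i
  exact ⟨h.strictMono.monotone (by linarith), h.strictMono.monotone (by linarith)⟩

end IsEnum

namespace ConvergentLabels

variable {ρn : ℕ → Code D → Code D → ℝ} {Nn : ℕ → ℕ} {ιn : ℕ → ℤ → ℝ}
    {ρ : Code D → Code D → ℝ} {N : ℕ} {η : ℤ → ℝ}

lemma eventually_congr (h : ConvergentLabels ρn Nn ιn ρ N η) (i : ℤ) :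
    ∀ᶠ n in atTop, ∀ x y, ρn n x y ≤ ιn n i ↔ ∀ᶠ m in atTop, ρn m x y ≤ ιn m i := by
  obtain ⟨o, -⟩ := h.limit.exists_one
  have hfin := finite_range_splice o i.natAbs
  have h1 : ∀ᶠ n in atTop, ∀ x ∈ Set.range (splice o i.natAbs), ∀ y ∈ Set.range (splice o i.natAbs),
      ρn n x y ≤ ιn n i ↔ ∀ᶠ m in atTop, ρn m x y ≤ ιn m i := by
    refine (eventually_all_finite hfin).2 fun x _ => (eventually_all_finite hfin).2 fun y _ => ?_
    rcases h.stable i x y with h2 | h2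
    · exact h2.mono fun n hn => iff_of_true hn h2
    · refine h2.mono fun n hn => iff_of_false hn fun h3 => ?_
      obtain ⟨m, hm, hm'⟩ := (h2.and h3).exists
      exact hm hm'
  filter_upwards [h1] with n hn x y
  have key : ∀ m, ρn m x y ≤ ιn m i ↔
      ρn m (splice o i.natAbs x) (splice o i.natAbs y) ≤ ιn m i := fun m =>
    (h.isEnum m).le_iff_of_agree (h.metric m) (k := i.natAbs) (by omega)
      (splice_agree o _ x) (splice_agree o _ y)
  rw [key, hn _ ⟨x, rfl⟩ _ ⟨y, rfl⟩]
  exact Filter.eventually_congr (Eventually.of_forall fun m => (key m).symm)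

/-- The combinatorial limit. -/
def levelData (h : ConvergentLabels ρn Nn ιn ρ N η) : LevelData D where
  N := N
  R i :=
    { r := fun x y => ∀ᶠ n in atTop, ρn n x y ≤ ιn n i
      iseqv :=
        ⟨fun x => Eventually.of_forall fun n => by
            rw [(h.metric n).refl]
            exact ((h.isEnum n).pos (h.metric n) i).le,
          fun hxy => hxy.mono fun n hn => (h.metric n).symm_le hn,
          fun hxy hyz => (hxy.and hyz).mono fun n hn => (h.metric n).ultra_le hn.1 hn.2⟩ }
  one_le := by
    obtain ⟨n, hn⟩ := h.eventually_N.exists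
    exact hn ▸ (h.isEnum n).one_le
  mono i j x y hij hxy := hxy.mono fun n hn => hn.trans ((h.isEnum n).strictMono.monotone hij)
  top i x y hi := Eventually.of_forall fun n => ((h.isEnum n).levelData (h.metric n)).top i x y hi
  cons i a u u' := by
    refine Filter.eventually_congr (h.eventually_N.mono fun n hn => ?_)
    subst hn
    exact ((h.isEnum n).levelData (h.metric n)).cons i a u u'
  shift i x y hxy := by
    refine (hxy.and h.eventually_N).mono fun n hn => ?_
    obtain ⟨hn, rfl⟩ := hn
    exact ((h.isEnum n).levelData (h.metric n)).shift i x y hn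
  branch := by
    by_contra hcon
    push Not at hcon
    obtain ⟨n, hn⟩ := (h.eventually_congr (-1)).exists
    obtain ⟨x, y, hxy⟩ := ((h.isEnum n).levelData (h.metric n)).branch
    exact hxy ((hn x y).2 (hcon x y))

lemma le_of_rel (h : ConvergentLabels ρn Nn ιn ρ N η) (i : ℤ) (x y : Code D)
    (hxy : h.levelData.R i x y) : ρ x y ≤ η i :=
  le_of_tendsto_of_tendsto (h.tendsto_metric x y) (h.tendsto_height i) hxy

lemma height_zero (h : ConvergentLabels ρn Nn ιn ρ N η) : η 0 = 1 :=
  tendsto_nhds_unique (h.tendsto_height 0)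
    (tendsto_const_nhds.congr fun n => (h.isEnum n).zero.symm)

lemma height_add_mul (h : ConvergentLabels ρn Nn ιn ρ N η) (i k : ℤ) :
    η (i + k * N) = D ^ k * η i := by
  refine tendsto_nhds_unique (h.tendsto_height _) (((h.tendsto_height i).const_mul _).congr' ?_)
  filter_upwards [h.eventually_N] with n hn
  subst hn
  exact ((h.isEnum n).add_mul (h.metric n) i k).symm

lemma height_pos (h : ConvergentLabels ρn Nn ιn ρ N η) (i : ℤ) : 0 < η i :=
  (zpow_pos h.limit.pos' (-|i|)).trans_le
    (ge_of_tendsto' (h.tendsto_height i) fun n => ((h.isEnum n).mem_Icc (h.metric n) i).1)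

lemma le_height (h : ConvergentLabels ρn Nn ιn ρ N η) : (D : ℝ) ≤ η D := by
  refine ge_of_tendsto' (h.tendsto_height D) fun n => ?_
  have h1 := (h.isEnum n).add 0
  rw [(h.isEnum n).zero, mul_one] at h1
  rw [← h1]
  refine (h.isEnum n).strictMono.monotone ?_
  have := (h.isEnum n).lt (h.metric n)
  omega

/-- Every positive value of the limiting tree metric is the height of a level of the combinatorial
limit. -/
lemma exists_height_eq_value (h : ConvergentLabels ρn Nn ιn ρ N η) {x y : Code D}
    (hxy : 0 < ρ x y) : ∃ l, η l = ρ x y := by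
  obtain ⟨B, hB⟩ := h.limit.exists_pow_lt hxy
  have h1 : ∀ᶠ n in atTop, ∃ l ∈ Set.Icc (-(B * N : ℤ)) 0, ιn n l = ρn n x y := by
    filter_upwards [(h.tendsto_metric x y).eventually_const_lt hB, h.eventually_N] with n hn hN
    subst hN
    obtain ⟨l, hl⟩ := (h.isEnum n).exists_eq_of_pos ((by
      have := h.limit.pos'
      positivity : (0 : ℝ) ≤ ((D : ℝ)⁻¹) ^ B).trans_lt hn)
    refine ⟨l, ⟨?_, ?_⟩, hl⟩
    · rw [← (h.isEnum n).strictMono.le_iff_le, hl, ← neg_mul, (h.isEnum n).mul_eq (h.metric n),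
        zpow_neg, zpow_natCast, ← inv_pow]
      exact hn.le
    · rw [← (h.isEnum n).strictMono.le_iff_le, hl, (h.isEnum n).zero]
      exact (h.metric n).le_one x y
  by_contra hcon
  push Not at hcon
  have h2 : ∀ l ∈ Set.Icc (-(B * N : ℤ)) 0, ∀ᶠ n in atTop, ιn n l ≠ ρn n x y := by
    intro l _
    have := ((h.tendsto_height l).sub (h.tendsto_metric x y)).eventually_ne (sub_ne_zero.2 (hcon l))
    exact this.mono fun n hn => sub_ne_zero.1 hn
  obtain ⟨n, ⟨l, hl, hn⟩, hn'⟩ := (h1.and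
    ((eventually_all_finite (Set.finite_Icc _ _)).2 h2)).exists
  exact hn' l hl hn

lemma exists_height_eq (h : ConvergentLabels ρn Nn ιn ρ N η) {N' : ℕ} {ι : ℤ → ℝ}
    (hι : IsEnum ρ N' ι) (i : ℤ) : ∃ l, η l = ι i := by
  obtain ⟨k, _, ⟨h0, x, y, rfl⟩, hk⟩ := hι.isHeight i
  obtain ⟨l, hl⟩ := h.exists_height_eq_value h0
  exact ⟨l + k * N, by rw [h.height_add_mul, hl, hk]⟩

variable {X : ℕ → MTree D} {cn : ℕ → ℝ} {lamn : ∀ n, ℤ → Code D → (X n).V} {c : ℝ}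

lemma eventually_levelIso (h : ConvergentLabels ρn Nn ιn ρ N η)
    (hX : ∀ n, Labelling (X n) (ρn n) (cn n) (Nn n) (ιn n) (lamn n)) (k : ℕ) :
    ∀ᶠ n in atTop, ∃ φ : TreeMap.LevelIso h.levelData.tree (X n).toTreeMap k,
      ∀ v i x, v.1 = h.levelData.vert i x → (φ.iso v).1 = lamn n i x := by
  have h1 : ∀ᶠ n in atTop, ∀ i ∈ Set.Icc (-(k * N : ℤ)) (k * N), ∀ x y,
      ρn n x y ≤ ιn n i ↔ h.levelData.R i x y :=
    (eventually_all_finite (Set.finite_Icc _ _)).2 fun i _ => h.eventually_congr i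
  filter_upwards [h1, h.eventually_N] with n hn hN
  have h2 := (hX n).toCombLab
  rw [hN] at h2
  exact h.levelData.combLab.exists_levelIso h2 k fun i hi hi' x y => (hn i ⟨hi, hi'⟩ x y).symm

lemma eventually_levelIso_succ (h : ConvergentLabels ρn Nn ιn ρ N η)
    (hX : ∀ n, Labelling (X n) (ρn n) (cn n) (Nn n) (ιn n) (lamn n)) (k : ℕ) :
    ∀ᶠ n in atTop, Nonempty (TreeMap.LevelIso (X n).toTreeMap (X (n + 1)).toTreeMap k) := by
  have h1 : ∀ᶠ n in atTop, ∀ i ∈ Set.Icc (-(k * N : ℤ)) (k * N), ∀ x y,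
      ρn n x y ≤ ιn n i ↔ h.levelData.R i x y :=
    (eventually_all_finite (Set.finite_Icc _ _)).2 fun i _ => h.eventually_congr i
  filter_upwards [h1, h.eventually_N, (tendsto_add_atTop_nat 1).eventually h1,
    (tendsto_add_atTop_nat 1).eventually h.eventually_N] with n hn hN hn' hN'
  have h2 := (hX n).toCombLab
  have h3 := (hX (n + 1)).toCombLab
  rw [hN] at h2
  rw [hN'] at h3
  obtain ⟨φ, -⟩ := h2.exists_levelIso h3 k fun i hi hi' x y =>
    (hn i ⟨hi, hi'⟩ x y).trans (hn' i ⟨hi, hi'⟩ x y).symm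
  exact ⟨φ⟩

lemma tendsto_dist (h : ConvergentLabels ρn Nn ιn ρ N η)
    (hX : ∀ n, Labelling (X n) (ρn n) (cn n) (Nn n) (ιn n) (lamn n))
    (hc : Tendsto cn atTop (𝓝 c)) (i j : ℤ) (x y : Code D) :
    Tendsto (fun n => (X n).d (lamn n i x) (lamn n j y)) atTop
      (𝓝 (c * (2 * max (max (η i) (η j)) (ρ x y) - η i - η j))) := by
  simp only [(hX _).dist]
  exact hc.mul ((((((h.tendsto_height i).max (h.tendsto_height j)).max
    (h.tendsto_metric x y)).const_mul 2).sub (h.tendsto_height i)).sub (h.tendsto_height j))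

lemma convergesStrongly (h : ConvergentLabels ρn Nn ιn ρ N η)
    (hX : ∀ n, Labelling (X n) (ρn n) (cn n) (Nn n) (ιn n) (lamn n))
    (hc : Tendsto cn atTop (𝓝 c)) (hc0 : 0 < c) : ConvergesStrongly X := by
  obtain ⟨o, -⟩ := h.limit.exists_one
  have h1 : ∀ i : ℕ, Tendsto (fun n => (X n).d (X n).base ((X n).spine i)) atTop
      (𝓝 (c * (2 * max (max (η 0) (η i)) (ρ o o) - η 0 - η i))) := by
    intro i
    refine (h.tendsto_dist hX hc 0 i o o).congr fun n => ?_
    rw [(hX n).base_eq o, (hX n).spine_eq i o]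
  refine ⟨fun i _ => ⟨_, h1 i⟩, ⟨_, ?_, h1 D⟩, fun k _ => h.eventually_levelIso_succ hX k⟩
  refine mul_pos hc0 ?_
  have h2 : η D ≤ max (max (η 0) (η D)) (ρ o o) := (le_max_right _ _).trans (le_max_left _ _)
  have h3 := h.le_height
  have h4 := h.limit.one_lt'
  rw [h.height_zero] at h2 ⊢
  linarith

lemma isSimplicialLimit (h : ConvergentLabels ρn Nn ιn ρ N η)
    (hX : ∀ n, Labelling (X n) (ρn n) (cn n) (Nn n) (ιn n) (lamn n))
    (hc : Tendsto cn atTop (𝓝 c)) :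
    IsSimplicialLimit X h.levelData.tree fun v w => c * h.levelData.vertDist ρ η v w := by
  refine ⟨h.levelData.isLeveled.hasInfinity, fun k _ ε hε => ?_⟩
  choose i x hix using h.levelData.exists_vert
  have hfin : (h.levelData.tree.level k).Finite := by
    refine ((Set.finite_Icc (-(k * N : ℤ)) (k * N)).biUnion fun i _ =>
      h.levelData.finite_level i).subset ?_
    intro v hv
    obtain ⟨j, y, rfl⟩ := h.levelData.exists_vert v
    have := h.levelData.combLab.mem_level.1 hv
    exact Set.mem_biUnion (show j ∈ Set.Icc (-(k * N : ℤ)) (k * N) from this) ⟨y, rfl⟩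
  have h1 : ∀ᶠ n in atTop, ∀ v ∈ h.levelData.tree.level k, ∀ w ∈ h.levelData.tree.level k,
      |(X n).d (lamn n (i v) (x v)) (lamn n (i w) (x w)) - c * h.levelData.vertDist ρ η v w| ≤ ε := by
    refine (eventually_all_finite hfin).2 fun v _ => (eventually_all_finite hfin).2 fun w _ => ?_
    have h2 := h.tendsto_dist hX hc (i v) (i w) (x v) (x w)
    have e : h.levelData.vertDist ρ η (h.levelData.vert (i v) (x v))
        (h.levelData.vert (i w) (x w)) = h.levelData.vertDist ρ η v w :=
      congrArg₂ (h.levelData.vertDist ρ η) (hix v) (hix w)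
    rw [← h.levelData.vertDist_vert h.limit h.le_of_rel, e] at h2
    exact (Metric.tendsto_nhds.1 h2 ε hε).mono fun n hn => hn.le
  filter_upwards [h1, h.eventually_levelIso hX k] with n hn hφ
  obtain ⟨φ, hφ⟩ := hφ
  refine ⟨φ, fun v w => ?_⟩
  rw [hφ v _ _ (hix v.1).symm, hφ w _ _ (hix w.1).symm]
  exact hn v.1 v.2 w.1 w.2

lemma isCollapse (h : ConvergentLabels ρn Nn ιn ρ N η) {Y : MTree D} {N' : ℕ} {ι : ℤ → ℝ}
    {lam : ℤ → Code D → Y.V} (hι : IsEnum ρ N' ι) (hY : Labelling Y ρ c N' ι lam) :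
    IsCollapse h.levelData.tree (fun v w => c * h.levelData.vertDist ρ η v w) Y := by
  choose i x hix using hY.surj
  choose l hl using h.exists_height_eq hι
  have hv := h.levelData.vertDist_vert h.limit h.le_of_rel
  have hself : ∀ j y, ρ (x (lam j y)) y ≤ ι j ∧ i (lam j y) = j := fun j y => by
    have h1 := (hY.eq_iff _ _ _ _).1 (hix (lam j y))
    exact ⟨h1.2.trans_eq (congrArg ι h1.1), h1.1⟩
  have hρ := h.limit
  refine ⟨fun u => h.levelData.vert (l (i u)) (x u), fun u w => ?_, fun u => ?_, fun v => ?_⟩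
  · beta_reduce
    rw [hv, hl, hl, ← hY.dist, hix, hix]
  · have h1 : Y.F u = lam (i u + N') (Code.shift (x u)) := by rw [← hY.dyn, hix]
    obtain ⟨h2, h3⟩ := hself (i u + N') (Code.shift (x u))
    rw [← h1] at h2 h3
    change c * h.levelData.vertDist ρ η _ (h.levelData.map (h.levelData.vert _ _)) = 0
    have h4 : η (l (i u) + h.levelData.N) = ι (i u + N') := by
      have := h.height_add_mul (l (i u)) 1
      rw [one_mul, zpow_one, hl, ← hι.add] at this
      exact this
    rw [LevelData.map_vert, hv, hl, h4, h3, max_self, max_eq_left h2]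
    ring
  · obtain ⟨k, z, rfl⟩ := h.levelData.exists_vert v
    obtain ⟨a, ha⟩ := hι.exists_gt hρ (η k)
    obtain ⟨b, hb⟩ := hι.exists_lt hρ (h.height_pos k)
    obtain ⟨h1, h2⟩ := hself a z
    obtain ⟨h3, h4⟩ := hself b z
    refine ⟨lam a z, lam b z, ?_⟩
    beta_reduce
    rw [hv, hv, hv, hl, hl, h2, h4, max_eq_left (h1.trans ((le_max_left _ _))),
      max_eq_left ((hρ.symm_le h3).trans (le_max_right _ _)), max_eq_left ha.le, max_eq_left hb.le,
      hρ.max_congr h1 h3, hρ.refl, max_eq_left (hb.le.trans ha.le),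
      max_eq_left ((hι.pos hρ a).le)]
    ring

end ConvergentLabels

/-- Every sequence of tree metrics has a subsequence along which the combinatorial labels
stabilize and the heights converge. -/
lemma exists_convergentLabels {ρn : ℕ → Code D → Code D → ℝ} {Nn : ℕ → ℕ} {ιn : ℕ → ℤ → ℝ}
    {ρ : Code D → Code D → ℝ} (hρn : ∀ n, IsTreeMetric (ρn n))
    (hι : ∀ n, IsEnum (ρn n) (Nn n) (ιn n)) (hρ : IsTreeMetric ρ)
    (hlim : ∀ x y, Tendsto (fun n => ρn n x y) atTop (𝓝 (ρ x y))) :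
    ∃ (φ : ℕ → ℕ) (N : ℕ) (η : ℤ → ℝ), StrictMono φ ∧
      ConvergentLabels (fun n => ρn (φ n)) (fun n => Nn (φ n)) (fun n => ιn (φ n)) ρ N η := by
  classical
  obtain ⟨o, -⟩ := hρ.exists_one
  let W : Set (Code D) := ⋃ k, Set.range (splice o k)
  have hW : W.Countable := Set.countable_iUnion fun k => (finite_range_splice o k).countable
  have := hW.to_subtype
  let K : Set ((ℤ → ℝ) × (ℤ × W × W → Bool) × Fin D) :=
    (Set.univ.pi fun i => Set.Icc ((D : ℝ) ^ (-|i|)) ((D : ℝ) ^ |i|)) ×ˢ Set.univ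
  have hK : IsCompact K := (isCompact_univ_pi fun _ => isCompact_Icc).prod isCompact_univ
  let u : ℕ → (ℤ → ℝ) × (ℤ × W × W → Bool) × Fin D := fun n =>
    (ιn n, fun q => decide (ρn n q.2.1 q.2.2 ≤ ιn n q.1), ⟨Nn n, (hι n).lt (hρn n)⟩)
  have hu : ∀ n, u n ∈ K := fun n =>
    ⟨fun i _ => (hι n).mem_Icc (hρn n) i, Set.mem_univ _⟩
  obtain ⟨⟨η, b, N⟩, -, φ, hφ, hlimu⟩ := hK.tendsto_subseq hu
  rw [Prod.tendsto_iff] at hlimu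
  obtain ⟨h1, h2⟩ := hlimu
  rw [Prod.tendsto_iff] at h2
  obtain ⟨h2, h3⟩ := h2
  have h2' : ∀ i x y, ∀ᶠ n in atTop,
      decide (ρn (φ n) (x : W) (y : W) ≤ ιn (φ n) i) = b (i, x, y) := fun i x y =>
    (nhds_discrete Bool ▸ tendsto_pi_nhds.1 h2 (i, x, y)).eventually_mem
      (show {b (i, x, y)} ∈ pure (b (i, x, y)) from rfl)
  have h3' : ∀ᶠ n in atTop, (⟨Nn (φ n), (hι _).lt (hρn _)⟩ : Fin D) = N :=
    (nhds_discrete (Fin D) ▸ h3).eventually_mem (show {N} ∈ pure N from rfl)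
  refine ⟨φ, N, η, hφ, fun n => hρn _, fun n => hι _, hρ,
    fun x y => (hlim x y).comp hφ.tendsto_atTop, ?_, fun i => tendsto_pi_nhds.1 h1 i, ?_⟩
  · exact h3'.mono fun n hn => congrArg Fin.val hn
  · intro i x y
    have key : ∀ n, ρn n x y ≤ ιn n i ↔
        ρn n (splice o i.natAbs x) (splice o i.natAbs y) ≤ ιn n i := fun n =>
      (hι n).le_iff_of_agree (hρn n) (k := i.natAbs) (by omega)
        (splice_agree o _ x) (splice_agree o _ y)
    have h4 := h2' i ⟨splice o i.natAbs x, Set.mem_iUnion.2 ⟨_, x, rfl⟩⟩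
      ⟨splice o i.natAbs y, Set.mem_iUnion.2 ⟨_, y, rfl⟩⟩
    cases hb : b (i, ⟨splice o i.natAbs x, Set.mem_iUnion.2 ⟨_, x, rfl⟩⟩,
      ⟨splice o i.natAbs y, Set.mem_iUnion.2 ⟨_, y, rfl⟩⟩) with
    | true =>
      rw [hb] at h4
      exact Or.inl (h4.mono fun n hn => (key _).2 (of_decide_eq_true hn))
    | false =>
      rw [hb] at h4
      exact Or.inr (h4.mono fun n hn hcon => of_decide_eq_false hn ((key _).1 hcon))

/-- If the labels and the scales of a sequence of trees converge, then a subsequence of the trees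
converges strongly to the tree of the limiting labels. -/
theorem exists_strongLimit_subseq {X : ℕ → MTree D} {ρn : ℕ → Code D → Code D → ℝ} {cn : ℕ → ℝ}
    (hρn : ∀ n, IsTreeMetric (ρn n)) (hX : ∀ n, IsLabelled (X n) (ρn n) (cn n))
    {ρ : Code D → Code D → ℝ} (hρ : IsTreeMetric ρ)
    (hlim : ∀ x y, Tendsto (fun n => ρn n x y) atTop (𝓝 (ρ x y))) {c : ℝ} (hc0 : 0 < c)
    (hc : Tendsto cn atTop (𝓝 c)) {Y : MTree D} (hY : IsLabelled Y ρ c) :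
    ∃ φ : ℕ → ℕ, StrictMono φ ∧ StrongLimit (fun n => X (φ n)) Y := by
  choose Nn ιn lamn hι hX using hX
  obtain ⟨N', ι, lam, hι', hY⟩ := hY
  obtain ⟨φ, N, η, hφ, h⟩ := exists_convergentLabels hρn hι hρ hlim
  have hc' := hc.comp hφ.tendsto_atTop
  have hX' : ∀ n, Labelling (X (φ n)) (ρn (φ n)) ((cn ∘ φ) n) (Nn (φ n)) (ιn (φ n)) (lamn (φ n)) :=
    fun n => hX (φ n)
  exact ⟨φ, hφ, h.convergesStrongly hX' hc' hc0, _, _, h.isSimplicialLimit hX' hc',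
    h.isCollapse hι' hY⟩

/-! ### Isomorphisms of tree metrics -/

/-- `Θ` identifies the tree metric `ρ'` with `ρ`: it induces an isometry with dense image between
the ends of the two trees, conjugating the dynamics. -/
structure IsIsom (ρ' ρ : Code D → Code D → ℝ) (Θ : Code D → Code D) : Prop where
  isometry : ∀ x y, ρ (Θ x) (Θ y) = ρ' x y
  shift : ∀ x, ρ (shift (Θ x)) (Θ (shift x)) = 0
  dense : ∀ y, ∀ ε > 0, ∃ x, ρ (Θ x) y ≤ ε

namespace IsIsom

variable {ρ ρ' : Code D → Code D → ℝ} {Θ : Code D → Code D}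

lemma isValue_iff (hρ : IsTreeMetric ρ) (h : IsIsom ρ' ρ Θ) (s : ℝ) :
    IsTreeMetric.IsValue ρ' s ↔ IsTreeMetric.IsValue ρ s := by
  constructor
  · rintro ⟨hs, x, y, rfl⟩
    exact ⟨hs, Θ x, Θ y, h.isometry x y⟩
  · rintro ⟨hs, x, y, rfl⟩
    obtain ⟨x', hx⟩ := h.dense x (ρ x y / 2) (half_pos hs)
    obtain ⟨y', hy⟩ := h.dense y (ρ x y / 2) (half_pos hs)
    refine ⟨hs, x', y', ?_⟩
    rw [← h.isometry]
    exact hρ.eq_of_close ((hρ.symm_le hx).trans_lt (half_lt_self hs))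
      ((hρ.symm_le hy).trans_lt (half_lt_self hs))

lemma isEnum (hρ : IsTreeMetric ρ) (h : IsIsom ρ' ρ Θ) {N : ℕ} {ι : ℤ → ℝ} (hι : IsEnum ρ N ι) :
    IsEnum ρ' N ι := by
  have h1 : ∀ s, IsTreeMetric.IsHeight ρ' s ↔ IsTreeMetric.IsHeight ρ s := fun s => by
    simp only [IsTreeMetric.IsHeight, h.isValue_iff hρ]
  exact ⟨hι.one_le, hι.strictMono, hι.zero, hι.add, fun s hs => hι.exists_eq s ((h1 s).1 hs),
    fun i => (h1 _).2 (hι.isHeight i)⟩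

lemma labelling (hρ : IsTreeMetric ρ) (h : IsIsom ρ' ρ Θ) {N : ℕ} {ι : ℤ → ℝ} (hι : IsEnum ρ N ι)
    {X : MTree D} {c : ℝ} {lam : ℤ → Code D → X.V} (hX : Labelling X ρ c N ι lam) :
    Labelling X ρ' c N ι fun i x => lam i (Θ x) where
  surj v := by
    obtain ⟨i, y, rfl⟩ := hX.surj v
    obtain ⟨x, hx⟩ := h.dense y (ι i) (hι.pos hρ i)
    exact ⟨i, x, (hX.eq_iff _ _ _ _).2 ⟨rfl, hx⟩⟩
  top i x y hi := by
    rw [← h.isometry]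
    exact hX.top i _ _ hi
  eq_iff i j x y := by rw [hX.eq_iff, h.isometry]
  adj_iff i j x y := by rw [hX.adj_iff, h.isometry]
  dyn i x := by
    rw [hX.dyn, hX.eq_iff, h.shift]
    exact ⟨rfl, (hι.pos hρ _).le⟩
  height i x := hX.height i _
  N_eq := hX.N_eq
  dist i j x y := by rw [hX.dist, h.isometry]

lemma isLabelled (hρ : IsTreeMetric ρ) (h : IsIsom ρ' ρ Θ) {X : MTree D} {c : ℝ}
    (hX : IsLabelled X ρ c) : IsLabelled X ρ' c := by
  obtain ⟨N, ι, lam, hι, hX⟩ := hX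
  exact ⟨N, ι, _, h.isEnum hρ hι, h.labelling hρ hι hX⟩

end IsIsom

/-! ### Distances in labelled trees -/

lemma MTree.d_nonneg (X : MTree D) (v w : X.V) : 0 ≤ X.d v w := by
  have h1 := X.heightMetric.triangle v w v
  rw [X.heightMetric.self, X.heightMetric.symm w v] at h1
  linarith

lemma MTree.abs_d_sub_le (X : MTree D) (u v w : X.V) : |X.d u v - X.d u w| ≤ X.d v w := by
  have h1 := X.heightMetric.triangle u v w
  have h2 := X.heightMetric.triangle u w v
  rw [X.heightMetric.symm w v] at h2
  rw [abs_le]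
  constructor <;> linarith

namespace Labelling

variable {X : MTree D} {ρ : Code D → Code D → ℝ} {c : ℝ} {N : ℕ} {ι : ℤ → ℝ}
    {lam : ℤ → Code D → X.V}

lemma scale_pos (hρ : IsTreeMetric ρ) (hι : IsEnum ρ N ι) (hX : Labelling X ρ c N ι lam) :
    0 < c := by
  obtain ⟨o, -⟩ := hρ.exists_one
  have h1 := X.d_nonneg (lam 0 o) (lam 1 o)
  have h2 : X.d (lam 0 o) (lam 1 o) ≠ 0 := fun h => by
    have := ((hX.eq_iff _ _ _ _).1 (X.heightMetric.eq_of_zero _ _ h)).1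
    omega
  have h3 : ι 0 < ι 1 := hι.strictMono one_pos
  rw [hX.dist, hρ.refl, max_eq_right h3.le, max_eq_left (hι.pos hρ 1).le] at h1 h2
  have h4 : 0 < c * (2 * ι 1 - ι 0 - ι 1) := lt_of_le_of_ne h1 (Ne.symm h2)
  exact pos_of_mul_pos_left h4 (by linarith)

/-- The distance formula in terms of the heights `c * ι i`. -/
lemma dist_eq (hρ : IsTreeMetric ρ) (hι : IsEnum ρ N ι) (hX : Labelling X ρ c N ι lam) (i j : ℤ)
    (x y : Code D) : X.d (lam i x) (lam j y) =
      2 * max (max (c * ι i) (c * ι j)) (c * ρ x y) - c * ι i - c * ι j := by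
  have hc := (hX.scale_pos hρ hι).le
  rw [hX.dist, ← mul_max_of_nonneg _ _ hc, ← mul_max_of_nonneg _ _ hc]
  ring

lemma map_iterate (hX : Labelling X ρ c N ι lam) (m : ℕ) (i : ℤ) (x : Code D) :
    X.F^[m] (lam i x) = lam (i + m * N) (Code.shift^[m] x) := by
  induction m with
  | zero => simp
  | succ m ih =>
    rw [Function.iterate_succ_apply', ih, hX.dyn, Function.iterate_succ_apply']
    congr 1
    push_cast
    ring

lemma d_map_le (hρ : IsTreeMetric ρ) (hι : IsEnum ρ N ι) (hX : Labelling X ρ c N ι lam)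
    (v w : X.V) : X.d (X.F v) (X.F w) ≤ D * X.d v w := by
  obtain ⟨i, x, rfl⟩ := hX.surj v
  obtain ⟨j, y, rfl⟩ := hX.surj w
  have hc := (hX.scale_pos hρ hι).le
  rw [hX.dyn, hX.dyn, hX.dist, hX.dist, hι.add, hι.add, mul_left_comm]
  refine mul_le_mul_of_nonneg_left ?_ hc
  have h1 : max (max (D * ι i) (D * ι j)) (ρ (Code.shift x) (Code.shift y)) ≤
      D * max (max (ι i) (ι j)) (ρ x y) := by
    have hD := hρ.pos'.le
    rw [mul_max_of_nonneg _ _ hD, mul_max_of_nonneg _ _ hD]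
    exact max_le_max le_rfl (hρ.shift x y)
  linarith

end Labelling

/-! ### Maps witnessing a simplicial limit -/

/-- The levels of the simplicial limit exhaust it. -/
lemma IsSimplicialLimit.one_le_N {X : ℕ → MTree D} {T' : TreeMap} {k n N : ℕ}
    {R : ℤ → Code D → Code D → Prop} {lam : ℤ → Code D → (X n).V} (x : Code D)
    (hX : CombLab (X n).toTreeMap N R lam) (hN : 1 ≤ N) (hk : 0 < k)
    (φ : TreeMap.LevelIso T' (X n).toTreeMap k) : 1 ≤ T'.N := by
  by_contra hcon
  have hsub : ∀ v : T'.level k, v.1 = T'.base := by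
    intro v
    obtain ⟨h1, h2⟩ := v.2
    have h3 : (k : ℤ) * T'.N ≤ 0 := mul_nonpos_of_nonneg_of_nonpos (by positivity) (by omega)
    have h4 : T'.height v.1 = 0 := by omega
    unfold TreeMap.height at h4
    have h5 : T'.G.dist T'.base v.1 = 0 := by
      split_ifs at h4 <;> omega
    exact ((T'.isTree.connected.dist_eq_zero_iff).1 h5).symm
  have hkN : (1 : ℤ) * N ≤ k * N := by
    gcongr
    exact_mod_cast hk
  have h1 : lam 0 x ∈ (X n).level k := hX.mem_level.2 ⟨by omega, by omega⟩
  have h2 : lam N x ∈ (X n).level k := hX.mem_level.2 ⟨by omega, by omega⟩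
  have h3 : φ.iso.symm ⟨_, h1⟩ = φ.iso.symm ⟨_, h2⟩ :=
    Subtype.ext ((hsub _).trans (hsub _).symm)
  have h4 := congrArg Subtype.val (φ.iso.symm.injective h3)
  have h5 : (0 : ℤ) = N := ((hX.eq_iff _ _ _ _).1 h4).1
  omega

/-- Vertices at bounded distance from the base. -/
def TreeMap.around (T : TreeMap) : ℕ → Set T.V
  | 0 => {T.base}
  | m + 1 => ⋃ v ∈ T.around m, T.G.neighborSet v

lemma TreeMap.finite_around (T : TreeMap) (m : ℕ) : (T.around m).Finite := by
  induction m with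
  | zero => exact Set.finite_singleton _
  | succ m ih => exact ih.biUnion fun v _ => T.locallyFinite v

/-- The level isomorphisms of a simplicial limit can be chosen diagonally, as a single sequence of
maps. -/
lemma IsSimplicialLimit.exists_maps {X : ℕ → MTree D} {ρn : ℕ → Code D → Code D → ℝ} {cn : ℕ → ℝ}
    {Nn : ℕ → ℕ} {ιn : ℕ → ℤ → ℝ} {lamn : ∀ n, ℤ → Code D → (X n).V} (o : Code D)
    (hX : ∀ n, Labelling (X n) (ρn n) (cn n) (Nn n) (ιn n) (lamn n)) (hN : ∀ n, 1 ≤ Nn n)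
    {T' : TreeMap} {d' : T'.V → T'.V → ℝ} (hS : IsSimplicialLimit X T' d') :
    ∃ φ : ∀ n, T'.V → (X n).V,
      (∀ v w, Tendsto (fun n => (X n).d (φ n v) (φ n w)) atTop (𝓝 (d' v w))) ∧
      (∀ v, ∀ᶠ n in atTop, φ n (T'.F v) = (X n).F (φ n v)) ∧
      ∀ m : ℕ, ∃ S : Set T'.V, S.Finite ∧ ∀ᶠ n in atTop, ∀ y, ∃ v ∈ S, φ n v = lamn n (-m) y := by
  classical
  let Q : ℕ → ℕ → Prop := fun k n => ∃ φ : TreeMap.LevelIso T' (X n).toTreeMap k,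
    ∀ x y, |(X n).d (φ.iso x).1 (φ.iso y).1 - d' x.1 y.1| ≤ 1 / k
  let κ : ℕ → ℕ := fun n => Nat.findGreatest (fun k => 0 < k ∧ Q k n) n
  have hκ : ∀ K : ℕ, ∀ᶠ n in atTop, K < κ n := by
    intro K
    filter_upwards [hS.2 (K + 1) K.succ_pos (1 / (K + 1 : ℕ)) (by positivity),
      eventually_ge_atTop (K + 1)] with n hn hK
    exact Nat.le_findGreatest (P := fun k => 0 < k ∧ Q k n) hK ⟨K.succ_pos, hn⟩
  have hQ : ∀ n, 0 < κ n → Q (κ n) n := fun n hn =>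
    (Nat.findGreatest_of_ne_zero (P := fun k => 0 < k ∧ Q k n) (n := n) rfl hn.ne').2
  choose ψ hψ using hQ
  let φ : ∀ n, T'.V → (X n).V := fun n v =>
    if h : 0 < κ n ∧ v ∈ T'.level (κ n) then ((ψ n h.1).iso ⟨v, h.2⟩).1 else (X n).base
  have hφ : ∀ n v (h1 : 0 < κ n) (h2 : v ∈ T'.level (κ n)),
      φ n v = ((ψ n h1).iso ⟨v, h2⟩).1 := fun n v h1 h2 => dif_pos ⟨h1, h2⟩
  have hT : 1 ≤ T'.N := by
    obtain ⟨n, hn⟩ := (hκ 0).exists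
    exact IsSimplicialLimit.one_le_N o (hX n).toCombLab (hN n) hn (ψ n hn)
  have hmem : ∀ v : T'.V, ∀ᶠ n in atTop, 0 < κ n ∧ v ∈ T'.level (κ n) := by
    intro v
    filter_upwards [hκ (T'.height v).natAbs] with n hn
    have h1 : (κ n : ℤ) * 1 ≤ κ n * T'.N := by gcongr
    refine ⟨by omega, ?_, ?_⟩ <;> omega
  refine ⟨φ, ?_, ?_, ?_⟩
  · intro v w
    rw [Metric.tendsto_nhds]
    intro ε hε
    obtain ⟨K, hK⟩ := exists_nat_gt (1 / ε)
    filter_upwards [hmem v, hmem w, hκ K] with n hv hw hn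
    rw [hφ n v hv.1 hv.2, hφ n w hw.1 hw.2, Real.dist_eq]
    refine (hψ n hv.1 _ _).trans_lt ?_
    have h1 : (K : ℝ) < κ n := by exact_mod_cast hn
    rw [div_lt_iff₀ (by exact_mod_cast hv.1)]
    rw [div_lt_iff₀ hε] at hK
    nlinarith
  · intro v
    filter_upwards [hmem v, hmem (T'.F v)] with n hv hw
    rw [hφ n v hv.1 hv.2, hφ n _ hw.1 hw.2]
    exact (((ψ n hv.1).map_dyn ⟨v, hv.2⟩ ⟨T'.F v, hw.2⟩).1 rfl).symm
  · intro m
    refine ⟨T'.around m, T'.finite_around m, ?_⟩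
    filter_upwards [hκ m] with n hn y
    have h0 : 0 < κ n := by omega
    have hlev : ∀ l ≤ m, lamn n (-l) y ∈ (X n).level (κ n) := by
      intro l hl
      have h1 : (κ n : ℤ) * 1 ≤ κ n * Nn n := by
        gcongr
        exact_mod_cast hN n
      exact (hX n).mem_level.2 ⟨by omega, by omega⟩
    have key : ∀ l (hl : l ≤ m), ((ψ n h0).iso.symm ⟨_, hlev l hl⟩).1 ∈ T'.around l := by
      intro l
      induction l with
      | zero =>
        intro hl
        rw [TreeMap.around, Set.mem_singleton_iff, (ψ n h0).map_base, RelIso.apply_symm_apply,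
          (hX n).base_eq y]
        simp
      | succ l ih =>
        intro hl
        rw [TreeMap.around]
        refine Set.mem_biUnion (ih (by omega)) ?_
        have h1 : (X n).G.Adj (lamn n (-l) y) (lamn n (-(l + 1 : ℕ)) y) := by
          refine ((hX n).adj_iff _ _ _ _).2 (Or.inr ⟨by push_cast; ring, ?_⟩)
          exact ((hX n).eq_iff _ _ _ _).1 (rfl : lamn n (-l) y = lamn n (-l) y) |>.2
        exact (ψ n h0).iso.symm.map_rel_iff.2 h1
    refine ⟨_, key m le_rfl, ?_⟩
    rw [hφ n _ h0 (Subtype.property _)]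
    simp

/-- Almost isometric maps from a fixed tree `Y` to the trees `X n`, almost conjugating the
dynamics, and with almost dense image. -/
structure ApproxMaps (X : ℕ → MTree D) (lamn : ∀ n, ℤ → Code D → (X n).V) (Y : MTree D)
    (ψ : ∀ n, Y.V → (X n).V) : Prop where
  dist : ∀ u w, Tendsto (fun n => (X n).d (ψ n u) (ψ n w)) atTop (𝓝 (Y.d u w))
  dyn : ∀ u, Tendsto (fun n => (X n).d (ψ n (Y.F u)) ((X n).F (ψ n u))) atTop (𝓝 0)
  onto : ∀ (m : ℕ) y, ∃ u w, Tendsto (fun n => (X n).d (ψ n u) (lamn n (-m) y) +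
    (X n).d (lamn n (-m) y) (ψ n w) - (X n).d (ψ n u) (ψ n w)) (hyperfilter ℕ) (𝓝 0)

lemma exists_approxMaps {X : ℕ → MTree D} {ρn : ℕ → Code D → Code D → ℝ} {cn : ℕ → ℝ}
    {Nn : ℕ → ℕ} {ιn : ℕ → ℤ → ℝ} {lamn : ∀ n, ℤ → Code D → (X n).V} (o : Code D)
    (hX : ∀ n, Labelling (X n) (ρn n) (cn n) (Nn n) (ιn n) (lamn n)) (hN : ∀ n, 1 ≤ Nn n)
    {T' : TreeMap} {d' : T'.V → T'.V → ℝ} (hS : IsSimplicialLimit X T' d') {Y : MTree D}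
    (hC : IsCollapse T' d' Y) : ∃ ψ, ApproxMaps X lamn Y ψ := by
  obtain ⟨φ, h1, h2, h3⟩ := hS.exists_maps o hX hN
  obtain ⟨j, hj, hjF, hj'⟩ := hC
  refine ⟨fun n u => φ n (j u), fun u w => hj u w ▸ h1 _ _, fun u => ?_, fun m y => ?_⟩
  · have := h1 (j (Y.F u)) (T'.F (j u))
    rw [hjF] at this
    refine this.congr' ((h2 (j u)).mono fun n hn => ?_)
    rw [hn]
  · obtain ⟨S, hS, hev⟩ := h3 m
    have h4 : ∀ᶠ n in (hyperfilter ℕ : Filter ℕ), ∃ v ∈ S, φ n v = lamn n (-m) y :=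
      (hev.filter_mono Nat.hyperfilter_le_atTop).mono fun n hn => hn y
    obtain ⟨v, -, hv⟩ := (Ultrafilter.eventually_exists_mem_iff hS).1 h4
    obtain ⟨u, w, huw⟩ := hj' v
    refine ⟨u, w, ?_⟩
    have h5 := ((h1 (j u) v).add (h1 v (j w))).sub (h1 (j u) (j w))
    rw [huw, sub_self] at h5
    refine (h5.mono_left Nat.hyperfilter_le_atTop).congr' (hv.mono fun n hn => ?_)
    rw [hn]

/-! ### The labels of a strong limit -/

/-- Tree metrics converge continuously: the words may vary along with the metrics. -/
lemma tendsto_metric_of_tendsto {α : Type*} {l : Filter α} {f : α → Code D → Code D → ℝ}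
    {ρ : Code D → Code D → ℝ} (hf : ∀ n, IsTreeMetric (f n)) (hρ : IsTreeMetric ρ)
    (h : ∀ x y, Tendsto (fun n => f n x y) l (𝓝 (ρ x y))) {x y : α → Code D} {a b : Code D}
    (hx : Tendsto x l (𝓝 a)) (hy : Tendsto y l (𝓝 b)) :
    Tendsto (fun n => f n (x n) (y n)) l (𝓝 (ρ a b)) := by
  have hagree : ∀ {z : α → Code D} {c : Code D}, Tendsto z l (𝓝 c) → ∀ k : ℕ,
      ∀ᶠ n in l, ∀ i < k, c i = z n i := by
    intro z c hz k
    refine (eventually_all_finite (Set.finite_lt_nat k)).2 fun i _ => ?_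
    have := tendsto_pi_nhds.1 hz i
    rw [nhds_discrete, tendsto_pure] at this
    exact this.mono fun n hn => hn.symm
  rw [Metric.tendsto_nhds]
  intro ε hε
  obtain ⟨k, hk⟩ := hρ.exists_pow_lt (half_pos hε)
  filter_upwards [hagree hx k, hagree hy k, Metric.tendsto_nhds.1 (h a b) (ε / 2) (half_pos hε)]
    with n h1 h2 h3
  have h4 := (hf n).abs_sub_le ((hf n).le_of_agree k h1) ((hf n).le_of_agree k h2)
  rw [Real.dist_eq] at h3 ⊢
  have h5 := abs_sub_le (f n (x n) (y n)) (f n a b) (ρ a b)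
  linarith

lemma continuous_shift : Continuous (Code.shift : Code D → Code D) :=
  continuous_pi fun n => continuous_apply (n + 1)

lemma exists_tendsto_code {α : Type*} (𝒰 : Ultrafilter α) (z : α → Code D) :
    ∃ a, Tendsto z 𝒰 (𝓝 a) := by
  obtain ⟨a, -, ha⟩ := isCompact_univ.ultrafilter_le_nhds (𝒰.map z) (by simp)
  exact ⟨a, ha⟩

/-- The data of a sequence of labelled trees with convergent labels, and almost isometric maps from
a labelled tree `Y` to them. -/
structure LimitSetup (X : ℕ → MTree D) (ρn : ℕ → Code D → Code D → ℝ) (cn : ℕ → ℝ) (Nn : ℕ → ℕ)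
    (ιn : ℕ → ℤ → ℝ) (lamn : ∀ n, ℤ → Code D → (X n).V) (ρ : Code D → Code D → ℝ) (c : ℝ)
    (Y : MTree D) (ρY : Code D → Code D → ℝ) (cY : ℝ) (NY : ℕ) (ιY : ℤ → ℝ)
    (lamY : ℤ → Code D → Y.V) (ψ : ∀ n, Y.V → (X n).V) : Prop where
  metric : ∀ n, IsTreeMetric (ρn n)
  isEnum : ∀ n, IsEnum (ρn n) (Nn n) (ιn n)
  labelling : ∀ n, Labelling (X n) (ρn n) (cn n) (Nn n) (ιn n) (lamn n)
  limit : IsTreeMetric ρ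
  tendsto_metric : ∀ x y, Tendsto (fun n => ρn n x y) atTop (𝓝 (ρ x y))
  tendsto_scale : Tendsto cn atTop (𝓝 c)
  scale_pos : 0 < c
  metricY : IsTreeMetric ρY
  isEnumY : IsEnum ρY NY ιY
  labellingY : Labelling Y ρY cY NY ιY lamY
  maps : ApproxMaps X lamn Y ψ

namespace LimitSetup

variable {X : ℕ → MTree D} {ρn : ℕ → Code D → Code D → ℝ} {cn : ℕ → ℝ} {Nn : ℕ → ℕ}
    {ιn : ℕ → ℤ → ℝ} {lamn : ∀ n, ℤ → Code D → (X n).V} {ρ : Code D → Code D → ℝ} {c : ℝ}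
    {Y : MTree D} {ρY : Code D → Code D → ℝ} {cY : ℝ} {NY : ℕ} {ιY : ℤ → ℝ}
    {lamY : ℤ → Code D → Y.V} {ψ : ∀ n, Y.V → (X n).V}

lemma tendsto_dist_iterate (h : LimitSetup X ρn cn Nn ιn lamn ρ c Y ρY cY NY ιY lamY ψ) (m : ℕ)
    (u : Y.V) :
    Tendsto (fun n => (X n).d (ψ n (Y.F^[m] u)) ((X n).F^[m] (ψ n u))) atTop (𝓝 0) := by
  induction m with
  | zero => simpa only [Function.iterate_zero, id, (X _).heightMetric.self] using tendsto_const_nhds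
  | succ m ih =>
    simp only [Function.iterate_succ_apply']
    have h1 := (h.maps.dyn (Y.F^[m] u)).add (ih.const_mul (D : ℝ))
    rw [mul_zero, add_zero] at h1
    refine squeeze_zero (fun n => (X n).d_nonneg _ _) (fun n => ?_) h1
    refine ((X n).heightMetric.triangle _ ((X n).F (ψ n (Y.F^[m] u))) _).trans ?_
    gcongr
    exact (h.labelling n).d_map_le (h.metric n) (h.isEnum n) _ _

lemma scaleY_pos (h : LimitSetup X ρn cn Nn ιn lamn ρ c Y ρY cY NY ιY lamY ψ) : 0 < cY :=
  h.labellingY.scale_pos h.metricY h.isEnumY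

lemma heightY_pos (h : LimitSetup X ρn cn Nn ιn lamn ρ c Y ρY cY NY ιY lamY ψ) (i : ℤ) :
    0 < cY * ιY i :=
  mul_pos h.scaleY_pos (h.isEnumY.pos h.metricY i)

/-- Heights converge: the height of a vertex `v` is determined by the distances from `v` to its
forward orbit. -/
lemma tendsto_height (h : LimitSetup X ρn cn Nn ιn lamn ρ c Y ρY cY NY ιY lamY ψ) {i : ℤ}
    {x : Code D} {a : ℕ → ℤ} {z : ℕ → Code D} (haz : ∀ n, lamn n (a n) (z n) = ψ n (lamY i x)) :
    Tendsto (fun n => cn n * ιn n (a n)) atTop (𝓝 (cY * ιY i)) := by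
  have hH := h.heightY_pos i
  -- far out in the orbit the distance exceeds `2 * c`, and there it is a multiple of the height
  obtain ⟨m, hm⟩ := pow_unbounded_of_one_lt ((2 * c + 1 + cY) / (cY * ιY i) + 1) h.limit.one_lt'
  have hm1 : (2 * c + 1 + cY) < ((D : ℝ) ^ m - 1) * (cY * ιY i) := by
    rw [← div_lt_iff₀ hH]
    linarith
  have hM : (1 : ℝ) < D ^ m := by
    have := h.scale_pos
    have := h.scaleY_pos
    have h1 : (0 : ℝ) ≤ (2 * c + 1 + cY) / (cY * ιY i) := by positivity
    linarith
  have hY : Y.d (lamY i x) (Y.F^[m] (lamY i x)) = (D ^ m - 1) * (cY * ιY i) := by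
    have h1 : ιY (i + m * NY) = D ^ m * ιY i := by
      have := h.isEnumY.add_mul h.metricY i m
      rwa [zpow_natCast] at this
    rw [h.labellingY.map_iterate, h.labellingY.dist_eq h.metricY h.isEnumY, h1]
    have h2 : cY * ρY x (Code.shift^[m] x) ≤ cY := by
      have := mul_le_mul_of_nonneg_left (h.metricY.le_one x (Code.shift^[m] x)) h.scaleY_pos.le
      rwa [mul_one] at this
    have h3 : cY * ιY i ≤ cY * (D ^ m * ιY i) := by nlinarith
    have h4 := h.scale_pos
    rw [max_eq_right h3, max_eq_left (by nlinarith)]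
    ring
  have h1 : Tendsto (fun n => (X n).d (ψ n (lamY i x)) ((X n).F^[m] (ψ n (lamY i x)))) atTop
      (𝓝 ((D ^ m - 1) * (cY * ιY i))) := by
    rw [← hY]
    have h2 := h.maps.dist (lamY i x) (Y.F^[m] (lamY i x))
    refine (h2.congr_dist (squeeze_zero (fun _ => dist_nonneg) (fun n => ?_)
      (h.tendsto_dist_iterate m (lamY i x))))
    rw [Real.dist_eq]
    exact (X n).abs_d_sub_le _ _ _
  have h2 : ∀ᶠ n in atTop, ((D : ℝ) ^ m - 1)⁻¹ *
      (X n).d (ψ n (lamY i x)) ((X n).F^[m] (ψ n (lamY i x))) = cn n * ιn n (a n) := by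
    have h3 : 2 * c < (D ^ m - 1) * (cY * ιY i) := by
      have := h.scaleY_pos
      linarith
    filter_upwards [(h.tendsto_scale.const_mul 2).eventually_lt h1 h3] with n hn
    rw [inv_mul_eq_iff_eq_mul₀ (by linarith)]
    have hc := (h.labelling n).scale_pos (h.metric n) (h.isEnum n)
    have hp := mul_pos hc ((h.isEnum n).pos (h.metric n) (a n))
    have e : ιn n (a n + m * Nn n) = D ^ m * ιn n (a n) := by
      have := (h.isEnum n).add_mul (h.metric n) (a n) m
      rwa [zpow_natCast] at this
    rw [← haz, (h.labelling n).map_iterate,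
      (h.labelling n).dist_eq (h.metric n) (h.isEnum n), e] at hn ⊢
    have h4 : cn n * ιn n (a n) ≤ cn n * (D ^ m * ιn n (a n)) := by nlinarith
    rw [max_eq_right h4] at hn ⊢
    rcases le_total (cn n * ρn n (z n) (Code.shift^[m] (z n))) (cn n * (D ^ m * ιn n (a n)))
      with h5 | h5
    · rw [max_eq_left h5]
      ring
    · rw [max_eq_right h5] at hn
      have := mul_le_mul_of_nonneg_left ((h.metric n).le_one (z n) (Code.shift^[m] (z n))) hc.le
      exfalso
      nlinarith
  have h3 := h1.const_mul (((D : ℝ) ^ m - 1)⁻¹)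
  rw [← mul_assoc, inv_mul_cancel₀ (by linarith), one_mul] at h3
  exact h3.congr' h2

lemma le_or_le_of_add_eq {a b a' p q r : ℝ} (hr : r ≤ max p q)
    (h : max (max a b) p + max (max b a') q = b + max (max a a') r) :
    max a p ≤ b ∨ max a' q ≤ b := by
  by_contra hcon
  push Not at hcon
  obtain ⟨h1, h2⟩ := hcon
  have h3 : max a p ≤ max (max a b) p := max_le_max (le_max_left _ _) le_rfl
  have h4 : max a' q ≤ max (max b a') q := max_le_max (le_max_right _ _) le_rfl
  have h5 : max (max a a') r ≤ max (max a p) (max a' q) := by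
    refine max_le (max_le ?_ ?_) (hr.trans (max_le_max (le_max_right _ _) (le_max_right _ _)))
    · exact (le_max_left _ _).trans (le_max_left _ _)
    · exact (le_max_left _ _).trans (le_max_right _ _)
  rcases max_choice (max a p) (max a' q) with h6 | h6 <;> rw [h6] at h5 <;> linarith

/-- The labels of the limiting tree agree with the limit of the labels, up to isomorphism. -/
theorem exists_isIsom (h : LimitSetup X ρn cn Nn ιn lamn ρ c Y ρY cY NY ιY lamY ψ) :
    cY = c ∧ ∃ Θ, IsIsom ρY ρ Θ := by
  have hρ := h.limit
  have hcY := h.scaleY_pos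
  have hc0 := h.scale_pos
  have htop : (hyperfilter ℕ : Filter ℕ) ≤ atTop := Nat.hyperfilter_le_atTop
  choose iY xY hY using h.labellingY.surj
  choose a z haz using fun n u => (h.labelling n).surj (ψ n u)
  -- ends `z n u` below the images of the vertex `u` of `Y` converge along a fixed ultrafilter
  choose Θ₀ hΘ₀ using fun u => exists_tendsto_code (hyperfilter ℕ) fun n => z n u
  have hself : ∀ i x, iY (lamY i x) = i ∧ ρY (xY (lamY i x)) x ≤ ιY i := fun i x => by
    have h1 := (h.labellingY.eq_iff _ _ _ _).1 (hY (lamY i x))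
    exact ⟨h1.1, h1.2.trans_eq (congrArg ιY h1.1)⟩
  have hH : ∀ u, Tendsto (fun n => cn n * ιn n (a n u)) (hyperfilter ℕ) (𝓝 (cY * ιY (iY u))) :=
    fun u => (h.tendsto_height (i := iY u) (x := xY u) (a := fun n => a n u) (z := fun n => z n u)
      fun n => by rw [hY, haz]).mono_left htop
  have hlim : ∀ {x y : ℕ → Code D} {p q : Code D}, Tendsto x (hyperfilter ℕ) (𝓝 p) →
      Tendsto y (hyperfilter ℕ) (𝓝 q) →
      Tendsto (fun n => cn n * ρn n (x n) (y n)) (hyperfilter ℕ) (𝓝 (c * ρ p q)) :=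
    fun hx hy => (h.tendsto_scale.mono_left htop).mul
      (tendsto_metric_of_tendsto h.metric hρ (fun x y => (h.tendsto_metric x y).mono_left htop) hx hy)
  -- heights of branch points are preserved, where visible from the two vertices
  have hmax : ∀ u w, max (max (cY * ιY (iY u)) (cY * ιY (iY w))) (c * ρ (Θ₀ u) (Θ₀ w)) =
      max (max (cY * ιY (iY u)) (cY * ιY (iY w))) (cY * ρY (xY u) (xY w)) := by
    intro u w
    have h1 : Tendsto (fun n => (X n).d (ψ n u) (ψ n w)) (hyperfilter ℕ) (𝓝 _) :=
      ((((((hH u).max (hH w)).max (hlim (hΘ₀ u) (hΘ₀ w))).const_mul 2).sub (hH u)).sub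
        (hH w)).congr fun n => by
          rw [← (h.labelling n).dist_eq (h.metric n) (h.isEnum n), haz, haz]
    have h2 := tendsto_nhds_unique h1 ((h.maps.dist u w).mono_left htop)
    rw [← hY u, ← hY w, h.labellingY.dist_eq h.metricY h.isEnumY, hY, hY] at h2
    linarith
  have hdyn : ∀ u, c * ρ (Θ₀ (Y.F u)) (Code.shift (Θ₀ u)) ≤ D * (cY * ιY (iY u)) := by
    intro u
    have h0 : iY (Y.F u) = iY u + NY := by
      have : Y.F u = lamY (iY u + NY) (Code.shift (xY u)) := by rw [← h.labellingY.dyn, hY]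
      rw [this, (hself _ _).1]
    have h3 : cY * ιY (iY (Y.F u)) = D * (cY * ιY (iY u)) := by
      rw [h0, h.isEnumY.add]
      ring
    have hs := (continuous_shift.tendsto _).comp (hΘ₀ u)
    have hHF := hH (Y.F u)
    rw [h3] at hHF
    have h1 : Tendsto (fun n => (X n).d (ψ n (Y.F u)) ((X n).F (ψ n u))) (hyperfilter ℕ) (𝓝 _) :=
      (((((hHF.max ((hH u).const_mul (D : ℝ))).max (hlim (hΘ₀ (Y.F u)) hs)).const_mul 2).sub
        hHF).sub ((hH u).const_mul (D : ℝ))).congr fun n => by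
          rw [← haz n u, ← haz n (Y.F u), (h.labelling n).dyn,
            (h.labelling n).dist_eq (h.metric n) (h.isEnum n), (h.isEnum n).add,
            mul_left_comm (cn n) (D : ℝ)]
          rfl
    have h2 := tendsto_nhds_unique h1 ((h.maps.dyn u).mono_left htop)
    have h4 := le_max_right (max (D * (cY * ιY (iY u))) (D * (cY * ιY (iY u))))
      (c * ρ (Θ₀ (Y.F u)) (Code.shift (Θ₀ u)))
    linarith
  -- the end `x` of `Y` is mapped to the limit of the images of the vertices above it
  choose Θ hΘ using fun x => exists_tendsto_code (hyperfilter ℕ) fun k : ℕ => Θ₀ (lamY (-k) x)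
  have hlim' : ∀ {x y : ℕ → Code D} {p q : Code D}, Tendsto x (hyperfilter ℕ) (𝓝 p) →
      Tendsto y (hyperfilter ℕ) (𝓝 q) →
      Tendsto (fun n => c * ρ (x n) (y n)) (hyperfilter ℕ) (𝓝 (c * ρ p q)) :=
    fun hx hy => (tendsto_metric_of_tendsto (fun _ => hρ) hρ (fun x y => tendsto_const_nhds)
      hx hy).const_mul c
  have hι0 : Tendsto (fun k : ℕ => ιY (-k)) atTop (𝓝 0) := by
    rw [Metric.tendsto_atTop]
    intro ε hε
    obtain ⟨b, hb⟩ := h.isEnumY.exists_lt h.metricY hε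
    refine ⟨b.natAbs, fun k hk => ?_⟩
    rw [Real.dist_eq, sub_zero, abs_of_pos (h.isEnumY.pos h.metricY _)]
    exact (h.isEnumY.strictMono.monotone (by omega)).trans_lt hb
  have hι0' : Tendsto (fun k : ℕ => cY * ιY (-k)) (hyperfilter ℕ) (𝓝 0) := by
    have := (hι0.mono_left htop).const_mul cY
    rwa [mul_zero] at this
  have hclose : ∀ i x, c * ρ (Θ₀ (lamY i x)) (Θ x) ≤ cY * ιY i := by
    intro i x
    refine le_of_tendsto (hlim' tendsto_const_nhds (hΘ x)) (htop ?_)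
    filter_upwards [eventually_ge_atTop i.natAbs] with k hk
    have h1 := hmax (lamY i x) (lamY (-k) x)
    rw [(hself i x).1, (hself (-k) x).1] at h1
    have h2 : ιY (-k) ≤ ιY i := h.isEnumY.strictMono.monotone (by omega)
    have h3 : ρY (xY (lamY i x)) (xY (lamY (-k) x)) ≤ ιY i :=
      h.metricY.ultra_le (hself i x).2 ((h.metricY.symm_le (hself _ x).2).trans h2)
    rw [max_eq_left (mul_le_mul_of_nonneg_left h2 hcY.le),
      max_eq_left (mul_le_mul_of_nonneg_left h3 hcY.le)] at h1
    exact (le_max_right _ _).trans h1.le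
  have hiso : ∀ x y, c * ρ (Θ x) (Θ y) = cY * ρY x y := by
    intro x y
    have h1 : Tendsto (fun k : ℕ => ρY (xY (lamY (-k) x)) (xY (lamY (-k) y))) atTop
        (𝓝 (ρY x y)) := by
      rw [tendsto_iff_dist_tendsto_zero]
      refine squeeze_zero (fun _ => dist_nonneg) (fun k => ?_) hι0
      rw [Real.dist_eq]
      exact h.metricY.abs_sub_le (h.metricY.symm_le (hself _ x).2) (h.metricY.symm_le (hself _ y).2)
    have h2 := (hι0'.max hι0').max (hlim' (hΘ x) (hΘ y))
    have h3 := (hι0'.max hι0').max ((h1.mono_left htop).const_mul cY)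
    have h4 := tendsto_nhds_unique (h2.congr fun k => by
      have := hmax (lamY (-k) x) (lamY (-k) y)
      rw [(hself _ x).1, (hself _ y).1] at this
      exact this) h3
    rw [max_self, max_eq_right (mul_nonneg hc0.le (hρ.nonneg _ _)),
      max_eq_right (mul_nonneg hcY.le (h.metricY.nonneg _ _))] at h4
    exact h4
  have hdense : ∀ y, ∀ ε > 0, ∃ x, ρ (Θ x) y ≤ ε := by
    intro y ε hε
    obtain ⟨k, hk⟩ := hρ.exists_pow_lt hε
    -- the point on the ray to `y` on level `-(D * k)` lies low, uniformly in `n`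
    have hlow : ∀ n, ιn n (-((D * k : ℕ) : ℤ)) ∈ Set.Icc 0 (((D : ℝ)⁻¹) ^ k) := by
      intro n
      refine ⟨((h.isEnum n).pos (h.metric n) _).le, ?_⟩
      have h1 := (h.isEnum n).mul_eq (h.metric n) (-k)
      rw [zpow_neg, zpow_natCast, ← inv_pow] at h1
      rw [← h1]
      refine (h.isEnum n).strictMono.monotone ?_
      have h2 : (k : ℤ) * Nn n ≤ k * D := by
        gcongr
        exact ((h.isEnum n).lt (h.metric n)).le
      push_cast
      linarith
    obtain ⟨b, hb, hblim⟩ := isCompact_Icc.ultrafilter_le_nhds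
      ((hyperfilter ℕ).map fun n => ιn n (-((D * k : ℕ) : ℤ)))
      (le_principal_iff.2 (mem_map.2 (univ_mem' hlow)))
    have hblim' : Tendsto (fun n => cn n * ιn n (-((D * k : ℕ) : ℤ))) (hyperfilter ℕ) (𝓝 (c * b)) :=
      (h.tendsto_scale.mono_left htop).mul hblim
    obtain ⟨u, w, huw⟩ := h.maps.onto (D * k) y
    have hy : Tendsto (fun _ : ℕ => y) (hyperfilter ℕ) (𝓝 y) := tendsto_const_nhds
    have d1 : Tendsto (fun n => (X n).d (ψ n u) (lamn n (-((D * k : ℕ) : ℤ)) y)) (hyperfilter ℕ)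
        (𝓝 _) := ((((((hH u).max hblim').max (hlim (hΘ₀ u) hy)).const_mul 2).sub (hH u)).sub
          hblim').congr fun n => by
            rw [← haz n u, (h.labelling n).dist_eq (h.metric n) (h.isEnum n)]
    have d2 : Tendsto (fun n => (X n).d (lamn n (-((D * k : ℕ) : ℤ)) y) (ψ n w)) (hyperfilter ℕ)
        (𝓝 _) := ((((((hblim').max (hH w)).max (hlim hy (hΘ₀ w))).const_mul 2).sub hblim').sub
          (hH w)).congr fun n => by
            rw [← haz n w, (h.labelling n).dist_eq (h.metric n) (h.isEnum n)]
    have d3 : Tendsto (fun n => (X n).d (ψ n u) (ψ n w)) (hyperfilter ℕ) (𝓝 _) :=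
      ((((((hH u).max (hH w)).max (hlim (hΘ₀ u) (hΘ₀ w))).const_mul 2).sub (hH u)).sub
        (hH w)).congr fun n => by
          rw [← (h.labelling n).dist_eq (h.metric n) (h.isEnum n), haz, haz]
    have h1 := tendsto_nhds_unique ((d1.add d2).sub d3) huw
    have h2 : c * ρ (Θ₀ u) (Θ₀ w) ≤ max (c * ρ (Θ₀ u) y) (c * ρ y (Θ₀ w)) := by
      rw [← mul_max_of_nonneg _ _ hc0.le]
      exact mul_le_mul_of_nonneg_left (hρ.ultra _ _ _) hc0.le
    have key : ∀ v, cY * ιY (iY v) ≤ c * b → c * ρ (Θ₀ v) y ≤ c * b → ∃ x, ρ (Θ x) y ≤ ε := by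
      intro v h3 h4
      refine ⟨xY v, (le_trans ?_ hb.2).trans hk.le⟩
      have h5 := hclose (iY v) (xY v)
      rw [hY] at h5
      exact hρ.ultra_le (hρ.symm_le (le_of_mul_le_mul_left (h5.trans h3) hc0))
        (le_of_mul_le_mul_left h4 hc0)
    -- the point lies on a segment from `u` to `w`, so it lies above one of the two
    rcases le_or_le_of_add_eq h2 (a := cY * ιY (iY u)) (b := c * b) (a' := cY * ιY (iY w))
      (by linarith) with h3 | h3
    · exact key u ((le_max_left _ _).trans h3) ((le_max_right _ _).trans h3)
    · refine key w ((le_max_left _ _).trans h3) ?_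
      rw [hρ.symm]
      exact (le_max_right _ _).trans h3
  -- the largest values of `ρ` and `ρY` are both `1`, and `c * ρ` agrees with `cY * ρY`
  have hcc : cY = c := by
    refine le_antisymm ?_ ?_
    · obtain ⟨x, y, hxy⟩ := h.metricY.exists_one
      have h1 := hiso x y
      rw [hxy, mul_one] at h1
      rw [← h1]
      exact mul_le_of_le_one_right hc0.le (hρ.le_one _ _)
    · obtain ⟨p, q, hpq⟩ := hρ.exists_one
      obtain ⟨x, hx⟩ := hdense p (1 / 2) one_half_pos
      obtain ⟨y, hy⟩ := hdense q (1 / 2) one_half_pos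
      have h1 := hiso x y
      rw [hρ.eq_of_close (x := p) (y := q) ((hρ.symm_le hx).trans_lt (by rw [hpq]; norm_num))
        ((hρ.symm_le hy).trans_lt (by rw [hpq]; norm_num)), hpq, mul_one] at h1
      rw [h1]
      exact mul_le_of_le_one_right hcY.le (h.metricY.le_one _ _)
  subst hcc
  refine ⟨rfl, Θ, fun x y => mul_left_cancel₀ hcY.ne' (hiso x y), fun x => ?_, hdense⟩
  have h1 : ∀ᶠ k : ℕ in (hyperfilter ℕ : Filter ℕ),
      cY * ρ (Code.shift (Θ₀ (lamY (-k) x))) (Θ (Code.shift x)) ≤ D * (cY * ιY (-k)) := by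
    refine Eventually.of_forall fun k => ?_
    have h2 := hdyn (lamY (-k) x)
    rw [(hself _ _).1, h.labellingY.dyn] at h2
    have h3 := hclose (-k + NY) (Code.shift x)
    rw [h.isEnumY.add, mul_left_comm] at h3
    rw [← le_div_iff₀' hcY] at h2 h3 ⊢
    exact hρ.ultra_le (hρ.symm_le h2) h3
  have h2 := le_of_tendsto_of_tendsto
    (hlim' ((continuous_shift.tendsto _).comp (hΘ x)) tendsto_const_nhds) (hι0'.const_mul (D : ℝ)) h1
  rw [mul_zero] at h2
  exact le_antisymm (nonpos_of_mul_nonpos_right h2 hcY) (hρ.nonneg _ _)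

end LimitSetup

/-- The labels of a strong limit are the limit of the labels, up to isomorphism. -/
theorem exists_isIsom_of_limit {X : ℕ → MTree D} {ρn : ℕ → Code D → Code D → ℝ} {cn : ℕ → ℝ}
    (hρn : ∀ n, IsTreeMetric (ρn n)) (hX : ∀ n, IsLabelled (X n) (ρn n) (cn n))
    {ρ : Code D → Code D → ℝ} (hρ : IsTreeMetric ρ)
    (hlim : ∀ x y, Tendsto (fun n => ρn n x y) atTop (𝓝 (ρ x y))) {c : ℝ} (hc0 : 0 < c)
    (hc : Tendsto cn atTop (𝓝 c)) {Y : MTree D} {ρY : Code D → Code D → ℝ} {cY : ℝ}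
    (hρY : IsTreeMetric ρY) (hY : IsLabelled Y ρY cY) {T' : TreeMap} {d' : T'.V → T'.V → ℝ}
    (hS : IsSimplicialLimit X T' d') (hC : IsCollapse T' d' Y) : cY = c ∧ ∃ Θ, IsIsom ρY ρ Θ := by
  choose Nn ιn lamn hι hX using hX
  obtain ⟨NY, ιY, lamY, hιY, hY⟩ := hY
  obtain ⟨o, -⟩ := hρ.exists_one
  obtain ⟨ψ, hψ⟩ := exists_approxMaps o hX (fun n => (hι n).one_le) hS hC
  exact LimitSetup.exists_isIsom ⟨hρn, hι, hX, hρ, hlim, hc, hc0, hρY, hιY, hY, hψ⟩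

/-- The labels of a tree are unique up to isomorphism. -/
theorem MTree.Equivalent.exists_isIsom {X Y : MTree D} (h : MTree.Equivalent X Y)
    {ρ ρ' : Code D → Code D → ℝ} {c c' : ℝ} (hρ : IsTreeMetric ρ) (hX : IsLabelled X ρ c)
    (hρ' : IsTreeMetric ρ') (hY : IsLabelled Y ρ' c') : c' = c ∧ ∃ Θ, IsIsom ρ' ρ Θ := by
  have hc : 0 < c := by
    obtain ⟨N, ι, lam, hι, hX⟩ := hX
    exact hX.scale_pos hρ hι
  obtain ⟨i, hd, hF⟩ := h
  refine exists_isIsom_of_limit (X := fun _ => X) (fun _ => hρ) (fun _ => hX) hρ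
    (fun _ _ => tendsto_const_nhds) hc tendsto_const_nhds hρ' hY (T' := X.toTreeMap) (d' := X.d)
    ⟨X.polyLike.hasInfinity, fun k _ ε hε => Eventually.of_forall fun _ =>
      ⟨⟨RelIso.refl _, fun _ => Iff.rfl, fun _ _ => Iff.rfl⟩, fun x y => ?_⟩⟩
    ⟨i.symm, fun u w => ?_, fun u => ?_, fun x => ⟨i x, i x, ?_⟩⟩
  · simpa using hε.le
  · rw [← hd, i.apply_symm_apply, i.apply_symm_apply]
  · have : i.symm (Y.F u) = X.F (i.symm u) := by
      apply i.injective
      rw [hF, i.apply_symm_apply, i.apply_symm_apply]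
    rw [this, X.heightMetric.self]
  · rw [i.symm_apply_apply, X.heightMetric.self, add_zero]

/-! ### Orientation of a tree towards an end -/

section Ends

variable {V : Type} {G : SimpleGraph V}

lemma mem_of_closed (hG : G.Connected) {S : Set V} {v : V} (hv : v ∈ S)
    (hS : ∀ x ∈ S, ∀ y, G.Adj x y → y ∈ S) (w : V) : w ∈ S := by
  obtain ⟨q⟩ := hG.preconnected v w
  induction q with
  | nil => exact hv
  | cons hab _ ih => exact ih (hS _ hv _ hab)

lemma exists_walk_avoiding {e : G.end} {K : Finset V} {x y : V} (hx : x ∈ endComp e K)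
    (hy : y ∈ endComp e K) : ∃ q : G.Walk x y, ∀ z ∈ q.support, z ∉ K := by
  obtain ⟨hx1, hx'⟩ := hx
  obtain ⟨hy1, hy'⟩ := hy
  have hr : (G.induce ((K : Set V)ᶜ)).Reachable ⟨x, hx1⟩ ⟨y, hy1⟩ :=
    SimpleGraph.ConnectedComponent.eq.1 (hx'.trans hy'.symm)
  obtain ⟨q⟩ := hr
  refine ⟨q.map (SimpleGraph.Embedding.induce ((K : Set V)ᶜ)).toHom, fun z hz => ?_⟩
  obtain ⟨z', -, rfl⟩ := List.mem_map.1
    ((congrArg (z ∈ ·) (SimpleGraph.Walk.support_map _ q)).mp hz)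
  exact fun hk => z'.2 (Finset.mem_coe.2 hk)

/-- In a tree, every walk joining the endpoints of an edge passes along that edge. -/
lemma edge_mem_of_adj (hG : G.IsTree) {v w : V} (h : G.Adj v w) (q : G.Walk v w) :
    s(v, w) ∈ q.edges :=
  SimpleGraph.isBridge_iff_forall_walk_mem_edges.1
    (SimpleGraph.isAcyclic_iff_forall_adj_isBridge.1 hG.isAcyclic h) q

lemma exists_adj_mem_endComp (hG : G.IsTree) (e : G.end) (v : V) :
    ∃ w, G.Adj v w ∧ w ∈ endComp e {v} := by
  by_contra! hc
  obtain ⟨u, hu⟩ := (endComp_infinite e {v}).nonempty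
  have := mem_of_closed hG.connected hu (fun x hx y hxy => by
    refine mem_endComp_of_adj hx ?_ hxy
    rw [Finset.mem_singleton]
    rintro rfl
    exact hc x hxy.symm hx) v
  exact notMem_of_mem_endComp this (Finset.mem_singleton_self v)

lemma eq_of_mem_endComp (hG : G.IsTree) {e : G.end} {v w w' : V} (h : G.Adj v w)
    (hw : w ∈ endComp e {v}) (h' : G.Adj v w') (hw' : w' ∈ endComp e {v}) : w = w' := by
  by_contra hne
  obtain ⟨q, hq⟩ := exists_walk_avoiding hw' hw
  have h1 := edge_mem_of_adj hG h (SimpleGraph.Walk.cons h' q)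
  rw [SimpleGraph.Walk.edges_cons, List.mem_cons] at h1
  rcases h1 with h1 | h1
  · exact hne (Sym2.congr_right.1 h1)
  · exact hq v (SimpleGraph.Walk.fst_mem_support_of_mem_edges _ h1) (Finset.mem_singleton_self v)

variable [DecidableEq V]

lemma exists_adj_of_mem_endComp {e : G.end} {v w : V} (h : G.Adj v w) (hw : w ∈ endComp e {v}) :
    ∃ x ∈ endComp e {v, w}, G.Adj x w := by
  by_contra! hc
  obtain ⟨u, hu⟩ := (endComp_infinite e {v, w}).nonempty
  have hsub := endComp_subset (endComp_mono e (by simp) hu) hu (fun x hx y hxy hy => by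
    refine mem_endComp_of_adj hx ?_ hxy
    rw [Finset.mem_insert, Finset.mem_singleton, not_or]
    refine ⟨by simpa using hy, ?_⟩
    rintro rfl
    exact hc x hx hxy) (K := {v})
  exact notMem_of_mem_endComp (hsub hw) (by simp)

/-- Each edge points towards the end in one direction only. -/
lemma notMem_endComp_of_adj (hG : G.IsTree) {e : G.end} {v w : V} (h : G.Adj v w)
    (hw : w ∈ endComp e {v}) : v ∉ endComp e {w} := by
  intro hv
  obtain ⟨x, hx, hxw⟩ := exists_adj_of_mem_endComp h hw
  obtain ⟨y, hy, hyv⟩ := exists_adj_of_mem_endComp h.symm hv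
  rw [Finset.pair_comm] at hy
  obtain ⟨q, hq⟩ := exists_walk_avoiding hy hx
  have h1 := edge_mem_of_adj hG h (SimpleGraph.Walk.cons hyv.symm (q.concat hxw))
  rw [SimpleGraph.Walk.edges_cons, SimpleGraph.Walk.edges_concat, List.mem_cons,
    List.concat_eq_append, List.mem_append, List.mem_singleton] at h1
  have hyw : y ≠ w := fun e => notMem_of_mem_endComp hy (by simp [e])
  have hxv : x ≠ v := fun e => notMem_of_mem_endComp hx (by simp [e])
  rcases h1 with h1 | h1 | h1
  · exact hyw (Sym2.congr_right.1 h1).symm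
  · exact hq v (SimpleGraph.Walk.fst_mem_support_of_mem_edges _ h1) (by simp)
  · rw [Sym2.congr_left] at h1
    exact hxv h1.symm

/-- Each edge points towards the end in one of its two directions. -/
lemma mem_endComp_or (hG : G.IsTree) {e : G.end} {v w : V} (h : G.Adj v w) :
    w ∈ endComp e {v} ∨ v ∈ endComp e {w} := by
  by_contra! hc
  obtain ⟨u, hu⟩ := (endComp_infinite e {v, w}).nonempty
  have := mem_of_closed hG.connected hu (fun x hx y hxy => by
    refine mem_endComp_of_adj hx ?_ hxy
    rw [Finset.mem_insert, Finset.mem_singleton, not_or]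
    constructor
    · rintro rfl
      exact hc.2 (mem_endComp_of_adj (endComp_mono e (by simp) hx) (by simpa using h.ne) hxy)
    · rintro rfl
      exact hc.1 (mem_endComp_of_adj (endComp_mono e (by simp) hx) (by simpa using h.ne') hxy)) v
  exact notMem_of_mem_endComp this (by simp)

end Ends

namespace TreeMap

/-- `p` moves each vertex one step towards the end `e`. -/
structure IsParent (T : TreeMap) (e : T.G.end) (p : T.V → T.V) : Prop where
  adj : ∀ v, T.G.Adj v (p v)
  mem : ∀ v, p v ∈ endComp e {v}

lemma exists_isParent (T : TreeMap) (e : T.G.end) : ∃ p, T.IsParent e p := by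
  choose p hp hp' using exists_adj_mem_endComp T.isTree e
  exact ⟨p, hp, hp'⟩

namespace IsParent

variable {T : TreeMap} {e : T.G.end} {p : T.V → T.V}

lemma adj_iff (hp : T.IsParent e p) (v w : T.V) : T.G.Adj v w ↔ p v = w ∨ p w = v := by
  classical
  constructor
  · intro h
    rcases mem_endComp_or T.isTree (e := e) h with h1 | h1
    · exact Or.inl (eq_of_mem_endComp T.isTree (hp.adj v) (hp.mem v) h h1)
    · exact Or.inr (eq_of_mem_endComp T.isTree (hp.adj w) (hp.mem w) h.symm h1)
  · rintro (rfl | rfl)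
    · exact hp.adj v
    · exact (hp.adj w).symm

lemma mem_parent (hp : T.IsParent e p) {u v : T.V} (h : u ∈ endComp e {v}) :
    p u ∈ endComp e {v} := by
  classical
  refine mem_endComp_of_adj h ?_ (hp.adj u)
  rw [Finset.mem_singleton]
  rintro rfl
  exact notMem_endComp_of_adj T.isTree (hp.adj u) (hp.mem u) h

lemma iterate_mem (hp : T.IsParent e p) {u v : T.V} (h : u ∈ endComp e {v}) (n : ℕ) :
    p^[n] u ∈ endComp e {v} := by
  induction n with
  | zero => exact h
  | succ n ih =>
    rw [Function.iterate_succ_apply']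
    exact hp.mem_parent ih

lemma notMem_of_iterate (hp : T.IsParent e p) {u v : T.V} {n : ℕ} (h : p^[n] u = v) :
    u ∉ endComp e {v} := fun hu =>
  notMem_of_mem_endComp (hp.iterate_mem hu n) (by rw [h]; exact Finset.mem_singleton_self v)

lemma iterate_succ_ne (hp : T.IsParent e p) (n : ℕ) (v : T.V) : p^[n + 1] v ≠ v := fun h =>
  hp.notMem_of_iterate (n := n) h (hp.mem v)

lemma iterate_inj (hp : T.IsParent e p) {m n : ℕ} {v : T.V} (h : p^[m] v = p^[n] v) : m = n := by
  have key : ∀ m k, p^[m] v = p^[m + (k + 1)] v → False := fun m k h => by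
    rw [add_comm, Function.iterate_add_apply] at h
    exact hp.iterate_succ_ne k _ h.symm
  rcases lt_trichotomy m n with h1 | h1 | h1
  · obtain ⟨k, rfl⟩ := Nat.exists_eq_add_of_lt h1
    exact (key m k h).elim
  · exact h1
  · obtain ⟨k, rfl⟩ := Nat.exists_eq_add_of_lt h1
    exact (key n k h.symm).elim

lemma exists_common (hp : T.IsParent e p) (v w : T.V) : ∃ m n, p^[m] v = p^[n] w := by
  refine mem_of_closed T.isTree.connected (S := {w | ∃ m n, p^[m] v = p^[n] w})
    ⟨0, 0, rfl⟩ ?_ w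
  rintro x ⟨m, n, h⟩ y hxy
  rcases (hp.adj_iff _ _).1 hxy with rfl | rfl
  · exact ⟨m + 1, n, by
      rw [Function.iterate_succ_apply', h, ← Function.iterate_succ_apply' p,
        Function.iterate_succ_apply]⟩
  · exact ⟨m, n + 1, by rw [h, Function.iterate_succ_apply]⟩

/-- A finite set lies below all vertices far out on a ray to the end. -/
lemma exists_bound (hp : T.IsParent e p) (K : Finset T.V) (o : T.V) :
    ∃ n0, ∀ n ≥ n0, ∀ k ∈ K, ∃ a, p^[a + 1] k = p^[n] o := by
  choose a b hab using fun k => hp.exists_common k o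
  refine ⟨K.sup b + 1, fun n hn k hk => ⟨a k + (n - b k - 1), ?_⟩⟩
  have h1 : b k ≤ K.sup b := Finset.le_sup hk
  have h2 : a k + (n - b k - 1) + 1 = (n - b k) + a k := by omega
  rw [h2, Function.iterate_add_apply, hab, ← Function.iterate_add_apply]
  congr 1
  omega

lemma eventually_mem (hp : T.IsParent e p) (K : Finset T.V) (o : T.V) :
    ∃ n0, ∀ n ≥ n0, p^[n] o ∈ endComp e K := by
  classical
  obtain ⟨n0, hn0⟩ := hp.exists_bound K o
  refine ⟨n0 + 1, fun n hn => ?_⟩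
  obtain ⟨n, rfl⟩ := Nat.exists_eq_add_of_le' (show 1 ≤ n by omega)
  obtain ⟨u, hu⟩ := (endComp_infinite e (K ∪ {p^[n] o})).nonempty
  have hsub := endComp_subset (K := {p^[n] o}) (S := endComp e K ∩ endComp e {p^[n] o})
    (endComp_mono e Finset.subset_union_right hu)
    ⟨endComp_mono e Finset.subset_union_left hu, endComp_mono e Finset.subset_union_right hu⟩
    (fun x hx y hxy hy => by
      have h1 := mem_endComp_of_adj hx.2 hy hxy
      refine ⟨mem_endComp_of_adj hx.1 (fun hyK => ?_) hxy, h1⟩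
      obtain ⟨a, ha⟩ := hn0 n (by omega) y hyK
      exact hp.notMem_of_iterate ha h1)
  rw [Function.iterate_succ_apply']
  exact (hsub (hp.mem _)).1

lemma iterate_descending {r : ℕ → T.V} (hr : ∀ n, p (r (n + 1)) = r n) (n m : ℕ) :
    p^[n] (r (m + n)) = r m := by
  induction n with
  | zero => rfl
  | succ n ih => rw [Function.iterate_succ_apply, ← add_assoc, hr, ih]

lemma injective_descending (hp : T.IsParent e p) {r : ℕ → T.V} (hr : ∀ n, p (r (n + 1)) = r n) :
    Function.Injective r := by
  intro m n h
  have h1 := iterate_descending hr m 0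
  have h2 := iterate_descending hr n 0
  rw [zero_add] at h1 h2
  rw [← h1, h] at h2
  exact (hp.iterate_inj h2).symm

/-- The end of a descending ray differs from `e`. -/
lemma rayEnd_ne (hp : T.IsParent e p) {r : ℕ → T.V} (hr : ∀ n, p (r (n + 1)) = r n) {e' : T.G.end}
    (he' : ∀ K : Finset T.V, ∃ n0, ∀ n ≥ n0, r n ∈ endComp e' K) : e' ≠ e := by
  rintro rfl
  obtain ⟨n0, hn0⟩ := he' {r 0}
  have h1 := iterate_descending hr n0 0
  rw [zero_add] at h1
  exact hp.notMem_of_iterate h1 (hn0 n0 le_rfl)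

/-- If `e` is the only isolated end, then no descending ray is free of branching. -/
lemma not_descending (hp : T.IsParent e p) (huniq : ∀ e', T.IsIsolatedEnd e' → e' = e)
    {r : ℕ → T.V} (hr : ∀ n, p (r (n + 1)) = r n)
    (hnbr : ∀ n w, p w = r (n + 1) → w = r (n + 2)) : False := by
  obtain ⟨e', he'⟩ := exists_rayEnd (G := T.G)
    (fun n => (hp.adj_iff (r n) (r (n + 1))).2 (Or.inr (hr n))) (hp.injective_descending hr)
  refine hp.rayEnd_ne hr he' (huniq e' (isIsolatedEnd_of_ray (fun n w hw => ?_) he'))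
  rcases (hp.adj_iff _ _).1 hw with h1 | h1
  · exact Or.inl (by rw [← h1, hr])
  · exact Or.inr (hnbr n w h1)

/-- Far out on a ray to an isolated end there is no branching. -/
lemma eventually_unique_child (hp : T.IsParent e p) (he : T.IsIsolatedEnd e)
    (hchild : ∀ v, ∃ w, p w = v) (o : T.V) :
    ∃ n0, ∀ n ≥ n0, ∀ w, p w = p^[n + 1] o → w = p^[n] o := by
  obtain ⟨K, hK⟩ := he
  obtain ⟨n0, hn0⟩ := hp.exists_bound K o
  refine ⟨n0, fun n hn w hw => by_contra fun hne => ?_⟩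
  choose c hc using hchild
  let s : ℕ → T.V := fun j => c^[j] w
  have hs : ∀ j, p (s (j + 1)) = s j := fun j => by
    simp only [s, Function.iterate_succ_apply', hc]
  obtain ⟨e', he'⟩ := exists_rayEnd (G := T.G)
    (fun n => (hp.adj_iff (s n) (s (n + 1))).2 (Or.inr (hs n))) (hp.injective_descending hs)
  have hsw : ∀ j, p^[j] (s j) = w := fun j => by
    have := iterate_descending hs j 0
    rwa [zero_add] at this
  -- the descending ray from `w` avoids `K`, as does the ray from `w` to `e`
  have havoid : ∀ j i, p^[i] (s j) ∉ K := by
    intro j i hk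
    obtain ⟨a, ha⟩ := hn0 n hn _ hk
    rcases le_or_gt i j with hij | hij
    · have h1 : p^[j - i] (p^[i] (s j)) = w := by
        rw [← Function.iterate_add_apply, Nat.sub_add_cancel hij, hsw]
      have h2 : p^[j - i + 1] (p^[i] (s j)) = p^[a + 2] (p^[i] (s j)) := by
        rw [Function.iterate_succ_apply', h1, hw, Function.iterate_succ_apply', ← ha,
          ← Function.iterate_succ_apply' p]
      have h3 := hp.iterate_inj h2
      apply hne
      rw [← h1, ← ha]
      congr 1
      omega
    · have h1 : p^[i] (s j) = p^[i - j - 1 + (n + 1)] o := by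
        rw [Function.iterate_add_apply, ← hw, ← Function.iterate_succ_apply, ← hsw j,
          ← Function.iterate_add_apply]
        congr 1
        omega
      rw [h1, ← Function.iterate_add_apply] at ha
      have := hp.iterate_inj ha
      omega
  have hmem : ∀ j, s j ∈ endComp e K := by
    intro j
    obtain ⟨m, hm⟩ := hp.eventually_mem K (s j)
    refine mem_endComp_of_chain (r := fun i => p^[i] (s j)) (fun i => ?_) (fun i _ => havoid j i)
      (hm m le_rfl) 0 (Nat.zero_le _)
    rw [Function.iterate_succ_apply']
    exact hp.adj _
  obtain ⟨m, hm⟩ := he' K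
  exact hp.rayEnd_ne hs he' (hK e' (endComp_eq_of_mem (hm m le_rfl) (hmem m)))

end IsParent

end TreeMap

/-! ### The dynamics preserves the orientation towards the isolated end -/

namespace TreeMap

lemma HasDegree.ncard_fiber_le {T : TreeMap} (h : T.HasDegree D) (v : T.V) :
    (T.F ⁻¹' {v}).ncard ≤ D := by
  obtain ⟨degV, degE, hdeg, hsum⟩ := h
  rw [← hsum v, finsum_mem_eq_finite_toFinset_sum _ (T.map_proper v),
    Set.ncard_eq_toFinset_card _ (T.map_proper v), Finset.card_eq_sum_ones]
  exact Finset.sum_le_sum fun u _ => hdeg.vertex_pos u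

namespace IsParent

variable {T : TreeMap} {e : T.G.end} {p : T.V → T.V}

lemma parent_parent_ne (hp : T.IsParent e p) (v : T.V) : p (p v) ≠ v := hp.iterate_succ_ne 1 v

lemma neighborSet_eq (hp : T.IsParent e p) (v : T.V) :
    T.G.neighborSet v = insert (p v) {w | p w = v} := by
  ext w
  rw [SimpleGraph.mem_neighborSet, hp.adj_iff]
  simp [eq_comm]

lemma exists_child (hp : T.IsParent e p) (hval : ∀ v, T.val v ≠ 1) (v : T.V) : ∃ w, p w = v := by
  by_contra! hc
  refine hval v ?_
  have h1 : {w | p w = v} = ∅ := Set.eq_empty_of_forall_notMem hc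
  rw [val, hp.neighborSet_eq, h1]
  simp

lemma exists_children (hp : T.IsParent e p) {v : T.V} (hv : 3 ≤ T.val v) :
    ∃ w w', w ≠ w' ∧ p w = v ∧ p w' = v := by
  by_contra! hc
  have hsub : {w | p w = v}.ncard ≤ 1 := by
    have hfin : {w | p w = v}.Finite :=
      (T.locallyFinite v).subset fun w hw => (hp.adj_iff _ _).2 (Or.inr hw)
    refine (Set.ncard_le_one hfin).2 fun a ha b hb => ?_
    by_contra hne
    exact hc a b hne ha hb
  have h1 := Set.ncard_insert_le (p v) {w | p w = v}
  rw [← hp.neighborSet_eq] at h1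
  have h2 : T.val v = (T.G.neighborSet v).ncard := rfl
  omega

/-- The last branch point on the way to the isolated end. -/
lemma exists_last_branch (hp : T.IsParent e p) (he : T.IsIsolatedEnd e)
    (hval : ∀ v, T.val v ≠ 1) {b : T.V} (hb : 3 ≤ T.val b) :
    ∃ v0, (∃ w w', w ≠ w' ∧ p w = v0 ∧ p w' = v0) ∧
      ∀ n w, p w = p^[n + 1] v0 → w = p^[n] v0 := by
  classical
  obtain ⟨n0, hn0⟩ := hp.eventually_unique_child he (hp.exists_child hval) b
  let P : ℕ → Prop := fun n => ∃ w w', w ≠ w' ∧ p w = p^[n] b ∧ p w' = p^[n] b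
  have hP : ∀ n, P n → n ≤ n0 := by
    rintro (_ | n) ⟨w, w', hne, hw, hw'⟩
    · exact Nat.zero_le _
    · by_contra! hlt
      exact hne ((hn0 n (by omega) w hw).trans (hn0 n (by omega) w' hw').symm)
  refine ⟨p^[Nat.findGreatest P n0] b, Nat.findGreatest_spec (P := P) (Nat.zero_le n0)
    (hp.exists_children hb), fun n w hw => by_contra fun hne => ?_⟩
  rw [← Function.iterate_add_apply] at hw hne
  have h1 : P (n + 1 + Nat.findGreatest P n0) := by
    refine ⟨w, _, hne, hw, ?_⟩
    rw [← Function.iterate_succ_apply' p]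
    congr 2
    omega
  have := Nat.le_findGreatest (hP _ h1) h1
  omega

variable {v0 : T.V}

/-- Above the last branch point, the dynamics translates the ray to the isolated end. -/
lemma exists_translation (hp : T.IsParent e p) (huniq : ∀ e', T.IsIsolatedEnd e' → e' = e)
    (hval : ∀ v, T.val v ≠ 1) (hbr : ∃ w w', w ≠ w' ∧ p w = v0 ∧ p w' = v0)
    (hone : ∀ n w, p w = p^[n + 1] v0 → w = p^[n] v0) :
    ∃ c, ∀ i, T.F (p^[i] v0) = p^[i + c] v0 := by
  -- the image ray has no branching, and does not backtrack
  have hnbr : ∀ i w, T.G.Adj (T.F (p^[i + 1] v0)) w →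
      w = T.F (p^[i] v0) ∨ w = T.F (p^[i + 2] v0) := by
    intro i w hw
    obtain ⟨u, hu, rfl⟩ := T.map_open _ _ hw
    rcases (hp.adj_iff _ _).1 hu with h1 | h1
    · exact Or.inr (by rw [← h1, ← Function.iterate_succ_apply' p])
    · exact Or.inl (by rw [hone i u h1])
  have hadj : ∀ i, T.G.Adj (T.F (p^[i] v0)) (T.F (p^[i + 1] v0)) := fun i => by
    refine T.map_adj _ _ ?_
    rw [Function.iterate_succ_apply']
    exact hp.adj _
  have hne : ∀ i, T.F (p^[i] v0) ≠ T.F (p^[i + 2] v0) := by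
    intro i heq
    obtain ⟨u, hu⟩ := hp.exists_child hval (T.F (p^[i + 1] v0))
    have h1 := hnbr i _ ((hp.adj_iff _ _).2 (Or.inr hu))
    have h2 := hnbr i _ (hp.adj _)
    rw [← heq, or_self] at h1 h2
    apply hp.parent_parent_ne u
    rw [hu, h2, h1]
  have hup : ∀ i, p (T.F (p^[i] v0)) = T.F (p^[i + 1] v0) := by
    intro i
    by_contra hcon
    have hdown : ∀ j, p (T.F (p^[i + j + 1] v0)) = T.F (p^[i + j] v0) := by
      intro j
      induction j with
      | zero => exact ((hp.adj_iff _ _).1 (hadj i)).resolve_left hcon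
      | succ j ih =>
        refine ((hp.adj_iff _ _).1 (hadj (i + j + 1))).resolve_left fun h1 => ?_
        exact hne (i + j) (ih.symm.trans h1)
    refine hp.not_descending huniq (r := fun j => T.F (p^[i + j] v0)) hdown fun n w hw => ?_
    refine (hnbr (i + n) w ((hp.adj_iff _ _).2 (Or.inr hw))).resolve_left fun h1 => ?_
    apply hp.parent_parent_ne (T.F (p^[i + n + 1] v0))
    rw [hdown, ← h1, hw]
    rfl
  have hiter : ∀ i, T.F (p^[i] v0) = p^[i] (T.F v0) := by
    intro i
    induction i with
    | zero => rfl
    | succ i ih => rw [← hup, ih, Function.iterate_succ_apply']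
  obtain ⟨m, n, hmn⟩ := hp.exists_common v0 (T.F v0)
  have hbase : ∀ n m, p^[m] v0 = T.F (p^[n] v0) → ∃ c, T.F v0 = p^[c] v0 := by
    intro n
    induction n with
    | zero => exact fun m h => ⟨m, h.symm⟩
    | succ n ih =>
      rintro (_ | m) h
      · exfalso
        obtain ⟨w, w', hne', hw, hw'⟩ := hbr
        have h0 : v0 = T.F (p^[n + 1] v0) := h
        have key : ∀ u, p u = v0 → u = T.F (p^[n] v0) := by
          intro u hu
          refine (hnbr n u ((hp.adj_iff _ _).2 (Or.inr (hu.trans h0)))).resolve_right fun h1 => ?_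
          apply hp.parent_parent_ne u
          rw [hu, h0, hup, ← h1]
        exact hne' ((key w hw).trans (key w' hw').symm)
      · exact ih m (hone m _ (by rw [hup, h])).symm
  obtain ⟨c, hc⟩ := hbase n m (by rw [hmn, hiter])
  exact ⟨c, fun i => by rw [hiter, hc, Function.iterate_add_apply]⟩

/-- A path without backtracking in the image lifts to a descending path, once its first step does. -/
lemma exists_lift (hp : T.IsParent e p) {x w : T.V} {q : ℕ → T.V} {M : ℕ} (hw : p w = x)
    (h0 : T.F x = q 0) (h1 : T.F w = q 1) (hadj : ∀ i < M, T.G.Adj (q (i + 1)) (q (i + 2)))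
    (hnb : ∀ i < M, q (i + 2) ≠ q i) :
    ∀ n ≤ M, ∃ u, p^[n] u = w ∧ T.F u = q (n + 1) ∧ T.F (p u) = q n := by
  intro n
  induction n with
  | zero => exact fun _ => ⟨w, rfl, h1, by rw [hw, h0]⟩
  | succ n ih =>
    intro hn
    obtain ⟨u, hu, hu1, hu0⟩ := ih (by omega)
    obtain ⟨u', hu', hFu'⟩ := T.map_open u (q (n + 2)) (by rw [hu1]; exact hadj n (by omega))
    have h2 : p u' = u := ((hp.adj_iff _ _).1 hu').resolve_left fun h3 =>
      hnb n (by omega) (by rw [← hFu', ← h3, hu0])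
    exact ⟨u', by rw [Function.iterate_succ_apply, h2, hu], hFu', by rw [h2, hu1]⟩

/-- Side branches at different places of a descending ray are disjoint. -/
lemma side_branch_disjoint (hp : T.IsParent e p) {r : ℕ → T.V} (hr : ∀ n, p (r (n + 1)) = r n)
    {k k' n n' : ℕ} {u w : T.V} (hkk : k < k') (hw : p w = r k) (hne : w ≠ r (k + 1))
    (h : p^[n] u = w) (h' : p^[n' + 1] u = r k') : False := by
  obtain ⟨l, rfl⟩ := Nat.exists_eq_add_of_lt hkk
  have h1 := iterate_descending hr l (k + 1)
  have h2 : p^[l + (n' + 1)] u = r (k + 1) := by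
    rw [Function.iterate_add_apply, h', ← h1]
    congr 2
    omega
  have h3 : p^[n + 1] u = p^[l + (n' + 1) + 1] u := by
    rw [Function.iterate_succ_apply', h, hw, Function.iterate_succ_apply', h2, hr]
  have h4 := hp.iterate_inj h3
  apply hne
  rw [← h, ← h2]
  congr 1
  omega

/-- No descending ray maps onto the ray to the isolated end.  Along such a ray there would be
infinitely many side branches; each of them covers the part of the ray above or below its own image,
which is too much for a map of finite degree. -/
lemma not_descending_of_map (hp : T.IsParent e p) (huniq : ∀ e', T.IsIsolatedEnd e' → e' = e)
    (hdeg : T.HasDegree D) (hone : ∀ n w, p w = p^[n + 1] v0 → w = p^[n] v0) {r : ℕ → T.V} {j : ℕ}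
    (hr : ∀ n, p (r (n + 1)) = r n) (hF : ∀ k, T.F (r k) = p^[j + 1 + k] v0) : False := by
  classical
  have hspine : ∀ i, T.G.Adj (p^[i] v0) (p^[i + 1] v0) := fun i => by
    rw [Function.iterate_succ_apply']
    exact hp.adj _
  -- a side branch at `r k` starts upwards (`U`) or downwards (`W`) in the image
  let U : Set ℕ := {k | ∃ w, p w = r k ∧ w ≠ r (k + 1) ∧ T.F w = p^[j + 1 + k + 1] v0}
  let W : Set ℕ := {k | ∃ w, p w = r k ∧ w ≠ r (k + 1) ∧ T.F w = p^[j + k] v0}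
  have hUW : (U ∪ W).Infinite := by
    intro hfin
    obtain ⟨K, hK⟩ := hfin.bddAbove
    refine hp.not_descending huniq (r := fun n => r (K + n)) (fun n => hr (K + n)) ?_
    intro n w hw
    by_contra hne
    have hadj : T.G.Adj (T.F (r (K + (n + 1)))) (T.F w) :=
      T.map_adj _ _ ((hp.adj_iff _ _).2 (Or.inr hw))
    rw [hF] at hadj
    have hmem : K + (n + 1) ∈ U ∪ W := by
      rcases (hp.adj_iff _ _).1 hadj with h1 | h1
      · exact Or.inl ⟨w, hw, hne, by rw [← h1, Function.iterate_succ_apply']⟩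
      · refine Or.inr ⟨w, hw, hne, hone _ _ ?_⟩
        rw [h1]
        congr 1
        omega
    have := hK hmem
    omega
  rcases Set.infinite_union.1 hUW with hU | hW
  · -- more than `D` points over a high point of the ray
    obtain ⟨S, hSU, hS⟩ := hU.exists_subset_card_eq (D + 1)
    have key : ∀ k ∈ S, ∃ u n w, p w = r k ∧ w ≠ r (k + 1) ∧ p^[n] u = w ∧
        T.F u = p^[j + 2 + S.sup id] v0 := by
      intro k hk
      obtain ⟨w, hw, hne, hFw⟩ := hSU hk
      obtain ⟨u, hu, hFu, -⟩ := hp.exists_lift (q := fun i => p^[j + 1 + k + i] v0)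
        (M := S.sup id - k) hw (hF k) hFw (fun i _ => hspine (j + 1 + k + (i + 1)))
        (fun i _ h => by
          have := hp.iterate_inj h
          omega) _ le_rfl
      refine ⟨u, _, w, hw, hne, hu, ?_⟩
      have h1 : k ≤ S.sup id := Finset.le_sup (f := id) hk
      rw [hFu]
      congr 1
      omega
    choose! u n w hw hne hu hFu using key
    have hinj : Set.InjOn u S := by
      intro k hk k' hk' hkk
      rcases lt_trichotomy k k' with h1 | h1 | h1
      · refine (hp.side_branch_disjoint hr h1 (hw k hk) (hne k hk) (hu k hk) (n' := n k') ?_).elim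
        rw [hkk, Function.iterate_succ_apply', hu k' hk', hw k' hk']
      · exact h1
      · refine (hp.side_branch_disjoint hr h1 (hw k' hk') (hne k' hk') (hu k' hk')
          (n' := n k) ?_).elim
        rw [← hkk, Function.iterate_succ_apply', hu k hk, hw k hk]
    have h1 : (u '' S).ncard ≤ (T.F ⁻¹' {p^[j + 2 + S.sup id] v0}).ncard :=
      Set.ncard_le_ncard (by
        rintro _ ⟨k, hk, rfl⟩
        exact hFu k hk) (T.map_proper _)
    rw [hinj.ncard_image, Set.ncard_coe_finset, hS] at h1
    have h2 := hdeg.ncard_fiber_le (p^[j + 2 + S.sup id] v0)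
    omega
  · -- infinitely many points over `v0`
    have key : ∀ k ∈ W, ∃ u n w, p w = r k ∧ w ≠ r (k + 1) ∧ p^[n] u = w ∧ T.F u = v0 := by
      rintro k ⟨w, hw, hne, hFw⟩
      obtain ⟨u, hu, hFu, -⟩ := hp.exists_lift (q := fun i => p^[j + 1 + k - i] v0)
        (M := j + k) hw (hF k) (by
          rw [hFw]
          congr 1
          omega) (fun i hi => by
          have h1 : j + 1 + k - (i + 1) = j + 1 + k - (i + 2) + 1 := by omega
          simp only [h1]
          exact (hspine _).symm)
        (fun i hi h => by
          have := hp.iterate_inj h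
          omega) _ le_rfl
      refine ⟨u, _, w, hw, hne, hu, ?_⟩
      have h1 : j + 1 + k - (j + k + 1) = 0 := by omega
      rw [hFu, h1]
      rfl
    choose! u n w hw hne hu hFu using key
    have hinj : Set.InjOn u W := by
      intro k hk k' hk' hkk
      rcases lt_trichotomy k k' with h1 | h1 | h1
      · refine (hp.side_branch_disjoint hr h1 (hw k hk) (hne k hk) (hu k hk) (n' := n k') ?_).elim
        rw [hkk, Function.iterate_succ_apply', hu k' hk', hw k' hk']
      · exact h1
      · refine (hp.side_branch_disjoint hr h1 (hw k' hk') (hne k' hk') (hu k' hk')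
          (n' := n k) ?_).elim
        rw [← hkk, Function.iterate_succ_apply', hu k hk, hw k hk]
    exact (Set.infinite_of_injOn_mapsTo hinj (t := T.F ⁻¹' {v0}) (fun k hk => hFu k hk) hW)
      (T.map_proper v0)

lemma map_parent (hp : T.IsParent e p) (huniq : ∀ e', T.IsIsolatedEnd e' → e' = e)
    (hdeg : T.HasDegree D) (hone : ∀ n w, p w = p^[n + 1] v0 → w = p^[n] v0) (v : T.V) :
    T.F (p v) = p (T.F v) := by
  by_contra hcon
  have hstep : ∀ u, T.F u = p (T.F (p u)) → ∃ u', p u' = u ∧ T.F u' = p (T.F u) := by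
    intro u hu
    obtain ⟨u', hu', hFu'⟩ := T.map_open u (p (T.F u)) (hp.adj _)
    refine ⟨u', ((hp.adj_iff _ _).1 hu').resolve_left fun h1 => ?_, hFu'⟩
    subst h1
    exact hp.parent_parent_ne (T.F (p u)) (by rw [← hu, ← hFu'])
  -- starting from `v`, lift the ray from `F v` to the isolated end to a descending ray
  choose! s hs hs' using hstep
  obtain ⟨w, hw, hFw⟩ := T.map_open v (p (T.F v)) (hp.adj _)
  have hwv : p w = v := ((hp.adj_iff _ _).1 hw).resolve_left fun h1 => hcon (by rw [h1, hFw])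
  have hQ : ∀ k, T.F (s^[k] w) = p (T.F (p (s^[k] w))) := by
    intro k
    induction k with
    | zero => exact hFw.trans (by rw [← hwv]; rfl)
    | succ k ih => rw [Function.iterate_succ_apply', hs' _ ih, hs _ ih]
  have hr : ∀ k, p (s^[k + 1] w) = s^[k] w := fun k => by
    rw [Function.iterate_succ_apply', hs _ (hQ k)]
  have hFr : ∀ k, T.F (s^[k] w) = p^[k] (T.F w) := by
    intro k
    induction k with
    | zero => rfl
    | succ k ih => rw [Function.iterate_succ_apply', hs' _ (hQ k), ih, Function.iterate_succ_apply']
  obtain ⟨a, b, hab⟩ := hp.exists_common (T.F w) v0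
  refine hp.not_descending_of_map huniq hdeg hone (r := fun k => s^[a + 1 + k] w) (j := b)
    (fun k => hr (a + 1 + k)) fun k => ?_
  have e1 : a + 1 + k = (k + 1) + a := by omega
  have e2 : b + 1 + k = (k + 1) + b := by omega
  rw [hFr, e1, e2, Function.iterate_add_apply, hab, ← Function.iterate_add_apply]

lemma exists_lift_of_iterate (hp : T.IsParent e p) (hFp : ∀ v, T.F (p v) = p (T.F v)) (n : ℕ)
    {v x : T.V} (h : p^[n] x = T.F v) : ∃ y, p^[n] y = v ∧ T.F y = x := by
  induction n generalizing x with
  | zero => exact ⟨v, rfl, h.symm⟩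
  | succ n ih =>
    obtain ⟨y, hy, hFy⟩ := ih (x := p x) h
    obtain ⟨w, hw, hFw⟩ := T.map_open y x (by
      rw [hFy]
      exact (hp.adj x).symm)
    have h1 : p w = y := ((hp.adj_iff _ _).1 hw).resolve_left fun h1 => by
      apply hp.parent_parent_ne x
      rw [← hFy, ← hFp, h1, hFw]
    exact ⟨w, by rw [Function.iterate_succ_apply, h1, hy], hFw⟩

end IsParent

end TreeMap

/-- The vertices of a metrized polynomial-like tree lie on levels, which the dynamics raises by a
constant. -/
theorem MTree.exists_isLeveled (X : MTree D) (hD : 2 ≤ D) :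
    ∃ (p : X.V → X.V) (h : X.V → ℤ) (N : ℕ), X.IsLeveled p h ∧ (∀ v, X.F (p v) = p (X.F v)) ∧
      1 ≤ N ∧ ∀ v, h (X.F v) = h v + N := by
  obtain ⟨e, he, huniq⟩ := X.polyLike.hasInfinity
  obtain ⟨p, hp⟩ := X.toTreeMap.exists_isParent e
  have hval := X.polyLike.no_endpoints
  obtain ⟨b, -, hb⟩ := X.polyLike.grand_orbit X.base
  obtain ⟨v0, hbr, hone⟩ := hp.exists_last_branch he hval hb
  obtain ⟨c, hc⟩ := hp.exists_translation huniq hval hbr hone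
  have hFp := hp.map_parent huniq X.polyLike.hasDegree hone
  have hc1 : 1 ≤ c := by
    by_contra hcon
    obtain rfl : c = 0 := by omega
    have h0 : X.F v0 = v0 := hc 0
    have h1 : X.F (p v0) = p v0 := hc 1
    have h2 := X.heightMetric.expand v0 (p v0) (hp.adj v0)
    rw [h0, h1] at h2
    have h3 : X.d v0 (p v0) ≠ 0 := fun h => (hp.adj v0).ne (X.heightMetric.eq_of_zero _ _ h)
    have h4 : (D : ℝ) = 1 := by
      apply mul_right_cancel₀ h3
      rw [one_mul]
      exact h2.symm
    have h5 : D = 1 := by exact_mod_cast h4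
    omega
  choose m n hmn using fun v => hp.exists_common v v0
  let h : X.V → ℤ := fun v => n v - m v
  have hh : ∀ v i j, p^[i] v = p^[j] v0 → h v = j - i := by
    intro v i j hij
    have h1 : p^[i + n v] v0 = p^[m v + j] v0 := by
      rw [Function.iterate_add_apply, ← hmn, ← Function.iterate_add_apply, add_comm,
        Function.iterate_add_apply, hij, ← Function.iterate_add_apply]
    have h2 := hp.iterate_inj h1
    simp only [h]
    omega
  have htop : ∀ v, 0 ≤ h v → v = p^[(h v).toNat] v0 := by
    have key : ∀ i j v, p^[i] v = p^[j + i] v0 → v = p^[j] v0 := by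
      intro i
      induction i with
      | zero => exact fun j v h => h
      | succ i ih =>
        intro j v h
        rw [Function.iterate_succ_apply'] at h
        exact ih j v (hone (j + i) _ h)
    intro v hv
    refine key (m v) _ v ?_
    rw [hmn]
    congr 1
    simp only [h] at hv ⊢
    omega
  have hparent : ∀ v, h (p v) = h v + 1 := by
    intro v
    have h1 : p^[m v] (p v) = p^[n v + 1] v0 := by
      rw [← Function.iterate_succ_apply, Function.iterate_succ_apply', hmn,
        Function.iterate_succ_apply']
    rw [hh _ _ _ h1]
    simp only [h]
    push_cast
    ring
  have hFiter : ∀ i v, X.F (p^[i] v) = p^[i] (X.F v) := by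
    intro i v
    induction i with
    | zero => rfl
    | succ i ih => rw [Function.iterate_succ_apply', hFp, ih, Function.iterate_succ_apply']
  have hmap : ∀ v, h (X.F v) = h v + c := by
    intro v
    have h1 : p^[m v] (X.F v) = p^[n v + c] v0 := by rw [← hFiter, hmn, hc]
    rw [hh _ _ _ h1]
    simp only [h]
    push_cast
    ring
  have h00 : h v0 = 0 := by
    rw [hh v0 0 0 rfl]
    simp
  have hbranch : ∀ (k : ℕ) v, 0 ≤ h v + k * c →
      ∃ w w' n, w ≠ w' ∧ p^[n] w = v ∧ p^[n] w' = v := by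
    intro k
    induction k with
    | zero =>
      intro v hv
      obtain ⟨w, w', hne, hw, hw'⟩ := hbr
      have h1 := htop v (by simpa using hv)
      exact ⟨w, w', (h v).toNat + 1, hne, by rw [Function.iterate_succ_apply, hw, ← h1],
        by rw [Function.iterate_succ_apply, hw', ← h1]⟩
    | succ k ih =>
      intro v hv
      obtain ⟨w, w', n, hne, hw, hw'⟩ := ih (X.F v) (by
        rw [hmap]
        push_cast at hv
        linarith)
      obtain ⟨y, hy, rfl⟩ := hp.exists_lift_of_iterate hFp n hw
      obtain ⟨y', hy', rfl⟩ := hp.exists_lift_of_iterate hFp n hw'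
      exact ⟨y, y', n, fun e => hne (by rw [e]), hy, hy'⟩
  refine ⟨p, h, c, ⟨hp.adj_iff, hparent, ?_, ⟨v0, h00, hbr⟩, hp.exists_child hval, fun v => ?_⟩,
    hFp, hc1, hmap⟩
  · intro v w hv hvw
    rw [htop v hv, htop w (hvw ▸ hv), hvw]
  · refine hbranch (h v).natAbs v ?_
    have h1 : ((h v).natAbs : ℤ) * 1 ≤ (h v).natAbs * c := by
      gcongr
      exact_mod_cast hc1
    omega

/-! ### Inverse branches and labels for a tree with a local degree function -/

namespace TreeMap.IsLeveled

variable {T : TreeMap} {p : T.V → T.V} {h : T.V → ℤ} {degV : T.V → ℕ} {degE : Sym2 T.V → ℕ}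

lemma degE_parent (hL : IsLeveled T p h) (hFp : ∀ v, T.F (p v) = p (T.F v))
    (hdeg : T.IsLocalDegree degV degE) (v : T.V) : degE s(v, p v) = degV v := by
  rw [hdeg.eq v (p v) (hL.adj_parent v), hL.edge_fiber_parent hFp, finsum_mem_singleton]

lemma exists_child_map_eq (hL : IsLeveled T p h) (hFp : ∀ v, T.F (p v) = p (T.F v)) {v u : T.V}
    (hu : p u = T.F v) : ∃ w, p w = v ∧ T.F w = u := by
  obtain ⟨w, hw, hFw⟩ := T.map_open v u ((hL.adj_iff _ _).2 (Or.inr hu))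
  refine ⟨w, ((hL.adj_iff _ _).1 hw).resolve_left fun h1 => ?_, hFw⟩
  apply hL.parent_parent_ne u
  rw [hu, ← hFp, h1, hFw]

/-- The local degree at `v` is the sum of the local degrees at the children over a given child of
the image. -/
lemma degV_eq_sum (hL : IsLeveled T p h) (hFp : ∀ v, T.F (p v) = p (T.F v))
    (hdeg : T.IsLocalDegree degV degE) {v u : T.V} (hu : p u = T.F v) :
    degV v = ∑ᶠ w ∈ {w | p w = v ∧ T.F w = u}, degV w := by
  obtain ⟨w, rfl, rfl⟩ := hL.exists_child_map_eq hFp hu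
  rw [hdeg.eq _ w (hL.adj_parent w).symm, hL.edge_fiber_child hFp rfl]
  refine finsum_mem_congr rfl fun w' hw' => ?_
  rw [← hw'.1, Sym2.eq_swap, hL.degE_parent hFp hdeg]

/-- The Riemann–Hurwitz inequality, in terms of the children of `v`. -/
lemma sum_degV_sub_one_le (hL : IsLeveled T p h) (hFp : ∀ v, T.F (p v) = p (T.F v))
    (hdeg : T.IsLocalDegree degV degE) (v : T.V) :
    ∑ w ∈ (hL.finite_children v).toFinset, ((degV w : ℤ) - 1) ≤ degV v - 1 := by
  have h1 := hdeg.ineq v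
  have hnot : p v ∉ {w | p w = v} := hL.parent_parent_ne v
  rw [hL.neighborSet_eq v, finsum_mem_insert _ hnot (hL.finite_children v),
    hL.degE_parent hFp hdeg, finsum_mem_eq_finite_toFinset_sum _ (hL.finite_children v)] at h1
  have h2 : ∑ w ∈ (hL.finite_children v).toFinset, ((degE s(v, w) : ℤ) - 1) =
      ∑ w ∈ (hL.finite_children v).toFinset, ((degV w : ℤ) - 1) := by
    refine Finset.sum_congr rfl fun w hw => ?_
    have hw' : p w = v := by simpa using hw
    rw [← hw', Sym2.eq_swap, hL.degE_parent hFp hdeg]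
  rw [h2] at h1
  linarith

end TreeMap.IsLeveled

/-- A finite set can be divided into labelled parts of prescribed sizes. -/
lemma exists_partition {α W : Type*} [DecidableEq α] [DecidableEq W] (m : W → ℕ) (S : Finset W)
    (B : Finset α) (h : B.card = ∑ w ∈ S, m w) :
    ∃ f : α → Option W, (∀ a ∈ B, ∃ w ∈ S, f a = some w) ∧
      ∀ w ∈ S, (B.filter fun a => f a = some w).card = m w := by
  induction S using Finset.induction_on generalizing B with
  | empty =>
    have hB : B = ∅ := Finset.card_eq_zero.1 (by simpa using h)
    exact ⟨fun _ => none, by simp [hB], by simp⟩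
  | @insert w0 S hw0 ih =>
    rw [Finset.sum_insert hw0] at h
    obtain ⟨B0, hB0, hcard⟩ := Finset.exists_subset_card_eq (show m w0 ≤ B.card by omega)
    obtain ⟨f, hf, hf'⟩ := ih (B \ B0) (by rw [Finset.card_sdiff_of_subset hB0]; omega)
    refine ⟨fun a => if a ∈ B0 then some w0 else f a, fun a ha => ?_, fun w hw => ?_⟩
    · by_cases h0 : a ∈ B0
      · exact ⟨w0, by simp, by simp [h0]⟩
      · obtain ⟨w, hw, hfw⟩ := hf a (by simp [ha, h0])
        exact ⟨w, by simp [hw], by simp [h0, hfw]⟩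
    · rcases Finset.mem_insert.1 hw with rfl | hw
      · rw [← hcard]
        congr 1
        ext a
        simp only [Finset.mem_filter]
        constructor
        · rintro ⟨ha, ha'⟩
          by_contra h0
          rw [if_neg h0] at ha'
          obtain ⟨w', hw', hfw⟩ := hf a (by simp [ha, h0])
          rw [hfw, Option.some.injEq] at ha'
          exact hw0 (ha' ▸ hw')
        · exact fun ha => ⟨hB0 ha, by simp [ha]⟩
      · rw [← hf' w hw]
        congr 1
        ext a
        simp only [Finset.mem_filter, Finset.mem_sdiff]
        by_cases h0 : a ∈ B0
        · simp only [h0, if_true, not_true, and_false, false_and, iff_false, Option.some.injEq]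
          rintro ⟨-, rfl⟩
          exact hw0 hw
        · simp [h0]

/-- `g` lists the preimages of `v`, with multiplicities given by the local degrees. -/
def IsBranchList (T : TreeMap) (degV : T.V → ℕ) (v : T.V) (g : Fin D → T.V) : Prop :=
  (∀ a, T.F (g a) = v) ∧ ∀ w, T.F w = v → {a | g a = w}.ncard = degV w

namespace TreeMap.IsLeveled

variable {T : TreeMap} {p : T.V → T.V} {h : T.V → ℤ} {degV : T.V → ℕ} {degE : Sym2 T.V → ℕ}

lemma exists_extend_branchList (hL : IsLeveled T p h) (hFp : ∀ v, T.F (p v) = p (T.F v))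
    (hdeg : T.IsLocalDegree degV degE) {v : T.V} {g : Fin D → T.V}
    (hg : IsBranchList T degV (p v) g) :
    ∃ g' : Fin D → T.V, IsBranchList T degV v g' ∧ ∀ a, p (g' a) = g a := by
  classical
  have key : ∀ y, ∃ f : Fin D → Option T.V,
      (∀ a, g a = y → ∃ w, (p w = y ∧ T.F w = v) ∧ f a = some w) ∧
      ∀ w, (p w = y ∧ T.F w = v) → {a | g a = y ∧ f a = some w}.ncard = degV w := by
    intro y
    have hfin : {w | p w = y ∧ T.F w = v}.Finite := (hL.finite_children y).subset fun _ hw => hw.1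
    obtain ⟨f, hf, hf'⟩ := exists_partition degV hfin.toFinset
      (Finset.univ.filter fun a => g a = y) (by
        rw [← finsum_mem_eq_finite_toFinset_sum _ hfin]
        by_cases hy : T.F y = p v
        · rw [← hL.degV_eq_sum hFp hdeg hy.symm, ← hg.2 y hy, Set.ncard_eq_toFinset_card']
          congr 1
          ext a
          simp
        · have h1 : {w | p w = y ∧ T.F w = v} = ∅ := by
            refine Set.eq_empty_of_forall_notMem ?_
            rintro w ⟨rfl, rfl⟩
            exact hy (hFp w)
          rw [h1, finsum_mem_empty, Finset.card_eq_zero, Finset.filter_eq_empty_iff]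
          rintro a - rfl
          exact hy (hg.1 a))
    refine ⟨f, fun a ha => ?_, fun w hw => ?_⟩
    · obtain ⟨w, hw, hfw⟩ := hf a (by simp [ha])
      exact ⟨w, by simpa using hw, hfw⟩
    · rw [← hf' w (by simpa using hw), Set.ncard_eq_toFinset_card']
      congr 1
      ext a
      simp
  choose f hf hf' using key
  choose g' hg' hfg' using fun a => hf (g a) a rfl
  refine ⟨g', ⟨fun a => (hg' a).2, fun w hw => ?_⟩, fun a => (hg' a).1⟩
  rw [← hf' (p w) w ⟨rfl, hw⟩]
  congr 1
  ext a
  simp only [Set.mem_ofPred_eq]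
  constructor
  · rintro rfl
    rw [(hg' a).1]
    exact ⟨rfl, hfg' a⟩
  · rintro ⟨h1, h2⟩
    rw [← h1, hfg', Option.some.injEq] at h2
    exact h2

variable {N : ℕ}

/-- Inverse branches of the dynamics, compatible with the parent map. -/
lemma exists_branches (hD : 0 < D) (hL : IsLeveled T p h) (hFp : ∀ v, T.F (p v) = p (T.F v))
    (hh : ∀ v, h (T.F v) = h v + N) (hdeg : T.IsLocalDegree degV degE)
    (hsum : ∀ v, ∑ᶠ u ∈ T.F ⁻¹' {v}, degV u = D) :
    ∃ B : T.V → Fin D → T.V, (∀ v, IsBranchList T degV v (B v)) ∧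
      ∀ v a, p (B v a) = B (p v) a := by
  have hsurj : ∀ v, ∃ w, T.F w = v := by
    intro v
    by_contra! hc
    have h1 : T.F ⁻¹' {v} = ∅ := Set.eq_empty_of_forall_notMem hc
    have h2 := hsum v
    rw [h1, finsum_mem_empty] at h2
    omega
  choose s hs using hsurj
  have hs_above : ∀ v, (N : ℤ) ≤ h v → ∀ w, T.F w = v → s v = w := by
    intro v hv w hw
    have h1 := hh (s v)
    have h2 := hh w
    rw [hs] at h1
    rw [hw] at h2
    exact hL.unique_top _ _ (by omega) (by omega)
  have htop : ∀ v, (N : ℤ) ≤ h v → IsBranchList T degV v fun _ : Fin D => s v := by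
    refine fun v hv => ⟨fun _ => hs v, fun w hw => ?_⟩
    have h1 : T.F ⁻¹' {v} = {w} := by
      ext u
      simp only [Set.mem_preimage, Set.mem_singleton_iff]
      exact ⟨fun hu => (hs_above v hv u hu).symm.trans (hs_above v hv w hw), fun hu => hu ▸ hw⟩
    have h2 := hsum v
    rw [h1, finsum_mem_singleton] at h2
    have h3 : {_a : Fin D | s v = w} = Set.univ := Set.eq_univ_of_forall fun _ => hs_above v hv w hw
    rw [h3, Set.ncard_univ, Nat.card_fin, h2]
  have hext : ∀ v (g : Fin D → T.V), IsBranchList T degV (p v) g →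
      ∃ g' : Fin D → T.V, IsBranchList T degV v g' ∧ ∀ a, p (g' a) = g a :=
    fun v g hg => hL.exists_extend_branchList hFp hdeg hg
  choose! ext hext hext' using hext
  let Bn : ℕ → T.V → Fin D → T.V := fun k =>
    Nat.rec (fun v _ => s v) (fun _ B v => ext v (B (p v))) k
  have hBn : ∀ (k : ℕ) v, (N : ℤ) ≤ h v + k → IsBranchList T degV v (Bn k v) := by
    intro k
    induction k with
    | zero => exact fun v hv => htop v (by simpa using hv)
    | succ k ih =>
      intro v hv
      refine hext v (Bn k (p v)) (ih (p v) ?_)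
      rw [hL.height_parent]
      push_cast at hv
      linarith
  refine ⟨fun v => Bn ((N : ℤ) - h v).toNat v, fun v => hBn _ v (by omega), fun v a => ?_⟩
  have h1 := hL.height_parent v
  rcases le_or_gt (N : ℤ) (h v) with hv | hv
  · have e1 : ((N : ℤ) - h v).toNat = 0 := by omega
    have e2 : ((N : ℤ) - h (p v)).toNat = 0 := by omega
    simp only [e1, e2]
    refine (hs_above (p v) (by omega) _ ?_).symm
    rw [hFp]
    exact congrArg p (hs v)
  · have e1 : ((N : ℤ) - h v).toNat = ((N : ℤ) - h (p v)).toNat + 1 := by omega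
    simp only [e1]
    exact hext' v (Bn ((N : ℤ) - h (p v)).toNat (p v)) (hBn _ _ (by omega)) a

end TreeMap.IsLeveled

/-- Labels for the vertices of a tree with dynamics, by levels and infinite words, on which the
dynamics acts by the shift, and which see the local degree. -/
structure TreeLabels (T : TreeMap) (p : T.V → T.V) (h : T.V → ℤ) (N : ℕ) (degV : T.V → ℕ)
    (lam : ℤ → Code D → T.V) : Prop where
  height : ∀ i x, h (lam i x) = i
  parent : ∀ i x, p (lam i x) = lam (i + 1) x
  map : ∀ i x, T.F (lam i x) = lam (i + N) (shift x)
  cons : ∀ i a u u', lam (i + N) u = lam (i + N) u' → lam i (cons a u) = lam i (cons a u')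
  surj : ∀ v, ∃ x, lam (h v) x = v
  count : ∀ i z, {a | lam i (Code.cons a (Code.shift z)) = lam i z}.ncard = degV (lam i z)

lemma TreeMap.IsLeveled.exists_labels {T : TreeMap} {p : T.V → T.V} {h : T.V → ℤ} {degV : T.V → ℕ}
    {degE : Sym2 T.V → ℕ} {N : ℕ} (hD : 0 < D) (hL : IsLeveled T p h)
    (hFp : ∀ v, T.F (p v) = p (T.F v)) (hN : 1 ≤ N) (hh : ∀ v, h (T.F v) = h v + N)
    (hdeg : T.IsLocalDegree degV degE) (hsum : ∀ v, ∑ᶠ u ∈ T.F ⁻¹' {v}, degV u = D) :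
    ∃ lam : ℤ → Code D → T.V, TreeLabels T p h N degV lam := by
  obtain ⟨B, hB, hpB⟩ := hL.exists_branches hD hFp hh hdeg hsum
  obtain ⟨v0, h0, -⟩ := hL.exists_base
  have hhB : ∀ v a, h (B v a) = h v - N := fun v a => by
    have h1 := hh (B v a)
    rw [(hB v).1 a] at h1
    omega
  -- the word `x` prescribes which inverse branches lead from the ray above the base down to
  -- level `i`; the result does not depend on the number `k` of steps
  let lk : ℕ → ℤ → Code D → T.V := fun k =>
    Nat.rec (fun i _ => p^[i.toNat] v0) (fun _ l i x => B (l (i + N) (Code.shift x)) (x 0)) k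
  have hnext : ∀ (k : ℕ) (i : ℤ), 0 ≤ i + ((k + 1 : ℕ) : ℤ) * N → 0 ≤ i + N + k * N := by
    intro k i hi
    push_cast at hi
    linarith
  have hheight : ∀ (k : ℕ) i x, 0 ≤ i + (k : ℤ) * N → h (lk k i x) = i := by
    intro k
    induction k with
    | zero =>
      intro i x hi
      change h (p^[i.toNat] v0) = i
      rw [hL.height_iterate, h0]
      simp only [Nat.cast_zero, zero_mul, add_zero] at hi
      omega
    | succ k ih =>
      intro i x hi
      change h (B (lk k (i + N) (Code.shift x)) (x 0)) = i
      rw [hhB, ih _ _ (hnext k i hi)]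
      ring
  have hstab : ∀ (k : ℕ) i x, 0 ≤ i + (k : ℤ) * N → lk (k + 1) i x = lk k i x := by
    intro k
    induction k with
    | zero =>
      intro i x hi
      have h1 := hheight 0 i x hi
      have h2 := hheight (0 + 1) i x (by push_cast at hi ⊢; linarith)
      refine hL.unique_top _ _ ?_ (by rw [h1, h2])
      rw [h2]
      simpa using hi
    | succ k ih =>
      intro i x hi
      change B (lk (k + 1) (i + N) (Code.shift x)) (x 0) = B (lk k (i + N) (Code.shift x)) (x 0)
      rw [ih _ _ (hnext k i hi)]
  have hstab' : ∀ (m k : ℕ) i x, 0 ≤ i + (k : ℤ) * N → lk (k + m) i x = lk k i x := by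
    intro m k i x hi
    induction m with
    | zero => rfl
    | succ m ih =>
      rw [← ih]
      refine hstab (k + m) i x (hi.trans ?_)
      push_cast
      nlinarith
  have hnat : ∀ i : ℤ, 0 ≤ i + (i.natAbs : ℤ) * N := by
    intro i
    have h1 : (i.natAbs : ℤ) * 1 ≤ i.natAbs * N := by
      gcongr
      exact_mod_cast hN
    omega
  let lam : ℤ → Code D → T.V := fun i x => lk i.natAbs i x
  have hlam : ∀ (k : ℕ) i x, 0 ≤ i + (k : ℤ) * N → lam i x = lk k i x := by
    intro k i x hi
    rw [← hstab' i.natAbs k i x hi, add_comm]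
    exact (hstab' k i.natAbs i x (hnat i)).symm
  have hcons : ∀ i x, lam i x = B (lam (i + N) (Code.shift x)) (x 0) := by
    intro i x
    have h1 := hnat (i + N)
    rw [hlam ((i + (N : ℤ)).natAbs + 1) i x (by
      rw [Nat.cast_add, Nat.cast_one, add_mul, one_mul]
      linarith)]
  have hlh : ∀ i x, h (lam i x) = i := fun i x => hheight _ i x (hnat i)
  have hpar : ∀ (k : ℕ) i x, 0 ≤ i + (k : ℤ) * N → p (lk k i x) = lk k (i + 1) x := by
    intro k
    induction k with
    | zero =>
      intro i x hi
      change p (p^[i.toNat] v0) = p^[(i + 1).toNat] v0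
      simp only [Nat.cast_zero, zero_mul, add_zero] at hi
      have e : (i + 1).toNat = i.toNat + 1 := by omega
      rw [e, Function.iterate_succ_apply']
    | succ k ih =>
      intro i x hi
      change p (B (lk k (i + N) (Code.shift x)) (x 0)) =
        B (lk k (i + 1 + N) (Code.shift x)) (x 0)
      rw [hpB, ih _ _ (hnext k i hi), add_right_comm]
  refine ⟨lam, hlh, fun i x => ?_, fun i x => ?_, fun i a u u' huu => ?_, fun v => ?_,
    fun i z => ?_⟩
  · rw [hlam i.natAbs (i + 1) x (by have := hnat i; linarith)]
    exact hpar _ i x (hnat i)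
  · rw [hcons i x, (hB _).1]
  · rw [hcons i (Code.cons a u), hcons i (Code.cons a u'), shift_cons, shift_cons, huu, cons_zero,
      cons_zero]
  · have key : ∀ (k : ℕ) v, 0 ≤ h v + (k : ℤ) * N → ∃ x, lam (h v) x = v := by
      intro k
      induction k with
      | zero =>
        intro v hv
        refine ⟨fun _ => ⟨0, hD⟩, hL.unique_top _ _ ?_ (hlh _ _)⟩
        rw [hlh]
        simpa using hv
      | succ k ih =>
        intro v hv
        obtain ⟨y, hy⟩ := ih (T.F v) (by
          rw [hh]
          exact hnext k _ hv)
        have h1 := (hB (T.F v)).2 v rfl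
        have h2 : {a | B (T.F v) a = v}.Nonempty := by
          rw [← Set.ncard_pos, h1]
          exact hdeg.vertex_pos v
        obtain ⟨a, ha⟩ := h2
        refine ⟨Code.cons a y, ?_⟩
        rw [hcons, shift_cons, cons_zero, ← hh, hy]
        exact ha
    exact key _ v (hnat (h v))
  · have h1 : T.F (lam i z) = lam (i + N) (Code.shift z) := by rw [hcons i z, (hB _).1]
    rw [← (hB _).2 (lam i z) rfl, h1]
    congr 1
    ext a
    simp only [Set.mem_ofPred_eq]
    rw [hcons i (Code.cons a _), shift_cons, cons_zero]

/-! ### Heights and distances in a metrized polynomial-like tree -/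

/-- The levels of a metrized tree, with the dynamics raising levels by `N`. -/
structure MTree.IsDynLeveled (X : MTree D) (p : X.V → X.V) (h : X.V → ℤ) (N : ℕ) : Prop extends
    X.IsLeveled p h where
  two_le : 2 ≤ D
  map_parent : ∀ v, X.F (p v) = p (X.F v)
  one_le : 1 ≤ N
  height_map : ∀ v, h (X.F v) = h v + N

/-- The height of a vertex above the ends below it, measured with the metric: since the metric is
expanded by the factor `D`, it is a multiple of the distance from `v` up to the level of `F v`. -/
noncomputable def MTree.elev (X : MTree D) (p : X.V → X.V) (N : ℕ) (v : X.V) : ℝ :=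
  X.d v (p^[N] v) / ((D : ℝ) - 1)

namespace MTree.IsDynLeveled

variable {X : MTree D} {p : X.V → X.V} {h : X.V → ℤ} {N : ℕ}

lemma one_lt (hL : X.IsDynLeveled p h N) : (1 : ℝ) < D := by
  have := hL.two_le
  exact_mod_cast this

lemma d_add (hL : X.IsDynLeveled p h N) {v a b : X.V} (ha : ∃ n, p^[n] a = v)
    (hb : ¬ ∃ n, p^[n] b = v) : X.d a v + X.d v b = X.d a b ∧
      X.d a (p v) + X.d (p v) b = X.d a b := by
  obtain ⟨q, hq⟩ := (X.isTree.existsUnique_path a b).exists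
  obtain ⟨h1, h2⟩ := hL.exists_exit q ha hb
  exact ⟨X.heightMetric.path a v b q hq (SimpleGraph.Walk.fst_mem_support_of_mem_edges _ h1),
    X.heightMetric.path a (p v) b q hq h2⟩

lemma d_iterate_succ (hL : X.IsDynLeveled p h N) (k : ℕ) (v : X.V) :
    X.d v (p^[k + 1] v) = X.d v (p v) + X.d (p v) (p^[k] (p v)) := by
  refine (hL.d_add ⟨0, rfl⟩ ?_).2.symm
  rintro ⟨n, hn⟩
  have h1 := hL.height_iterate n (p^[k + 1] v)
  have h2 := hL.height_iterate (k + 1) v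
  rw [hn, Function.iterate_zero_apply] at h1
  push_cast at h2
  omega

lemma d_iterate_succ' (hL : X.IsDynLeveled p h N) (k : ℕ) (v : X.V) :
    X.d v (p^[k + 1] v) = X.d v (p^[k] v) + X.d (p^[k] v) (p (p^[k] v)) := by
  rw [← Function.iterate_succ_apply' p]
  refine (hL.d_add ⟨k, rfl⟩ ?_).1.symm
  rintro ⟨n, hn⟩
  have h1 := hL.height_iterate n (p^[k + 1] v)
  rw [hn, hL.height_iterate, hL.height_iterate] at h1
  push_cast at h1
  omega

lemma d_parent_pos (hL : X.IsDynLeveled p h N) (v : X.V) : 0 < X.d v (p v) :=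
  lt_of_le_of_ne (X.d_nonneg _ _) fun h0 =>
    (hL.adj_parent v).ne (X.heightMetric.eq_of_zero _ _ h0.symm)

lemma d_map_parent (hL : X.IsDynLeveled p h N) (v : X.V) :
    X.d (X.F v) (p (X.F v)) = D * X.d v (p v) := by
  rw [← hL.map_parent, X.heightMetric.expand _ _ (hL.adj_parent v)]

lemma d_parent_eq (hL : X.IsDynLeveled p h N) {v w : X.V} (hvw : h v = h w) :
    X.d v (p v) = X.d w (p w) := by
  have hD := hL.one_lt
  have key : ∀ (k : ℕ) v w, h v = h w → 0 ≤ h v + k * N → X.d v (p v) = X.d w (p w) := by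
    intro k
    induction k with
    | zero =>
      intro v w hvw hv
      rw [hL.unique_top v w (by simpa using hv) hvw]
    | succ k ih =>
      intro v w hvw hv
      have h1 := ih (X.F v) (X.F w) (by rw [hL.height_map, hL.height_map, hvw]) (by
        rw [hL.height_map]
        push_cast at hv
        linarith)
      rw [hL.d_map_parent, hL.d_map_parent] at h1
      exact mul_left_cancel₀ (by linarith) h1
  refine key (h v).natAbs v w hvw ?_
  have h1 : ((h v).natAbs : ℤ) * 1 ≤ (h v).natAbs * N := by
    gcongr
    exact_mod_cast hL.one_le
  omega

lemma d_iterate_eq (hL : X.IsDynLeveled p h N) (k : ℕ) {v w : X.V} (hvw : h v = h w) :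
    X.d v (p^[k] v) = X.d w (p^[k] w) := by
  induction k generalizing v w with
  | zero => simp [X.heightMetric.self]
  | succ k ih =>
    rw [hL.d_iterate_succ, hL.d_iterate_succ, hL.d_parent_eq hvw,
      ih (v := p v) (w := p w) (by rw [hL.height_parent, hL.height_parent, hvw])]

lemma elev_eq (hL : X.IsDynLeveled p h N) {v w : X.V} (hvw : h v = h w) :
    X.elev p N v = X.elev p N w := by
  rw [elev, elev, hL.d_iterate_eq N hvw]

lemma elev_map (hL : X.IsDynLeveled p h N) (v : X.V) : X.elev p N (X.F v) = D * X.elev p N v := by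
  have key : ∀ k v, X.d (X.F v) (p^[k] (X.F v)) = D * X.d v (p^[k] v) := by
    intro k
    induction k with
    | zero => simp [X.heightMetric.self]
    | succ k ih =>
      intro v
      rw [hL.d_iterate_succ, hL.d_iterate_succ, hL.d_map_parent, ← hL.map_parent, ih, mul_add]
  rw [elev, elev, key, mul_div_assoc]

lemma elev_parent (hL : X.IsDynLeveled p h N) (v : X.V) :
    X.elev p N (p v) = X.elev p N v + X.d v (p v) := by
  have hD := hL.one_lt
  have h1 := hL.d_iterate_succ N v
  have h2 := hL.d_iterate_succ' N v
  have h3 : X.d (p^[N] v) (p (p^[N] v)) = D * X.d v (p v) := by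
    rw [← hL.d_map_parent]
    refine hL.d_parent_eq ?_
    rw [hL.height_iterate, hL.height_map]
  rw [elev, elev, div_add' _ _ _ (by linarith : (D : ℝ) - 1 ≠ 0).symm.symm]
  congr 1
  linarith

lemma d_iterate (hL : X.IsDynLeveled p h N) (k : ℕ) (v : X.V) :
    X.d v (p^[k] v) = X.elev p N (p^[k] v) - X.elev p N v := by
  induction k with
  | zero => simp [X.heightMetric.self]
  | succ k ih =>
    rw [hL.d_iterate_succ', ih, Function.iterate_succ_apply', hL.elev_parent]
    ring

lemma elev_pos (hL : X.IsDynLeveled p h N) (v : X.V) : 0 < X.elev p N v := by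
  refine div_pos ?_ (by have := hL.one_lt; linarith)
  obtain ⟨n, hn⟩ := Nat.exists_eq_add_of_le' hL.one_le
  rw [hn, hL.d_iterate_succ]
  have h1 := hL.d_parent_pos v
  have h2 := X.d_nonneg (p v) (p^[n] (p v))
  linarith

end MTree.IsDynLeveled

namespace TreeMap.IsLeveled

variable {T : TreeMap} {p : T.V → T.V} {h : T.V → ℤ} {degV : T.V → ℕ} {degE : Sym2 T.V → ℕ}

lemma finite_iterate_fiber (hL : IsLeveled T p h) (k : ℕ) (v : T.V) : {w | p^[k] w = v}.Finite := by
  induction k generalizing v with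
  | zero => exact (Set.finite_singleton v).subset fun w hw => hw
  | succ k ih =>
    refine ((hL.finite_children v).biUnion fun u _ => ih u).subset fun w hw => ?_
    rw [Set.mem_ofPred_eq, Function.iterate_succ_apply'] at hw
    exact Set.mem_biUnion (show p^[k] w ∈ {u | p u = v} from hw) rfl

lemma ncard_iterate_fiber_succ (hL : IsLeveled T p h) (k : ℕ) (v : T.V) :
    {w | p^[k + 1] w = v}.ncard = ∑ u ∈ (hL.finite_children v).toFinset, {w | p^[k] w = u}.ncard := by
  classical
  rw [Set.ncard_eq_toFinset_card _ (hL.finite_iterate_fiber (k + 1) v),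
    Finset.card_eq_sum_card_fiberwise (f := p^[k]) (t := (hL.finite_children v).toFinset)]
  · refine Finset.sum_congr rfl fun u hu => ?_
    have hu' : p u = v := by simpa using hu
    rw [Set.ncard_eq_toFinset_card _ (hL.finite_iterate_fiber k u)]
    congr 1
    ext w
    simp only [Finset.mem_filter, Set.Finite.mem_toFinset, Set.mem_ofPred_eq,
      Function.iterate_succ_apply', and_iff_right_iff_imp]
    rintro rfl
    exact hu'
  · intro w hw
    simpa [Function.iterate_succ_apply'] using hw

/-- The Riemann–Hurwitz inequality for the descendants of a vertex `k` levels down. -/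
lemma riemannHurwitz (hL : IsLeveled T p h) (hFp : ∀ v, T.F (p v) = p (T.F v))
    (hdeg : T.IsLocalDegree degV degE) (k : ℕ) (v : T.V) :
    degV v * {w | p^[k] w = T.F v}.ncard + 1 ≤ {w | p^[k] w = v}.ncard + degV v := by
  classical
  induction k generalizing v with
  | zero =>
    have e : ∀ v : T.V, {w | p^[0] w = v} = {v} := fun v => rfl
    rw [e, e, Set.ncard_singleton, Set.ncard_singleton]
    omega
  | succ k ih =>
    rw [hL.ncard_iterate_fiber_succ, hL.ncard_iterate_fiber_succ]
    have h1 : ∑ w ∈ (hL.finite_children v).toFinset, degV w * {u | p^[k] u = T.F w}.ncard =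
        degV v * ∑ u ∈ (hL.finite_children (T.F v)).toFinset, {w | p^[k] w = u}.ncard := by
      rw [← Finset.sum_fiberwise_of_maps_to (t := (hL.finite_children (T.F v)).toFinset) (g := T.F),
        Finset.mul_sum]
      · refine Finset.sum_congr rfl fun u hu => ?_
        have hu' : p u = T.F v := by simpa using hu
        have hf : {w | p w = v ∧ T.F w = u}.Finite :=
          (hL.finite_children v).subset fun _ hw => hw.1
        rw [hL.degV_eq_sum hFp hdeg hu', finsum_mem_eq_finite_toFinset_sum _ hf, Finset.sum_mul]
        refine Finset.sum_congr ?_ fun w hw => ?_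
        · ext w
          simp
        · have hw' : p w = v ∧ T.F w = u := by simpa using hw
          rw [hw'.2]
      · intro w hw
        have hw' : p w = v := by simpa using hw
        simp [← hFp, hw']
    have h2 := hL.sum_degV_sub_one_le hFp hdeg v
    have h3 : ∑ w ∈ (hL.finite_children v).toFinset,
        ((degV w : ℤ) * {u | p^[k] u = T.F w}.ncard - ((degV w : ℤ) - 1)) ≤
          ∑ w ∈ (hL.finite_children v).toFinset, ({u | p^[k] u = w}.ncard : ℤ) := by
      refine Finset.sum_le_sum fun w _ => ?_
      have := ih w
      zify at this
      linarith
    rw [Finset.sum_sub_distrib] at h3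
    zify at h1 ⊢
    linarith

end TreeMap.IsLeveled

/-! ### Every tree is labelled by a tree metric -/

/-- The height of level `i`, normalized to be `1` at the base. -/
noncomputable def MTree.relHeight (X : MTree D) (p : X.V → X.V) (N : ℕ) (lam : ℤ → Code D → X.V)
    (o : Code D) (i : ℤ) : ℝ :=
  X.elev p N (lam i o) / X.elev p N (lam 0 o)

namespace TreeLabels

variable {X : MTree D} {p : X.V → X.V} {h : X.V → ℤ} {N : ℕ} {degV : X.V → ℕ}
  {lam : ℤ → Code D → X.V} {o : Code D}

lemma eq_mono (hl : TreeLabels X.toTreeMap p h N degV lam) {i j : ℤ} (hij : i ≤ j) {x y : Code D}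
    (hxy : lam i x = lam i y) : lam j x = lam j y := by
  induction j, hij using Int.leInduction with
  | base => exact hxy
  | succ j _ ih => rw [← hl.parent, ← hl.parent, ih]

lemma iterate_parent (hl : TreeLabels X.toTreeMap p h N degV lam) (n : ℕ) (i : ℤ) (x : Code D) :
    p^[n] (lam i x) = lam (i + n) x := by
  induction n with
  | zero => simp
  | succ n ih =>
    rw [Function.iterate_succ_apply', ih, hl.parent]
    congr 1
    push_cast
    ring

lemma top (hL : X.IsDynLeveled p h N) (hl : TreeLabels X.toTreeMap p h N degV lam) {i : ℤ}
    (hi : 0 ≤ i) (x y : Code D) : lam i x = lam i y :=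
  hL.unique_top _ _ (by rwa [hl.height]) (by rw [hl.height, hl.height])

lemma elev_lam (hL : X.IsDynLeveled p h N) (hl : TreeLabels X.toTreeMap p h N degV lam) (i : ℤ)
    (x : Code D) : X.elev p N (lam i x) = X.elev p N (lam 0 o) * X.relHeight p N lam o i := by
  rw [MTree.relHeight, mul_div_cancel₀ _ (hL.elev_pos _).ne']
  exact hL.elev_eq (by rw [hl.height, hl.height])

lemma relHeight_pos (hL : X.IsDynLeveled p h N) (i : ℤ) : 0 < X.relHeight p N lam o i :=
  div_pos (hL.elev_pos _) (hL.elev_pos _)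

lemma relHeight_zero (hL : X.IsDynLeveled p h N) : X.relHeight p N lam o 0 = 1 :=
  div_self (hL.elev_pos _).ne'

lemma relHeight_strictMono (hL : X.IsDynLeveled p h N)
    (hl : TreeLabels X.toTreeMap p h N degV lam) : StrictMono (X.relHeight p N lam o) := by
  refine strictMono_int_of_lt_succ fun i => ?_
  rw [MTree.relHeight, MTree.relHeight, ← hl.parent, hL.elev_parent]
  have h1 := hL.d_parent_pos (lam i o)
  have h2 := hL.elev_pos (lam 0 o)
  gcongr
  linarith

lemma relHeight_add (hL : X.IsDynLeveled p h N) (hl : TreeLabels X.toTreeMap p h N degV lam)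
    (i : ℤ) : X.relHeight p N lam o (i + N) = D * X.relHeight p N lam o i := by
  rw [MTree.relHeight, MTree.relHeight, ← mul_div_assoc, ← hL.elev_map, hl.map]
  congr 1
  exact hL.elev_eq (by rw [hl.height, hl.height])

lemma relHeight_add_mul (hL : X.IsDynLeveled p h N) (hl : TreeLabels X.toTreeMap p h N degV lam)
    (i k : ℤ) : X.relHeight p N lam o (i + k * N) = D ^ k * X.relHeight p N lam o i := by
  have hD := hL.one_lt
  have hD0 : (D : ℝ) ≠ 0 := by linarith
  induction k using Int.induction_on with
  | zero => simp
  | succ k ih =>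
    rw [show i + ((k : ℤ) + 1) * N = i + k * N + N by ring, relHeight_add hL hl, ih,
      zpow_add_one₀ hD0]
    ring
  | pred k ih =>
    rw [show i + -(k : ℤ) * N = i + (-(k : ℤ) - 1) * N + N by ring, relHeight_add hL hl] at ih
    rw [zpow_sub_one₀ hD0, mul_right_comm, ← ih]
    field_simp

lemma exists_relHeight_lt (hL : X.IsDynLeveled p h N) (hl : TreeLabels X.toTreeMap p h N degV lam)
    {s : ℝ} (hs : 0 < s) : ∃ i, X.relHeight p N lam o i < s := by
  have hD := hL.one_lt
  obtain ⟨k, hk⟩ := exists_pow_lt_of_lt_one hs (inv_lt_one_of_one_lt₀ hD)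
  refine ⟨0 + (-k) * N, ?_⟩
  rw [relHeight_add_mul hL hl, relHeight_zero hL, mul_one, zpow_neg, zpow_natCast, ← inv_pow]
  exact hk

lemma exists_floor (hL : X.IsDynLeveled p h N) (hl : TreeLabels X.toTreeMap p h N degV lam)
    {s : ℝ} (hs : 0 < s) :
    ∃ i, X.relHeight p N lam o i ≤ s ∧ s < X.relHeight p N lam o (i + 1) := by
  have hD := hL.one_lt
  obtain ⟨j, hj⟩ := exists_relHeight_lt (o := o) hL hl hs
  obtain ⟨k, hk⟩ := pow_unbounded_of_one_lt s hD
  have hk' : s < X.relHeight p N lam o (0 + (k : ℤ) * N) := by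
    rw [relHeight_add_mul hL hl, relHeight_zero hL, mul_one, zpow_natCast]
    exact hk
  obtain ⟨i, hi, hmax⟩ := Int.exists_greatest_of_bdd (P := fun i => X.relHeight p N lam o i ≤ s)
    ⟨0 + (k : ℤ) * N, fun z hz =>
      ((relHeight_strictMono hL hl).lt_iff_lt.1 (lt_of_le_of_lt hz hk')).le⟩ ⟨j, hj.le⟩
  refine ⟨i, hi, not_le.1 fun h1 => ?_⟩
  have := hmax _ h1
  omega

/-- The height, as a tree metric value, at which two ends branch. -/
lemma exists_merge (hL : X.IsDynLeveled p h N) (hl : TreeLabels X.toTreeMap p h N degV lam)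
    (x y : Code D) : ∃ r, (r = 0 ∨ ∃ j, X.relHeight p N lam o j = r) ∧
      ∀ i, r ≤ X.relHeight p N lam o i ↔ lam i x = lam i y := by
  by_cases hall : ∀ i, lam i x = lam i y
  · exact ⟨0, Or.inl rfl, fun i => iff_of_true (relHeight_pos hL i).le (hall i)⟩
  · push Not at hall
    obtain ⟨b, hb⟩ := hall
    obtain ⟨j, hj, hmin⟩ := Int.exists_least_of_bdd (P := fun i => lam i x = lam i y)
      ⟨b, fun z hz => le_of_lt (not_le.1 fun hzb => hb (hl.eq_mono hzb hz))⟩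
      ⟨0, hl.top hL le_rfl x y⟩
    refine ⟨_, Or.inr ⟨j, rfl⟩, fun i => ?_⟩
    rw [(relHeight_strictMono hL hl).le_iff_le]
    exact ⟨fun hji => hl.eq_mono hji hj, hmin i⟩

end TreeLabels

/-- `ρ` records the relative heights of the branch points of the ends of a labelled tree. -/
structure IsMergeMetric (X : MTree D) (p : X.V → X.V) (N : ℕ) (lam : ℤ → Code D → X.V)
    (o : Code D) (ρ : Code D → Code D → ℝ) : Prop where
  value : ∀ x y, ρ x y = 0 ∨ ∃ j, X.relHeight p N lam o j = ρ x y
  le_iff : ∀ x y i, ρ x y ≤ X.relHeight p N lam o i ↔ lam i x = lam i y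

namespace IsMergeMetric

variable {X : MTree D} {p : X.V → X.V} {h : X.V → ℤ} {N : ℕ} {degV : X.V → ℕ}
  {degE : Sym2 X.V → ℕ} {lam : ℤ → Code D → X.V} {o : Code D} {ρ : Code D → Code D → ℝ}

lemma le_of_forall (hL : X.IsDynLeveled p h N) (hl : TreeLabels X.toTreeMap p h N degV lam)
    (hm : IsMergeMetric X p N lam o ρ) {x y : Code D} {s : ℝ}
    (hs : s = 0 ∨ ∃ j, X.relHeight p N lam o j = s)
    (hxy : ∀ i, s ≤ X.relHeight p N lam o i → lam i x = lam i y) : ρ x y ≤ s := by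
  rcases hs with rfl | ⟨j, rfl⟩
  · refine le_of_not_gt fun h0 => ?_
    obtain ⟨i, hi⟩ := TreeLabels.exists_relHeight_lt (o := o) hL hl h0
    exact absurd ((hm.le_iff x y i).2 (hxy i (TreeLabels.relHeight_pos hL i).le)) (not_le.2 hi)
  · exact (hm.le_iff x y j).2 (hxy j le_rfl)

lemma isTreeMetric (hL : X.IsDynLeveled p h N) (hl : TreeLabels X.toTreeMap p h N degV lam)
    (hdeg : X.IsLocalDegree degV degE) (hm : IsMergeMetric X p N lam o ρ) : IsTreeMetric ρ := by
  have hD := hL.one_lt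
  have hD0 : (0 : ℝ) < D := by linarith
  have hle : ∀ {x y : Code D} {s : ℝ}, (s = 0 ∨ ∃ j, X.relHeight p N lam o j = s) →
      (∀ i, s ≤ X.relHeight p N lam o i → lam i x = lam i y) → ρ x y ≤ s :=
    fun hs hxy => hm.le_of_forall hL hl hs hxy
  have hnonneg : ∀ x y, 0 ≤ ρ x y := fun x y => by
    rcases hm.value x y with h0 | ⟨j, hj⟩
    · exact h0.ge
    · rw [← hj]
      exact (TreeLabels.relHeight_pos hL j).le
  have hmono := TreeLabels.relHeight_strictMono (o := o) hL hl
  have hadd := TreeLabels.relHeight_add (o := o) hL hl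
  have hsub : ∀ i, X.relHeight p N lam o (i - N) = X.relHeight p N lam o i / D := fun i => by
    rw [eq_div_iff hD0.ne', mul_comm, ← hadd, sub_add_cancel]
  have hscale : ∀ s, (s = 0 ∨ ∃ j, X.relHeight p N lam o j = s) →
      (D * s = 0 ∨ ∃ j, X.relHeight p N lam o j = D * s) ∧
      (s / D = 0 ∨ ∃ j, X.relHeight p N lam o j = s / D) := by
    rintro s (rfl | ⟨j, rfl⟩)
    · exact ⟨Or.inl (mul_zero _), Or.inl (zero_div _)⟩
    · exact ⟨Or.inr ⟨_, hadd j⟩, Or.inr ⟨_, hsub j⟩⟩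
  have hcons : ∀ i a u u', lam i (Code.cons a u) = lam i (Code.cons a u') ↔
      lam (i + N) u = lam (i + N) u' := by
    intro i a u u'
    refine ⟨fun h1 => ?_, hl.cons i a u u'⟩
    have h2 := congrArg X.F h1
    rwa [hl.map, hl.map, shift_cons, shift_cons] at h2
  have hfloor : ∀ {s : ℝ} {i : ℤ}, X.relHeight p N lam o i ≤ s → s < X.relHeight p N lam o (i + 1) →
      ∀ x y, ρ x y ≤ s ↔ lam i x = lam i y := by
    intro s i h1 h2 x y
    rw [← hm.le_iff]
    refine ⟨fun h3 => ?_, fun h3 => h3.trans h1⟩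
    rcases hm.value x y with h0 | ⟨j, hj⟩
    · rw [h0]
      exact (TreeLabels.relHeight_pos hL i).le
    · rw [← hj] at h3 ⊢
      have := hmono.lt_iff_lt.1 (h3.trans_lt h2)
      exact hmono.monotone (by omega)
  have hcnt : ∀ {s s' : ℝ} {i : ℤ} {k : ℕ}, (∀ x y, ρ x y ≤ s ↔ lam (i + k) x = lam (i + k) y) →
      (∀ x y, ρ x y ≤ s' ↔ lam i x = lam i y) → ∀ z,
      cnt ρ s' (ball ρ s z) = {w | p^[k] w = lam (i + k) z}.ncard := by
    intro s s' i k hs hs' z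
    have : Nonempty (Code D) := ⟨z⟩
    have h1 : {w | p^[k] w = lam (i + k) z} = lam i '' ball ρ s z := by
      ext w
      constructor
      · intro hw
        have hw' : p^[k] w = lam (i + k) z := hw
        obtain ⟨y, hy⟩ := hl.surj w
        have h2 := hL.height_iterate k w
        rw [hw', hl.height] at h2
        have h3 : h w = i := by linarith
        rw [h3] at hy
        refine ⟨y, (hs z y).2 ?_, hy⟩
        rw [← hw', ← hl.iterate_parent k i y, hy]
      · rintro ⟨y, hy, rfl⟩
        change p^[k] (lam i y) = _
        rw [hl.iterate_parent]
        exact ((hs z y).1 hy).symm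
    rw [h1, cnt]
    refine ncard_image_eq_of_iff _ _ (fun a b => ?_) _
    constructor
    · intro hab
      have hb : b ∈ ball ρ s' b := (hs' b b).2 rfl
      rw [← hab] at hb
      exact (hs' a b).1 hb
    · intro hab
      ext y
      change ρ a y ≤ s' ↔ ρ b y ≤ s'
      rw [hs', hs', hab]
  refine ⟨fun x => ?_, fun x y => ?_, fun x y z => ?_, fun a u u' => ?_, fun x y => ?_,
    fun x y => ?_, ?_, fun z s s' hs' hss => ?_⟩
  · exact le_antisymm (hle (Or.inl rfl) fun i _ => rfl) (hnonneg x x)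
  · exact le_antisymm (hle (hm.value y x) fun i hi => ((hm.le_iff _ _ _).1 hi).symm)
      (hle (hm.value x y) fun i hi => ((hm.le_iff _ _ _).1 hi).symm)
  · refine hle ?_ fun i hi => ?_
    · rcases max_choice (ρ x y) (ρ y z) with h1 | h1 <;> rw [h1]
      · exact hm.value x y
      · exact hm.value y z
    · exact ((hm.le_iff _ _ _).1 ((le_max_left _ _).trans hi)).trans
        ((hm.le_iff _ _ _).1 ((le_max_right _ _).trans hi))
  · refine le_antisymm (hle (hscale _ (hm.value u u')).2 fun i hi => ?_) ?_
    · rw [div_le_iff₀' hD0, ← hadd] at hi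
      exact (hcons _ _ _ _).2 ((hm.le_iff _ _ _).1 hi)
    · rw [div_le_iff₀' hD0]
      refine hle (hscale _ (hm.value _ _)).1 fun i hi => ?_
      rw [mul_comm, ← le_div_iff₀ hD0, ← hsub] at hi
      have h1 := (hcons _ _ _ _).1 ((hm.le_iff _ _ _).1 hi)
      rwa [sub_add_cancel] at h1
  · refine hle (hscale _ (hm.value x y)).1 fun i hi => ?_
    rw [mul_comm, ← le_div_iff₀ hD0, ← hsub] at hi
    have h1 := congrArg X.F ((hm.le_iff _ _ _).1 hi)
    rwa [hl.map, hl.map, sub_add_cancel] at h1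
  · have h1 := (hm.le_iff x y 0).2 (hl.top hL le_rfl x y)
    rwa [TreeLabels.relHeight_zero hL] at h1
  · obtain ⟨v, hv, w, w', hne, hw, hw'⟩ := hL.exists_base
    have hhw : h w = -1 ∧ h w' = -1 := by
      have h1 := hL.height_parent w
      have h2 := hL.height_parent w'
      rw [hw, hv] at h1
      rw [hw', hv] at h2
      omega
    obtain ⟨x, hx⟩ := hl.surj w
    obtain ⟨y, hy⟩ := hl.surj w'
    rw [hhw.1] at hx
    rw [hhw.2] at hy
    refine ⟨x, y, ?_⟩
    have h1 : ¬ ρ x y ≤ X.relHeight p N lam o (-1) := fun h2 =>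
      hne (by rw [← hx, ← hy]; exact (hm.le_iff _ _ _).1 h2)
    have h2 : ρ x y ≤ X.relHeight p N lam o 0 := (hm.le_iff x y 0).2 (hl.top hL le_rfl x y)
    rcases hm.value x y with h0 | ⟨j, hj⟩
    · rw [h0] at h1
      exact absurd (TreeLabels.relHeight_pos hL _).le h1
    · rw [← hj] at h1 h2
      rw [not_le, hmono.lt_iff_lt] at h1
      rw [hmono.le_iff_le] at h2
      obtain rfl : j = 0 := by omega
      rw [← hj, TreeLabels.relHeight_zero hL]
  · obtain ⟨j, hj, hj'⟩ := TreeLabels.exists_floor (o := o) hL hl (hs'.trans_le hss)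
    obtain ⟨i, hi, hi'⟩ := TreeLabels.exists_floor (o := o) hL hl hs'
    have hij : i ≤ j := by
      have := hmono.lt_iff_lt.1 ((hi.trans hss).trans_lt hj')
      omega
    obtain ⟨k, rfl⟩ := Int.exists_add_of_le hij
    have hmul : ∀ {t : ℝ} {l : ℤ}, X.relHeight p N lam o l ≤ t → t < X.relHeight p N lam o (l + 1) →
        ∀ x y, ρ x y ≤ D * t ↔ lam (l + N) x = lam (l + N) y := fun h1 h2 => hfloor (by
          rw [hadd]
          gcongr) (by
          rw [add_right_comm, hadd]
          gcongr)
    have hN2 : i + k + (N : ℤ) = i + N + k := by ring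
    have hmul2 := hmul hj hj'
    rw [hN2] at hmul2
    have hd : deg ρ s z = degV (lam (i + k) z) := by
      classical
      rw [← hl.count, deg, Set.ncard_eq_toFinset_card']
      congr 1
      ext a
      simp only [Finset.mem_filter, Finset.mem_univ, true_and, Set.mem_toFinset, Set.mem_ofPred_eq]
      exact hfloor hj hj' _ _
    rw [hcnt (hfloor hj hj') (hfloor hi hi'), hcnt hmul2 (hmul hi hi'), hd, ← hN2, ← hl.map]
    exact hL.riemannHurwitz hL.map_parent hdeg k _

lemma isEnum (hL : X.IsDynLeveled p h N) (hl : TreeLabels X.toTreeMap p h N degV lam)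
    (hm : IsMergeMetric X p N lam o ρ) : IsEnum ρ N (X.relHeight p N lam o) where
  one_le := hL.one_le
  strictMono := TreeLabels.relHeight_strictMono hL hl
  zero := TreeLabels.relHeight_zero hL
  add := TreeLabels.relHeight_add hL hl
  exists_eq s hs := by
    obtain ⟨k, _, ⟨h0, x, y, rfl⟩, rfl⟩ := hs
    obtain ⟨j, hj⟩ := (hm.value x y).resolve_left h0.ne'
    exact ⟨j + k * N, by rw [TreeLabels.relHeight_add_mul hL hl, hj]⟩
  isHeight i := by
    -- the grand orbit of a vertex on level `i` contains a branch point
    obtain ⟨w, ⟨n, m, -, -, hnm⟩, hw⟩ := X.polyLike.grand_orbit (lam i o)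
    have hiter : ∀ n v, h (X.F^[n] v) = h v + n * N := by
      intro n v
      induction n with
      | zero => simp
      | succ n ih =>
        rw [Function.iterate_succ_apply', hL.height_map, ih]
        push_cast
        ring
    have h1 := congrArg h hnm
    rw [hiter, hiter, hl.height] at h1
    obtain ⟨u, u', hne, hu, hu'⟩ := hL.exists_children hw
    obtain ⟨x, hx⟩ := hl.surj u
    obtain ⟨y, hy⟩ := hl.surj u'
    have h2 := hL.height_parent u
    have h3 := hL.height_parent u'
    rw [hu] at h2
    rw [hu'] at h3
    have h4 : h u' = h u := by linarith
    rw [h4] at hy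
    have h5 : ρ x y ≤ X.relHeight p N lam o (h w) := by
      rw [hm.le_iff, h2, ← hl.parent, ← hl.parent, hx, hy, hu, hu']
    have h6 : ¬ ρ x y ≤ X.relHeight p N lam o (h u) := by
      rw [hm.le_iff, hx, hy]
      exact hne
    have hmono := TreeLabels.relHeight_strictMono (o := o) hL hl
    have h7 : X.relHeight p N lam o (h w) = ρ x y := by
      rcases hm.value x y with h0 | ⟨j, hj⟩
      · rw [h0] at h6
        exact absurd (TreeLabels.relHeight_pos hL _).le h6
      · rw [← hj, hmono.le_iff_le] at h5 h6
        obtain rfl : j = h w := by omega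
        exact hj
    refine ⟨(m : ℤ) - n, ρ x y, ⟨?_, x, y, rfl⟩, ?_⟩
    · rw [← h7]
      exact TreeLabels.relHeight_pos hL _
    · rw [← h7, ← TreeLabels.relHeight_add_mul hL hl]
      congr 1
      linarith

lemma labelling (hL : X.IsDynLeveled p h N) (hl : TreeLabels X.toTreeMap p h N degV lam)
    (hm : IsMergeMetric X p N lam o ρ) :
    Labelling X ρ (X.elev p N (lam 0 o)) N (X.relHeight p N lam o) lam where
  surj v := by
    obtain ⟨x, hx⟩ := hl.surj v
    exact ⟨_, x, hx⟩
  top i x y hi := (hm.le_iff x y i).2 (hl.top hL hi x y)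
  eq_iff i j x y := by
    rw [hm.le_iff]
    constructor
    · intro h1
      have h2 := congrArg h h1
      rw [hl.height, hl.height] at h2
      subst h2
      exact ⟨rfl, h1⟩
    · rintro ⟨rfl, h1⟩
      exact h1
  adj_iff i j x y := by
    rw [hL.adj_iff, hl.parent, hl.parent, hm.le_iff, hm.le_iff]
    have key : ∀ i j x y, lam (i + 1) x = lam j y ↔ j = i + 1 ∧ lam j x = lam j y := by
      intro i j x y
      constructor
      · intro h1
        have h2 := congrArg h h1
        rw [hl.height, hl.height] at h2
        subst h2
        exact ⟨rfl, h1⟩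
      · rintro ⟨rfl, h1⟩
        exact h1
    rw [key, key, eq_comm (a := lam i y)]
  dyn := hl.map
  height i x := by rw [hL.height_eq, hl.height]
  N_eq := hL.N_eq hL.height_map
  dist i j x y := by
    -- the lowest common vertex `l` of the rays up from the two vertices
    have hmono := TreeLabels.relHeight_strictMono (o := o) hL hl
    have hup : ∀ i l x, i ≤ l → X.d (lam i x) (lam l x) = X.elev p N (lam 0 o) *
        (X.relHeight p N lam o l - X.relHeight p N lam o i) := by
      intro i l x hil
      obtain ⟨k, rfl⟩ := Int.exists_add_of_le hil
      rw [← hl.iterate_parent, hL.d_iterate, hl.iterate_parent, hl.elev_lam hL (o := o) (i + k) x,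
        hl.elev_lam hL (o := o) i x]
      ring
    have hmeet : ∀ l, i ≤ l → j ≤ l → lam l x = lam l y →
        X.d (lam i x) (lam l x) + X.d (lam l x) (lam j y) = X.d (lam i x) (lam j y) →
        max (max (X.relHeight p N lam o i) (X.relHeight p N lam o j)) (ρ x y) =
          X.relHeight p N lam o l → X.d (lam i x) (lam j y) = X.elev p N (lam 0 o) *
        (2 * max (max (X.relHeight p N lam o i) (X.relHeight p N lam o j)) (ρ x y) -
          X.relHeight p N lam o i - X.relHeight p N lam o j) := by
      intro l hil hjl hxy hd hmax
      rw [hmax, ← hd, hup i l x hil, hxy, X.heightMetric.symm, hup j l y hjl]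
      ring
    by_cases hcase : ρ x y ≤ max (X.relHeight p N lam o i) (X.relHeight p N lam o j)
    · rcases le_total i j with hij | hij
      · rw [max_eq_right (hmono.monotone hij)] at hcase
        have h1 := (hm.le_iff _ _ _).1 hcase
        refine hmeet j hij le_rfl h1 ?_ ?_
        · rw [h1, X.heightMetric.self, add_zero]
        · rw [max_eq_right (hmono.monotone hij), max_eq_left hcase]
      · rw [max_eq_left (hmono.monotone hij)] at hcase
        have h1 := (hm.le_iff _ _ _).1 hcase
        refine hmeet i le_rfl hij h1 ?_ ?_
        · rw [X.heightMetric.self, zero_add]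
        · rw [max_eq_left (hmono.monotone hij), max_eq_left hcase]
    · rw [not_le] at hcase
      obtain ⟨l, hl'⟩ := (hm.value x y).resolve_left fun h0 => by
        rw [h0] at hcase
        exact absurd ((TreeLabels.relHeight_pos hL i).trans_le (le_max_left _ _)) (not_lt.2 hcase.le)
      rw [← hl', max_lt_iff, hmono.lt_iff_lt, hmono.lt_iff_lt] at hcase
      have h1 : lam l x = lam l y := (hm.le_iff _ _ _).1 hl'.ge
      have h2 : lam (l - 1) x ≠ lam (l - 1) y := fun h3 => by
        have := (hm.le_iff _ _ _).2 h3
        rw [← hl', hmono.le_iff_le] at this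
        omega
      refine hmeet l hcase.1.le hcase.2.le h1 ?_ ?_
      · have h3 : lam l x = p (lam (l - 1) x) := by rw [hl.parent, sub_add_cancel]
        rw [h3]
        refine (hL.d_add ⟨(l - 1 - i).toNat, ?_⟩ ?_).2
        · rw [hl.iterate_parent]
          congr 1
          omega
        · rintro ⟨n, hn⟩
          rw [hl.iterate_parent] at hn
          have h4 := congrArg h hn
          rw [hl.height, hl.height] at h4
          rw [h4] at hn
          exact h2 hn.symm
      · rw [hl']
        refine max_eq_right (max_le ?_ ?_)
        · rw [← hl']
          exact hmono.monotone hcase.1.le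
        · rw [← hl']
          exact hmono.monotone hcase.2.le

end IsMergeMetric

/-- Every metrized polynomial-like tree is the tree of a tree metric. -/
theorem MTree.exists_isLabelled (hD : 2 ≤ D) (X : MTree D) :
    ∃ ρ c, IsTreeMetric ρ ∧ IsLabelled X ρ c := by
  obtain ⟨p, h, N, hL, hFp, hN, hh⟩ := X.exists_isLeveled hD
  obtain ⟨degV, degE, hdeg, hsum⟩ := X.polyLike.hasDegree
  have hL' : X.IsDynLeveled p h N := ⟨hL, hD, hFp, hN, hh⟩
  obtain ⟨lam, hl⟩ := hL.exists_labels (by omega) hFp hN hh hdeg hsum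
  let o : Code D := fun _ => ⟨0, by omega⟩
  choose ρ h1 h2 using fun x y => hl.exists_merge (o := o) hL' x y
  have hm : IsMergeMetric X p N lam o ρ := ⟨h1, h2⟩
  exact ⟨ρ, _, hm.isTreeMetric hL' hl hdeg, N, _, lam, hm.isEnum hL' hl, hm.labelling hL' hl⟩

/-! ### Truncation respects isomorphism -/

namespace IsTreeMetric

variable {ρ : Code D → Code D → ℝ}

lemma exists_branch (hρ : IsTreeMetric ρ) (k : ℕ) (w : Code D) :
    ∃ a b, (∀ n < k, w n = a n) ∧ (∀ n < k, w n = b n) ∧ ρ a b = ((D : ℝ)⁻¹) ^ k := by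
  induction k generalizing w with
  | zero =>
    obtain ⟨a, b, hab⟩ := hρ.exists_one
    exact ⟨a, b, by simp, by simp, by simpa using hab⟩
  | succ k ih =>
    obtain ⟨a, b, ha, hb, hab⟩ := ih (Code.shift w)
    refine ⟨Code.cons (w 0) a, Code.cons (w 0) b, ?_, ?_, ?_⟩
    · rintro (_ | n) hn
      · rfl
      · exact ha n (by omega)
    · rintro (_ | n) hn
      · rfl
      · exact hb n (by omega)
    · rw [hρ.cons, hab, pow_succ, div_eq_mul_inv]

/-- Every ball meets arbitrarily many smaller balls. -/
lemma exists_le_cnt (hρ : IsTreeMetric ρ) {s : ℝ} (hs : 0 < s) (w : Code D) (M : ℕ) :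
    ∃ s', 0 < s' ∧ s' ≤ s ∧ M ≤ cnt ρ s' (ball ρ s w) := by
  induction M with
  | zero => exact ⟨s, hs, le_rfl, Nat.zero_le _⟩
  | succ M ih =>
    obtain ⟨s', hs', hss, hM⟩ := ih
    obtain ⟨k, hk⟩ := hρ.exists_pow_lt hs'
    obtain ⟨a, b, ha, hb, hab⟩ := hρ.exists_branch k w
    have hpos : 0 < ((D : ℝ)⁻¹) ^ k := pow_pos (inv_pos.2 hρ.pos') k
    have hwa := (hρ.le_of_agree k ha).trans hk.le
    have hwb := (hρ.le_of_agree k hb).trans hk.le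
    let t := ((D : ℝ)⁻¹) ^ k / 2
    have ht : 0 < t := half_pos hpos
    have hts : t ≤ s' := (half_le_self hpos.le).trans hk.le
    refine ⟨t, ht, hts.trans hss, hM.trans_lt ?_⟩
    let g : Set (Code D) → Set (Code D) := fun B => {x | ∃ y ∈ B, ρ y x ≤ s'}
    have hg : ∀ y, g (ball ρ t y) = ball ρ s' y := by
      intro y
      ext x
      constructor
      · rintro ⟨z, hz, hzx⟩
        exact hρ.ultra_le ((mem_ball.1 hz).trans hts) hzx
      · exact fun hx => ⟨y, mem_ball.2 (by rw [hρ.refl]; exact ht.le), hx⟩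
    have himg : ball ρ s' '' ball ρ s w = g '' (ball ρ t '' ball ρ s w) := by
      rw [Set.image_image]
      exact Set.image_congr fun y _ => (hg y).symm
    have hfin := hρ.finite_image_ball ht (ball ρ s w)
    rw [cnt, himg, cnt]
    refine lt_of_le_of_ne (Set.ncard_image_le hfin) fun h => ?_
    have hinj := (Set.ncard_image_iff hfin).1 h
    have h1 := hinj ⟨a, hwa.trans hss, rfl⟩ ⟨b, hwb.trans hss, rfl⟩ (by
      rw [hg, hg, hρ.ball_eq_iff hs'.le]
      exact hρ.ultra_le (hρ.symm_le hwa) hwb)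
    rw [hρ.ball_eq_iff ht.le, hab] at h1
    exact absurd h1 (not_le.2 (half_lt_self hpos))

/-- Each point of height `D s'` below the image of a point of degree `m` has at most `m`
preimages below that point. -/
lemma cnt_le_deg_mul (hρ : IsTreeMetric ρ) {s s' : ℝ} (hs' : 0 < s') (z : Code D) :
    cnt ρ s' (ball ρ s z) ≤
      deg ρ s z * cnt ρ (D * s') (ball ρ (D * s) (Code.shift z)) := by
  classical
  have hD := hρ.pos'
  let A : Finset (Fin D) := Finset.univ.filter fun a => ρ (Code.cons a (Code.shift z)) z ≤ s
  let g : Fin D × Set (Code D) → Set (Code D) := fun q =>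
    {y | ∃ v ∈ q.2, ρ (Code.cons q.1 v) y ≤ s'}
  have hle : ∀ {r : ℝ} a u v, ρ u v ≤ D * r → ρ (Code.cons a u) (Code.cons a v) ≤ r := by
    intro r a u v h
    rwa [hρ.cons, div_le_iff₀ hD, mul_comm]
  have hsub : ball ρ s' '' ball ρ s z ⊆
      g '' ((A : Set (Fin D)) ×ˢ (ball ρ (D * s') '' ball ρ (D * s) (Code.shift z))) := by
    rintro _ ⟨y, hy, rfl⟩
    rw [mem_ball] at hy
    have h1 : ρ (Code.shift z) (Code.shift y) ≤ D * s :=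
      (hρ.shift z y).trans (mul_le_mul_of_nonneg_left hy hD.le)
    refine ⟨(y 0, ball ρ (D * s') (Code.shift y)), ⟨?_, Code.shift y, h1, rfl⟩, ?_⟩
    · simp only [A, Finset.coe_filter, Finset.mem_univ, true_and, Set.mem_ofPred_eq]
      refine hρ.ultra_le ?_ (hρ.symm_le hy)
      have h2 := hle (y 0) _ _ h1
      rwa [cons_shift] at h2
    · ext x
      constructor
      · rintro ⟨v, hv, hvx⟩
        have h2 := hle (y 0) _ _ (mem_ball.1 hv)
        rw [cons_shift] at h2
        exact hρ.ultra_le h2 hvx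
      · intro hx
        refine ⟨Code.shift y, mem_ball.2 ?_, ?_⟩
        · rw [hρ.refl]
          positivity
        · rw [cons_shift]
          exact hx
  have hfin : ((A : Set (Fin D)) ×ˢ
      (ball ρ (D * s') '' ball ρ (D * s) (Code.shift z))).Finite :=
    A.finite_toSet.prod (hρ.finite_image_ball (by positivity) _)
  calc cnt ρ s' (ball ρ s z) ≤ _ := Set.ncard_le_ncard hsub (hfin.image g)
    _ ≤ _ := Set.ncard_image_le hfin
    _ = _ := by rw [Set.ncard_prod, Set.ncard_coe_finset]; rfl

end IsTreeMetric

namespace IsIsom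

variable {ρ ρ' : Code D → Code D → ℝ} {Θ : Code D → Code D}

lemma cnt_ball (hρ : IsTreeMetric ρ) (hρ' : IsTreeMetric ρ') (h : IsIsom ρ' ρ Θ) {s s' : ℝ}
    (hs' : 0 < s') (hss : s' ≤ s) (z : Code D) :
    cnt ρ' s' (ball ρ' s z) = cnt ρ s' (ball ρ s (Θ z)) := by
  have : Nonempty (Code D) := ⟨z⟩
  have h1 : ball ρ s' '' ball ρ s (Θ z) = (fun x => ball ρ s' (Θ x)) '' ball ρ' s z := by
    ext B
    constructor
    · rintro ⟨y, hy, rfl⟩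
      obtain ⟨x, hx⟩ := h.dense y s' hs'
      refine ⟨x, ?_, (hρ.ball_eq_iff hs'.le).2 hx⟩
      rw [mem_ball, ← h.isometry]
      exact hρ.ultra_le hy ((hρ.symm_le hx).trans hss)
    · rintro ⟨x, hx, rfl⟩
      refine ⟨Θ x, ?_, rfl⟩
      rw [mem_ball, h.isometry]
      exact hx
  rw [cnt, cnt, h1]
  refine ncard_image_eq_of_iff _ _ (fun a b => ?_) _
  rw [hρ.ball_eq_iff hs'.le, hρ'.ball_eq_iff hs'.le, h.isometry]

/-- The local degree is determined by the growth of the numbers of balls, hence is preserved by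
isomorphisms. -/
lemma deg_le (hρ : IsTreeMetric ρ) (hρ' : IsTreeMetric ρ') (h : IsIsom ρ' ρ Θ) {s : ℝ}
    (hs : 0 < s) (z : Code D) : deg ρ' s z ≤ deg ρ s (Θ z) := by
  have hD := hρ.pos'
  obtain ⟨r, hr, hrs, hM⟩ := hρ'.exists_le_cnt (mul_pos hD hs) (Code.shift z) (deg ρ' s z)
  have hr' : r = D * (r / D) := (mul_div_cancel₀ _ hD.ne').symm
  have hs' : 0 < r / D := div_pos hr hD
  have hss : r / D ≤ s := by rwa [div_le_iff₀ hD, mul_comm]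
  have h1 := hρ'.riemannHurwitz z s (r / D) hs' hss
  have h2 := hρ.cnt_le_deg_mul (s := s) hs' (Θ z)
  have h3 : ball ρ (D * s) (Code.shift (Θ z)) = ball ρ (D * s) (Θ (Code.shift z)) := by
    rw [hρ.ball_eq_iff (by positivity), h.shift]
    positivity
  rw [h3, ← h.cnt_ball hρ hρ' hs' hss, ← hr', ← h.cnt_ball hρ hρ' hr hrs] at h2
  rw [← hr'] at h1
  by_contra! hlt
  have h4 := Nat.mul_le_mul_right (cnt ρ' r (ball ρ' (D * s) (Code.shift z))) (Nat.succ_le_of_lt hlt)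
  rw [Nat.succ_mul] at h4
  omega

/-- The inverse branches of the dynamics at an end can be matched, up to a given height, with the
inverse branches at the corresponding end. -/
lemma exists_perm (hρ : IsTreeMetric ρ) (hρ' : IsTreeMetric ρ') (h : IsIsom ρ' ρ Θ) {t : ℝ}
    (ht : 0 < t) (u : Code D) :
    ∃ π : Equiv.Perm (Fin D), ∀ a, ρ (Θ (cons a u)) (cons (π a) (Θ u)) ≤ t := by
  classical
  let f : Fin D → Set (Code D) := fun a => ball ρ t (Θ (cons a u))
  let g : Fin D → Set (Code D) := fun a => ball ρ t (cons a (Θ u))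
  let S := Finset.univ.image f
  have hfg : ∀ c ∈ S, (Finset.univ.filter fun a => f a = c).card ≤
      (Finset.univ.filter fun a => g a = c).card := by
    intro c hc
    obtain ⟨b, -, rfl⟩ := Finset.mem_image.1 hc
    have h1 := h.deg_le hρ hρ' ht (cons b u)
    refine le_trans (le_of_eq ?_) (h1.trans (le_of_eq ?_))
    · rw [deg]
      congr 1
      refine Finset.filter_congr fun a _ => ?_
      rw [shift_cons, ← h.isometry, hρ.ball_eq_iff ht.le]
    · rw [deg]
      congr 1
      refine Finset.filter_congr fun a _ => ?_
      have h2 := h.shift (cons b u)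
      rw [shift_cons] at h2
      have h3 : ρ (cons a (Code.shift (Θ (cons b u)))) (cons a (Θ u)) ≤ t := by
        rw [hρ.cons, h2, zero_div]
        exact ht.le
      rw [hρ.ball_eq_iff ht.le]
      exact ⟨fun h4 => hρ.ultra_le (hρ.symm_le h3) h4, fun h4 => hρ.ultra_le h3 h4⟩
  have hf : ∑ c ∈ S, (Finset.univ.filter fun a => f a = c).card = D := by
    rw [← Finset.card_eq_sum_card_fiberwise fun a _ => Finset.mem_image_of_mem f (Finset.mem_univ a)]
    simp
  have hg : ∑ c ∈ S, (Finset.univ.filter fun a => g a = c).card =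
      (Finset.univ.filter fun a => g a ∈ S).card := by
    rw [Finset.card_eq_sum_card_fiberwise (s := Finset.univ.filter fun a => g a ∈ S) (f := g)
      (t := S) fun a ha => (Finset.mem_filter.1 ha).2]
    refine Finset.sum_congr rfl fun c hc => ?_
    rw [Finset.filter_filter]
    congr 1
    refine Finset.filter_congr fun a _ => ?_
    exact ⟨fun h1 => ⟨h1 ▸ hc, h1⟩, fun h1 => h1.2⟩
  have hgle : (Finset.univ.filter fun a => g a ∈ S).card ≤ D := by
    simpa using Finset.card_filter_le (Finset.univ : Finset (Fin D)) fun a => g a ∈ S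
  have hsum := Finset.sum_le_sum hfg
  have hall : (Finset.univ.filter fun a => g a ∈ S) = Finset.univ :=
    Finset.eq_univ_of_card _ (by rw [Fintype.card_fin]; omega)
  have hmem : ∀ a, g a ∈ S := fun a => by
    have := Finset.mem_univ a
    rw [← hall] at this
    exact (Finset.mem_filter.1 this).2
  have heq : ∀ c, (Finset.univ.filter fun a => f a = c).card =
      (Finset.univ.filter fun a => g a = c).card := by
    intro c
    by_cases hc : c ∈ S
    · exact (Finset.sum_eq_sum_iff_of_le hfg).1 (by omega) c hc
    · rw [Finset.filter_eq_empty_iff.2 fun a _ ha =>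
          hc (by rw [← ha]; exact Finset.mem_image_of_mem f (Finset.mem_univ a)),
        Finset.filter_eq_empty_iff.2 fun a _ ha => hc (by rw [← ha]; exact hmem a)]
  refine ⟨Equiv.ofFiberEquiv (f := f) (g := g) fun c => Fintype.equivOfCardEq ?_, fun a => ?_⟩
  · rw [Fintype.card_subtype, Fintype.card_subtype]
    exact heq c
  · rw [← hρ.ball_eq_iff ht.le]
    exact (Equiv.ofFiberEquiv_map (f := f) (g := g) _ a).symm

/-- Isomorphic tree metrics have isomorphic truncations: an isomorphism can be corrected below
the height of truncation so as to act on each letter by a permutation. -/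
lemma exists_trunc (hρ : IsTreeMetric ρ) (hρ' : IsTreeMetric ρ') (h : IsIsom ρ' ρ Θ) {t : ℝ}
    (ht : 0 < t) (ht1 : t ≤ 1) : ∃ Φ, IsIsom (trunc t ρ') (trunc t ρ) Φ := by
  have hD := hρ.pos'
  have hD1 := hρ.one_lt'
  obtain ⟨rep, hrep, hrep'⟩ : ∃ rep : Code D → Code D, (∀ u, ρ' u (rep u) ≤ D * t) ∧
      ∀ u v, ρ' u v ≤ D * t → rep u = rep v := by
    obtain ⟨Z, f, hZ⟩ := hρ'.exists_reps (mul_pos hD ht)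
    exact ⟨f, hZ.le, hZ.congr⟩
  choose π₀ hπ₀ using fun u => h.exists_perm hρ hρ' ht u
  -- the permutation of the letters depends only on the ball of radius `D * t` of the remaining word
  let π : Code D → Equiv.Perm (Fin D) := fun u => π₀ (rep u)
  have hπ : ∀ a u, ρ (Θ (cons a u)) (cons (π u a) (Θ u)) ≤ t := by
    intro a u
    have h1 : ρ (Θ (cons a u)) (Θ (cons a (rep u))) ≤ t := by
      rw [h.isometry, hρ'.cons, div_le_iff₀ hD, mul_comm]
      exact hrep u
    have h2 : ρ (cons (π u a) (Θ (rep u))) (cons (π u a) (Θ u)) ≤ t := by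
      rw [hρ.cons, h.isometry, hρ'.symm, div_le_iff₀ hD, mul_comm]
      exact hrep u
    exact hρ.ultra_le (hρ.ultra_le h1 (hπ₀ (rep u) a)) h2
  let Φ : Code D → Code D := fun x n => π (Code.shift^[n + 1] x) (x n)
  have hΦ : ∀ a u, Φ (cons a u) = cons (π u a) (Φ u) := by
    intro a u
    funext n
    cases n <;> rfl
  have hnear : ∀ (n : ℕ) x, ρ (Θ x) (Φ x) ≤ max t (((D : ℝ)⁻¹) ^ n) := by
    intro n
    induction n with
    | zero => exact fun x => by simpa using Or.inr (hρ.le_one _ _)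
    | succ n ih =>
      intro x
      rw [← cons_shift x, hΦ]
      refine hρ.ultra_le ((hπ _ _).trans (le_max_left _ _)) ?_
      rw [hρ.cons, div_le_iff₀ hD, max_mul_of_nonneg _ _ hD.le, pow_succ, mul_assoc,
        inv_mul_cancel₀ hD.ne', mul_one]
      refine (ih _).trans (max_le_max ?_ le_rfl)
      exact le_mul_of_one_le_right ht.le hD1.le
  have hclose : ∀ x, ρ (Θ x) (Φ x) ≤ t := by
    intro x
    obtain ⟨n, hn⟩ := hρ.exists_pow_lt ht
    have := hnear n x
    rwa [max_eq_left hn.le] at this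
  have hT := hρ.trunc ht.le ht1
  have hT' := hρ'.trunc ht.le ht1
  have hiso : ∀ (n : ℕ) x y,
      |trunc t ρ (Φ x) (Φ y) - trunc t ρ' x y| ≤ ((D : ℝ)⁻¹) ^ n := by
    intro n
    induction n with
    | zero =>
      intro x y
      have h1 := hT.nonneg (Φ x) (Φ y)
      have h2 := hT.le_one (Φ x) (Φ y)
      have h3 := hT'.nonneg x y
      have h4 := hT'.le_one x y
      rw [pow_zero, abs_le]
      constructor <;> linarith
    | succ n ih =>
      intro x y
      have hnn : 0 ≤ ((D : ℝ)⁻¹) ^ (n + 1) := pow_nonneg (inv_nonneg.2 hD.le) _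
      have hst : ∀ x y : Code D, t * std x y ≤ t := fun x y =>
        mul_le_of_le_one_right ht.le (std_le_one x y)
      rcases lt_or_ge t (ρ' x y) with hxy | hxy
      · rw [← h.isometry] at hxy
        have h1 := hρ.eq_of_close ((hclose x).trans_lt hxy) ((hclose y).trans_lt hxy)
        rw [trunc, trunc, h1, ← h.isometry, max_eq_left ((hst _ _).trans hxy.le),
          max_eq_left ((hst _ _).trans hxy.le), sub_self, abs_zero]
        exact hnn
      · have hπeq : π (Code.shift x) = π (Code.shift y) := by
          have := hrep' (Code.shift x) (Code.shift y)
            ((hρ'.shift x y).trans (mul_le_mul_of_nonneg_left hxy hD.le))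
          simp only [π, this]
        by_cases h0 : x 0 = y 0
        · rw [← cons_shift x, ← cons_shift y, hΦ, hΦ, hπeq, h0, trunc_cons hρ, trunc_cons hρ',
            ← sub_div, abs_div, abs_of_pos hD, div_le_iff₀ hD, pow_succ, mul_assoc,
            inv_mul_cancel₀ hD.ne', mul_one]
          exact ih _ _
        · have h0' : Φ x 0 ≠ Φ y 0 := by
            intro h1
            have h2 : π (Code.shift x) (x 0) = π (Code.shift y) (y 0) := h1
            rw [hπeq] at h2
            exact h0 ((π _).injective h2)
          have h1 : ρ (Φ x) (Φ y) ≤ t := by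
            refine hρ.ultra_le (hρ.ultra_le (hρ.symm_le (hclose x)) ?_) (hclose y)
            rw [h.isometry]
            exact hxy
          rw [trunc, trunc, std_of_ne h0, std_of_ne h0', mul_one, max_eq_right h1,
            max_eq_right hxy, sub_self, abs_zero]
          exact hnn
  refine ⟨Φ, fun x y => ?_, fun x => hT.refl _, fun y ε hε => ?_⟩
  · by_contra hne
    obtain ⟨n, hn⟩ := hρ.exists_pow_lt (abs_pos.2 (sub_ne_zero.2 hne))
    exact absurd (hiso n x y) (not_le.2 hn)
  · have key : ∀ (k : ℕ) (y : Code D), ∃ x, ∀ n < k, Φ x n = y n := by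
      intro k
      induction k with
      | zero => exact fun y => ⟨y, by simp⟩
      | succ k ih =>
        intro y
        obtain ⟨x, hx⟩ := ih (Code.shift y)
        refine ⟨cons ((π x).symm (y 0)) x, ?_⟩
        rw [hΦ, Equiv.apply_symm_apply]
        rintro (_ | n) hn
        · rfl
        · exact hx n (by omega)
    obtain ⟨n, hn⟩ := hρ.exists_pow_lt hε
    obtain ⟨x, hx⟩ := key n y
    exact ⟨x, (hT.le_of_agree n hx).trans hn.le⟩

end IsIsom

/-! ### Images of metrizable spaces under closed maps -/

section ClosedMap

universe u v

variable {A : Type u} {B : Type v} [TopologicalSpace A] [TopologicalSpace B] {f : A → B}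

lemma isOpen_setOf_fiber_subset (hf : IsClosedMap f) {U : Set A} (hU : IsOpen U) :
    IsOpen {b | f ⁻¹' {b} ⊆ U} := by
  have h : {b | f ⁻¹' {b} ⊆ U} = (f '' Uᶜ)ᶜ := by
    ext b
    simp only [Set.mem_ofPred_eq, Set.mem_compl_iff, Set.mem_image, not_exists, not_and]
    exact ⟨fun h a ha hab => ha (h hab), fun h a hab => by_contra fun ha => h a ha hab⟩
  rw [h]
  exact (hf _ hU.isClosed_compl).isOpen_compl

lemma t1Space_of_isClosedMap [T1Space A] (hf : IsClosedMap f) (hs : f.Surjective) : T1Space B where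
  t1 b := by
    obtain ⟨a, rfl⟩ := hs b
    rw [← Set.image_singleton]
    exact hf _ isClosed_singleton

lemma normalSpace_of_isClosedMap [NormalSpace A] (hf : IsClosedMap f) (hc : Continuous f)
    (hs : f.Surjective) : NormalSpace B where
  normal s t hs' ht hst := by
    obtain ⟨U, V, hU, hV, hsU, htV, hUV⟩ := NormalSpace.normal (f ⁻¹' s) (f ⁻¹' t)
      (hs'.preimage hc) (ht.preimage hc) (hst.preimage f)
    refine ⟨_, _, isOpen_setOf_fiber_subset hf hU, isOpen_setOf_fiber_subset hf hV, ?_, ?_, ?_⟩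
    · rintro b hb a rfl
      exact hsU hb
    · rintro b hb a rfl
      exact htV hb
    · rw [Set.disjoint_left]
      intro b hb hb'
      obtain ⟨a, rfl⟩ := hs b
      exact Set.disjoint_left.1 hUV (hb rfl) (hb' rfl)

lemma secondCountableTopology_of_isClosedMap [SecondCountableTopology A] (hf : IsClosedMap f)
    (hc : Continuous f) (hs : f.Surjective) (hcomp : ∀ b, IsCompact (f ⁻¹' {b})) :
    SecondCountableTopology B := by
  obtain ⟨S, hS, -, hb⟩ := TopologicalSpace.exists_countable_basis A
  let 𝓕 : Set (Set (Set A)) := {W | W.Finite ∧ W ⊆ S}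
  have h𝓕 : 𝓕.Countable := Set.countable_ofPred_finite_subset hS
  refine (TopologicalSpace.isTopologicalBasis_of_isOpen_of_nhds
    (s := (fun W : Set (Set A) => {b | f ⁻¹' {b} ⊆ ⋃₀ W}) '' 𝓕) ?_ ?_).secondCountableTopology
    (h𝓕.image _)
  · rintro _ ⟨W, hW, rfl⟩
    exact isOpen_setOf_fiber_subset hf (isOpen_sUnion fun U hU => hb.isOpen (hW.2 hU))
  · intro b G hbG hG
    have hG' := hG.preimage hc
    have hcov : f ⁻¹' {b} ⊆ ⋃ U : {U // U ∈ S ∧ U ⊆ f ⁻¹' G}, U.1 := by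
      intro a ha
      obtain ⟨U, hU, haU, hUG⟩ := hb.exists_subset_of_mem_open (u := f ⁻¹' G) (a := a)
        (by rw [Set.mem_preimage, ha]; exact hbG) hG'
      exact Set.mem_iUnion.2 ⟨⟨U, hU, hUG⟩, haU⟩
    obtain ⟨t, ht⟩ := (hcomp b).elim_finite_subcover _ (fun U => hb.isOpen U.2.1) hcov
    refine ⟨_, ⟨Subtype.val '' (t : Set {U // U ∈ S ∧ U ⊆ f ⁻¹' G}), ⟨t.finite_toSet.image _, ?_⟩,
      rfl⟩, ?_, ?_⟩
    · rintro _ ⟨U, -, rfl⟩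
      exact U.2.1
    · intro a ha
      obtain ⟨U, hU, haU⟩ := Set.mem_iUnion₂.1 (ht ha)
      exact ⟨U.1, ⟨U, hU, rfl⟩, haU⟩
    · intro b' hb'
      obtain ⟨a, rfl⟩ := hs b'
      obtain ⟨_, ⟨U, -, rfl⟩, haU⟩ := hb' rfl
      exact U.2.2 haU

lemma metrizableSpace_of_isClosedMap [TopologicalSpace.MetrizableSpace A]
    [SecondCountableTopology A] (hf : IsClosedMap f)
    (hc : Continuous f) (hs : f.Surjective) (hcomp : ∀ b, IsCompact (f ⁻¹' {b})) :
    TopologicalSpace.MetrizableSpace B := by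
  have := t1Space_of_isClosedMap hf hs
  have := normalSpace_of_isClosedMap hf hc hs
  have := secondCountableTopology_of_isClosedMap hf hc hs hcomp
  infer_instance

end ClosedMap

/-! ### The moduli space as an image of the space of tree metrics -/

lemma MTree.Equivalent.isLabelled (hD : 2 ≤ D) {X Y : MTree D} (h : MTree.Equivalent X Y)
    {ρ : Code D → Code D → ℝ} {c : ℝ} (hρ : IsTreeMetric ρ) (hY : IsLabelled Y ρ c) :
    IsLabelled X ρ c := by
  obtain ⟨ρ', c', hρ', hX⟩ := X.exists_isLabelled hD
  obtain ⟨rfl, Θ, hΘ⟩ := h.exists_isIsom hρ' hX hρ hY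
  exact hΘ.isLabelled hρ' hX

/-- The class of the tree labelled by a tree metric, with the base at a given height. -/
noncomputable def treeClass (p : TreeMetric D × PosReal) : TD D :=
  TD.mk (p.1.2.exists_labelled p.2.2).choose

lemma treeClass_eq {p : TreeMetric D × PosReal} {X : MTree D} (hX : IsLabelled X p.1.1 p.2.1) :
    treeClass p = TD.mk X :=
  Quotient.sound ((p.1.2.exists_labelled p.2.2).choose_spec.equivalent hX)

lemma isLabelled_of_treeClass_eq (hD : 2 ≤ D) {p : TreeMetric D × PosReal} {X : MTree D}
    (h : TD.mk X = treeClass p) : IsLabelled X p.1.1 p.2.1 :=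
  MTree.Equivalent.isLabelled hD (Quotient.exact h) p.1.2 (p.1.2.exists_labelled p.2.2).choose_spec

lemma treeClass_eq_treeClass {p q : TreeMetric D × PosReal} :
    treeClass p = treeClass q ↔ q.2 = p.2 ∧ ∃ Θ, IsIsom q.1.1 p.1.1 Θ := by
  obtain ⟨X, hX⟩ := p.1.2.exists_labelled p.2.2
  obtain ⟨Y, hY⟩ := q.1.2.exists_labelled q.2.2
  rw [treeClass_eq hX, treeClass_eq hY]
  constructor
  · intro h
    obtain ⟨h1, h2⟩ := MTree.Equivalent.exists_isIsom (Quotient.exact h) p.1.2 hX q.1.2 hY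
    exact ⟨Subtype.ext h1, h2⟩
  · rintro ⟨h1, Θ, hΘ⟩
    have h2 := hΘ.isLabelled p.1.2 hX
    rw [← h1] at h2
    exact Quotient.sound (h2.equivalent hY)

lemma treeClass_surjective (hD : 2 ≤ D) : Function.Surjective (treeClass (D := D)) := by
  rintro ⟨X⟩
  obtain ⟨ρ, c, hρ, hX⟩ := X.exists_isLabelled hD
  obtain ⟨N, ι, lam, hι, hl⟩ := id hX
  exact ⟨(⟨ρ, hρ⟩, ⟨c, hl.scale_pos hρ hι⟩), treeClass_eq hX⟩

lemma StrongLimit.tendsto {X : ℕ → MTree D} {Y : MTree D} (h : StrongLimit X Y) :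
    Tendsto (fun n => TD.mk (X n)) atTop (𝓝 (TD.mk Y)) :=
  tendsto_nhds.2 fun _ hU hY => hU X Y h hY

lemma continuous_treeClass (hD : 2 ≤ D) : Continuous (treeClass (D := D)) := by
  have := metrizableSpace_treeMetric hD
  refine continuous_iff_continuousAt.2 fun p => ?_
  refine tendsto_of_subseq_tendsto fun ns hns => ?_
  obtain ⟨Y, hY⟩ := p.1.2.exists_labelled p.2.2
  choose X hX using fun n => (ns n).1.2.exists_labelled (ns n).2.2
  have h1 : Tendsto (fun n => (ns n).1) atTop (𝓝 p.1) := (continuous_fst.tendsto p).comp hns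
  have h2 : Tendsto (fun n => (ns n).2.1) atTop (𝓝 p.2.1) :=
    ((continuous_subtype_val.comp continuous_snd).tendsto p).comp hns
  obtain ⟨φ, -, hφ⟩ := exists_strongLimit_subseq (fun n => (ns n).1.2) hX p.1.2
    (tendsto_treeMetric.1 h1) p.2.2 h2 hY
  refine ⟨φ, ?_⟩
  simp_rw [treeClass_eq (hX _), treeClass_eq hY]
  exact hφ.tendsto

/-- The height of the base is comparable to the distance from the base to the vertex `v_D`. -/
lemma IsLabelled.scale_bounds {X : MTree D} {ρ : Code D → Code D → ℝ} {c : ℝ}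
    (hρ : IsTreeMetric ρ) (hX : IsLabelled X ρ c) :
    c * (D - 1) ≤ X.d X.base (X.spine D) ∧ X.d X.base (X.spine D) ≤ c * D ^ D := by
  obtain ⟨N, ι, lam, hι, hl⟩ := hX
  obtain ⟨o, -⟩ := hρ.exists_one
  have hc := hl.scale_pos hρ hι
  have hN := hι.lt hρ
  have hN1 := hι.one_le
  have hmono := hι.strictMono.monotone
  have h1 : ι ((D : ℕ) : ℤ) ≤ D ^ D := by
    have h2 := hι.mul_eq hρ D
    rw [zpow_natCast] at h2
    rw [← h2]
    refine hmono ?_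
    have : (1 : ℤ) ≤ N := by exact_mod_cast hN1
    nlinarith
  have h2 : (D : ℝ) ≤ ι ((D : ℕ) : ℤ) := by
    have h3 := hι.add 0
    rw [hι.zero, mul_one, zero_add] at h3
    rw [← h3]
    exact hmono (by exact_mod_cast hN.le)
  have h3 : (0 : ℤ) ≤ ((D : ℕ) : ℤ) := Int.natCast_nonneg D
  rw [hl.base_eq o, hl.spine_eq D o, hl.dist, hρ.refl, max_eq_right (hmono h3),
    max_eq_left (hι.pos hρ _).le, hι.zero]
  constructor
  · exact mul_le_mul_of_nonneg_left (by linarith) hc.le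
  · exact mul_le_mul_of_nonneg_left (by linarith) hc.le

/-- Strong limits of trees with labels in a closed set of tree metrics have labels there: the
scales stay bounded, so the labels subconverge, and the limit is determined by them. -/
lemma isClosedMap_treeClass (hD : 2 ≤ D) : IsClosedMap (treeClass (D := D)) := by
  have := metrizableSpace_treeMetric hD
  intro C hC
  rw [← isOpen_compl_iff]
  intro X Y hXY hY
  by_contra hnot
  have hfreq : ∃ᶠ n in atTop, TD.mk (X n) ∈ treeClass '' C := by
    intro h
    exact hnot h
  apply hY
  obtain ⟨φ, hφ, hφC⟩ := extraction_of_frequently_atTop hfreq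
  choose p hpC hp using hφC
  have hlab : ∀ n, IsLabelled (X (φ n)) (p n).1.1 (p n).2.1 := fun n =>
    isLabelled_of_treeClass_eq hD (hp n).symm
  have hD1 : (1 : ℝ) < D := by exact_mod_cast hD
  have hpow : (0 : ℝ) < D ^ D := by positivity
  obtain ⟨l, hl, hlim⟩ := hXY.1.dist_pos
  have hlim' := hlim.comp hφ.tendsto_atTop
  let a : ℝ := l / 2 / D ^ D
  let b : ℝ := (l + 1) / (D - 1)
  have ha : 0 < a := by positivity
  have hev : ∀ᶠ n in atTop, (p n).2.1 ∈ Set.Icc a b := by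
    filter_upwards [hlim'.eventually_const_lt (half_lt_self hl),
      hlim'.eventually_lt_const (lt_add_one l)] with n h1 h2
    obtain ⟨h3, h4⟩ := (hlab n).scale_bounds (p n).1.2
    constructor
    · rw [div_le_iff₀ hpow]
      exact h1.le.trans h4
    · rw [le_div_iff₀ (by linarith)]
      exact h3.trans h2.le
  have hcomp : IsCompact ((Set.univ : Set (TreeMetric D)) ×ˢ Set.Icc a b) :=
    isCompact_univ.prod isCompact_Icc
  obtain ⟨q, hq, ψ, hψ, hψlim⟩ := hcomp.tendsto_subseq' (x := fun n => ((p n).1, (p n).2.1))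
    (hev.mono fun n hn => ⟨trivial, hn⟩).frequently
  have h1 := (continuous_fst.tendsto q).comp hψlim
  have h2 := (continuous_snd.tendsto q).comp hψlim
  have hq0 : 0 < q.2 := ha.trans_le hq.2.1
  obtain ⟨ρY, cY, hρY, hYlab⟩ := Y.exists_isLabelled hD
  obtain ⟨T', d', hS, hCol⟩ := hXY.2
  have hS' : IsSimplicialLimit (fun n => X (φ (ψ n))) T' d' := ⟨hS.1, fun k hk ε hε =>
    (hφ.comp hψ).tendsto_atTop.eventually (hS.2 k hk ε hε)⟩
  obtain ⟨hc, Θ, hΘ⟩ := exists_isIsom_of_limit (fun n => (p (ψ n)).1.2) (fun n => hlab (ψ n)) q.1.2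
    (tendsto_treeMetric.1 h1) hq0 h2 hρY hYlab hS' hCol
  let r : TreeMetric D × PosReal := (q.1, ⟨q.2, hq0⟩)
  have hr : Tendsto (fun n => p (ψ n)) atTop (𝓝 r) :=
    (h1.prodMk_nhds (tendsto_subtype_rng.2 h2))
  refine ⟨r, hC.mem_of_tendsto hr (Eventually.of_forall fun n => hpC _), ?_⟩
  obtain ⟨Z, hZ⟩ := q.1.2.exists_labelled hq0
  rw [treeClass_eq (p := r) hZ]
  have h3 := hΘ.isLabelled q.1.2 hZ
  rw [← hc] at h3
  exact Quotient.sound (h3.equivalent hYlab)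

lemma secondCountableTopology_treeMetric (hD : 2 ≤ D) :
    SecondCountableTopology (TreeMetric D) := by
  have := metrizableSpace_treeMetric hD
  let := TopologicalSpace.metrizableSpaceMetric (TreeMetric D)
  infer_instance

theorem metrizableSpace_TD (hD : 2 ≤ D) : TopologicalSpace.MetrizableSpace (TD D) := by
  have := metrizableSpace_treeMetric hD
  have := secondCountableTopology_treeMetric hD
  refine metrizableSpace_of_isClosedMap (isClosedMap_treeClass hD) (continuous_treeClass hD)
    (treeClass_surjective hD) fun y => ?_
  have hT1 := t1Space_of_isClosedMap (isClosedMap_treeClass hD) (treeClass_surjective hD)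
  obtain ⟨p, rfl⟩ := treeClass_surjective hD y
  refine (isCompact_univ.prod (isCompact_singleton (x := p.2))).of_isClosed_subset
    (isClosed_singleton.preimage (continuous_treeClass hD)) fun q hq => ⟨trivial, ?_⟩
  exact (treeClass_eq_treeClass.1 hq).1.symm

/-! ### The projective space -/

/-- The projective class of the tree labelled by a tree metric. -/
noncomputable def projClass (ρ : TreeMetric D) : PTD D :=
  Quotient.mk (MulAction.orbitRel PosReal (TD D)) (treeClass (ρ, 1))

lemma smul_treeClass (a : PosReal) (p : TreeMetric D × PosReal) :
    a • treeClass p = treeClass (p.1, a * p.2) := by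
  obtain ⟨X, hX⟩ := p.1.2.exists_labelled p.2.2
  rw [treeClass_eq hX, treeClass_eq (p := (p.1, a * p.2)) (hX.scale a)]
  rfl

lemma projClass_eq_mk (p : TreeMetric D × PosReal) :
    Quotient.mk (MulAction.orbitRel PosReal (TD D)) (treeClass p) = projClass p.1 := by
  refine Quotient.sound ⟨p.2, ?_⟩
  change p.2 • treeClass (p.1, 1) = treeClass p
  rw [smul_treeClass, mul_one]

lemma projClass_eq_projClass {ρ σ : TreeMetric D} :
    projClass ρ = projClass σ ↔ ∃ Θ, IsIsom σ.1 ρ.1 Θ := by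
  constructor
  · intro h
    obtain ⟨a, ha⟩ := Quotient.exact h
    change a • treeClass (σ, 1) = treeClass (ρ, 1) at ha
    rw [smul_treeClass] at ha
    exact (treeClass_eq_treeClass.1 ha.symm).2
  · intro h
    have h1 : treeClass (ρ, 1) = treeClass (σ, 1) := treeClass_eq_treeClass.2 ⟨rfl, h⟩
    rw [projClass, projClass, h1]

lemma continuous_projClass (hD : 2 ≤ D) : Continuous (projClass (D := D)) :=
  continuous_quotient_mk'.comp
    ((continuous_treeClass hD).comp (continuous_id.prodMk continuous_const))

lemma projClass_surjective (hD : 2 ≤ D) : Function.Surjective (projClass (D := D)) := by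
  rintro ⟨y⟩
  obtain ⟨p, rfl⟩ := treeClass_surjective hD y
  exact ⟨p.1, (projClass_eq_mk p).symm⟩

lemma isClosedMap_projClass (hD : 2 ≤ D) : IsClosedMap (projClass (D := D)) := by
  intro C hC
  have hpre : Quotient.mk (MulAction.orbitRel PosReal (TD D)) ⁻¹' (projClass '' C) =
      treeClass '' (C ×ˢ Set.univ) := by
    ext y
    constructor
    · rintro ⟨ρ, hρ, h⟩
      obtain ⟨a, ha⟩ := Quotient.exact h.symm
      change a • treeClass (ρ, 1) = y at ha
      rw [smul_treeClass] at ha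
      exact ⟨_, ⟨hρ, trivial⟩, ha⟩
    · rintro ⟨p, hp, rfl⟩
      exact ⟨p.1, hp.1, (projClass_eq_mk p).symm⟩
  refine (isQuotientMap_quotient_mk' (s := MulAction.orbitRel PosReal (TD D))).isClosed_preimage.1 ?_
  exact hpre ▸ isClosedMap_treeClass hD _ (hC.prod isClosed_univ)

theorem compactSpace_PTD (hD : 2 ≤ D) : CompactSpace (PTD D) :=
  (projClass_surjective hD).compactSpace (continuous_projClass hD)

theorem t2Space_PTD (hD : 2 ≤ D) : T2Space (PTD D) := by
  have := metrizableSpace_treeMetric hD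
  have := t1Space_of_isClosedMap (isClosedMap_projClass hD) (projClass_surjective hD)
  have := normalSpace_of_isClosedMap (isClosedMap_projClass hD) (continuous_projClass hD)
    (projClass_surjective hD)
  infer_instance

/-- Truncation at height `t`, as a map of the space of tree metrics. -/
noncomputable def TreeMetric.trunc (t : unitInterval) (ρ : TreeMetric D) : TreeMetric D :=
  ⟨PolyTree.trunc t.1 ρ.1, ρ.2.trunc t.2.1 t.2.2⟩

lemma continuous_trunc :
    Continuous fun q : unitInterval × TreeMetric D => TreeMetric.trunc q.1 q.2 := by
  refine Continuous.subtype_mk (continuous_pi fun x => continuous_pi fun y => ?_) _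
  have h1 : Continuous fun q : unitInterval × TreeMetric D => q.2.1 x y :=
    (continuous_apply_apply x y).comp (continuous_subtype_val.comp continuous_snd)
  exact h1.max ((continuous_subtype_val.comp continuous_fst).mul continuous_const)

lemma projClass_trunc_congr (t : unitInterval) {ρ σ : TreeMetric D}
    (h : projClass ρ = projClass σ) :
    projClass (TreeMetric.trunc t ρ) = projClass (TreeMetric.trunc t σ) := by
  obtain ⟨Θ, hΘ⟩ := projClass_eq_projClass.1 h
  refine projClass_eq_projClass.2 ?_
  rcases t.2.1.eq_or_lt with h0 | h0
  · refine ⟨Θ, ?_⟩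
    simp only [TreeMetric.trunc, ← h0, trunc_zero ρ.2, trunc_zero σ.2]
    exact hΘ
  · exact hΘ.exists_trunc ρ.2 σ.2 h0 t.2.2

/-- Truncating at heights that grow from `0` to `1` contracts the projective space to the class of
the standard tree metric. -/
theorem contractibleSpace_PTD (hD : 2 ≤ D) : ContractibleSpace (PTD D) := by
  rw [contractible_iff_id_nullhomotopic]
  let rep := Function.surjInv (projClass_surjective hD)
  have hrep : ∀ y, projClass (rep y) = y := Function.surjInv_eq _
  let H : unitInterval × PTD D → PTD D := fun q => projClass (TreeMetric.trunc q.1 (rep q.2))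
  have hquot := (isClosedMap_projClass hD).isQuotientMap (continuous_projClass hD)
    (projClass_surjective hD)
  have hH : Continuous H := by
    refine hquot.continuous_lift_prod_right ?_
    have h1 : (fun q : unitInterval × TreeMetric D => H (q.1, projClass q.2)) =
        fun q => projClass (TreeMetric.trunc q.1 q.2) := by
      funext q
      exact projClass_trunc_congr q.1 (hrep _)
    rw [h1]
    exact (continuous_projClass hD).comp continuous_trunc
  refine ⟨projClass ⟨std, isTreeMetric_std hD⟩, ⟨⟨⟨H, hH⟩, fun y => ?_, fun y => ?_⟩⟩⟩
  · change projClass (TreeMetric.trunc 0 (rep y)) = y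
    have : TreeMetric.trunc 0 (rep y) = rep y := Subtype.ext (trunc_zero (rep y).2)
    rw [this, hrep]
  · change projClass (TreeMetric.trunc 1 (rep y)) = _
    congr 1
    exact Subtype.ext (trunc_one (rep y).2)

end PolyTree

theorem theorem1p3 (D : ℕ) (hD : 2 ≤ D) :
    TopologicalSpace.MetrizableSpace (PolyTree.TD D) ∧
      CompactSpace (PolyTree.PTD D) ∧ T2Space (PolyTree.PTD D) ∧
      ContractibleSpace (PolyTree.PTD D) :=
  ⟨PolyTree.metrizableSpace_TD hD, PolyTree.compactSpace_PTD hD, PolyTree.t2Space_PTD hD,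
    PolyTree.contractibleSpace_PTD hD⟩
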